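/- \textbf{Definitions.} Let $\mathcal G$ be a hereditary family of finite graphs, i.e. a family closed under isomorphism and under taking induced subgraphs. $\mathcal G$-Sb-MWIS (Size bounded Maximum Weight Independent Set): given a graph $G\in\mathcal G$, positive integers $k,\rho$, and a weight function $w\colon V(G)\to\mathbb N$ (where $0\in\mathbb N$), decide whether $G$ has an independent set $S$ with $|S|\le k$ and $\sum_{v\in S}w(v)\ge\rho$. $\mathcal G$-Sb-CFFA (Size bounded Conflict free Fair Allocation): given a set $\mathcal A$ of $n$ agents, a set $\mathcal I$ of $m$ jobs, a utility function $u_a\colon\mathcal I\to\mathbb N$ for every agent $a$, positive integers $s,\eta$, and a conflict graph $\mathcal H\in\mathcal G$ with vertex set $\mathcal I$, decide whether there is a function $\phi\colon\mathcal A\to 2^{\mathcal I}$ such that for every $a\in\mathcal A$ the set $\phi(a)$ is independent in $\mathcal H$, $|\phi(a)|\le s$ and $\sum_{x\in\phi(a)}u_a(x)\ge\eta$, and such that $\phi(a)\cap\phi(a')=\emptyset$ for all distinct $a,a'\in\mathcal A$. Algorithms are deterministic programs of a random access machine on natural numbers with unit-cost addition, truncated subtraction, zero test and indirect addressing. Graphs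 are given by adjacency matrices, and weights, utilities and $k,\rho,s,\eta$ are single numbers. A running time is the number of executed instructions; $\log$ is to base $2$, and $0^{\log 0}:=1$. \textbf{Theorem.} Let $h$ be a function on the positive integers. Suppose that there are a constant $c$ and an algorithm that solves $\mathcal G$-Sb-MWIS in time at most $h(k)\cdot(|V(G)|+1)^{c}$. Then there are constants $C,c'$ and a deterministic algorithm that solves every instance of $\mathcal G$-Sb-CFFA in time at most $$C\cdot(3e)^{ns}\cdot(ns)^{\log (ns)}\cdot h(s)\cdot(n+m+1)^{c'} .$$ -/

import Mathlib

open scoped BigOperators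

/-! ### Random access machines with unit-cost instructions -/

/-- Programs of a random access machine over `ℕ`. The store consists of registers
`r₀, r₁, …` and arrays `A₀, A₁, …`, all holding natural numbers; a program mentions only finitely
many of them. The arithmetic instructions are addition and truncated subtraction
(there is no unit-cost multiplication). -/
inductive RAMProg : Type
  /-- do nothing -/
  | skip : RAMProg
  /-- `r_x := a` -/
  | const (x a : ℕ) : RAMProg
  /-- `r_x := r_y + r_z` -/
  | add (x y z : ℕ) : RAMProg
  /-- `r_x := max (r_y - r_z) 0` -/
  | sub (x y z : ℕ) : RAMProg
  /-- `r_x := A_b[r_y]` (indirect addressing) -/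
  | load (x b y : ℕ) : RAMProg
  /-- `A_b[r_x] := r_y` (indirect addressing) -/
  | store (b x y : ℕ) : RAMProg
  /-- sequential composition -/
  | seq (p q : RAMProg) : RAMProg
  /-- `if r_x ≠ 0 then p else q` -/
  | cond (x : ℕ) (p q : RAMProg) : RAMProg
  /-- `while r_x ≠ 0 do p` -/
  | loop (x : ℕ) (p : RAMProg) : RAMProg

/-- The contents of the registers and of the arrays. -/
structure RAMState : Type where
  reg : ℕ → ℕ
  arr : ℕ → ℕ → ℕ

/-- `r_x := v`. -/
def RAMState.setReg (σ : RAMState) (x v : ℕ) : RAMState :=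
  { σ with reg := Function.update σ.reg x v }

/-- `A_b[i] := v`. -/
def RAMState.setArr (σ : RAMState) (b i v : ℕ) : RAMState :=
  { σ with arr := Function.update σ.arr b (Function.update (σ.arr b) i v) }

/-- `RAMExec p σ t σ'`: started in `σ`, the program `p` halts in `σ'` after exactly `t` steps.
Every instruction and every test of a condition is one step. -/
inductive RAMExec : RAMProg → RAMState → ℕ → RAMState → Prop
  | skip (σ : RAMState) : RAMExec .skip σ 1 σ
  | const (x a : ℕ) (σ : RAMState) : RAMExec (.const x a) σ 1 (σ.setReg x a)
  | add (x y z : ℕ) (σ : RAMState) :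
      RAMExec (.add x y z) σ 1 (σ.setReg x (σ.reg y + σ.reg z))
  | sub (x y z : ℕ) (σ : RAMState) :
      RAMExec (.sub x y z) σ 1 (σ.setReg x (σ.reg y - σ.reg z))
  | load (x b y : ℕ) (σ : RAMState) :
      RAMExec (.load x b y) σ 1 (σ.setReg x (σ.arr b (σ.reg y)))
  | store (b x y : ℕ) (σ : RAMState) :
      RAMExec (.store b x y) σ 1 (σ.setArr b (σ.reg x) (σ.reg y))
  | seq {p q : RAMProg} {σ σ₁ σ₂ : RAMState} {t₁ t₂ : ℕ} :
      RAMExec p σ t₁ σ₁ → RAMExec q σ₁ t₂ σ₂ → RAMExec (.seq p q) σ (t₁ + t₂) σ₂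
  | cond_true {x : ℕ} {p q : RAMProg} {σ σ' : RAMState} {t : ℕ} :
      σ.reg x ≠ 0 → RAMExec p σ t σ' → RAMExec (.cond x p q) σ (t + 1) σ'
  | cond_false {x : ℕ} {p q : RAMProg} {σ σ' : RAMState} {t : ℕ} :
      σ.reg x = 0 → RAMExec q σ t σ' → RAMExec (.cond x p q) σ (t + 1) σ'
  | loop_true {x : ℕ} {p : RAMProg} {σ σ₁ σ₂ : RAMState} {t₁ t₂ : ℕ} :
      σ.reg x ≠ 0 → RAMExec p σ t₁ σ₁ → RAMExec (.loop x p) σ₁ t₂ σ₂ →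
      RAMExec (.loop x p) σ (t₁ + t₂ + 1) σ₂
  | loop_false {x : ℕ} {p : RAMProg} {σ : RAMState} :
      σ.reg x = 0 → RAMExec (.loop x p) σ 1 σ

/-- The machine is deterministic: the final state and the number of steps are determined by the
program and the initial state. -/
theorem RAMExec.deterministic {p : RAMProg} {σ σ₁ σ₂ : RAMState} {t₁ t₂ : ℕ}
    (h₁ : RAMExec p σ t₁ σ₁) (h₂ : RAMExec p σ t₂ σ₂) : t₁ = t₂ ∧ σ₁ = σ₂ := by
  induction h₁ generalizing t₂ σ₂ with
  | skip => cases h₂; exact ⟨rfl, rfl⟩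
  | const => cases h₂; exact ⟨rfl, rfl⟩
  | add => cases h₂; exact ⟨rfl, rfl⟩
  | sub => cases h₂; exact ⟨rfl, rfl⟩
  | load => cases h₂; exact ⟨rfl, rfl⟩
  | store => cases h₂; exact ⟨rfl, rfl⟩
  | seq _ _ ih₁ ih₂ =>
    cases h₂ with
    | seq a b =>
      obtain ⟨rfl, rfl⟩ := ih₁ a
      obtain ⟨rfl, rfl⟩ := ih₂ b
      exact ⟨rfl, rfl⟩
  | cond_true hx _ ih =>
    cases h₂ with
    | cond_true _ a => obtain ⟨rfl, rfl⟩ := ih a; exact ⟨rfl, rfl⟩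
    | cond_false hx' _ => exact absurd hx' hx
  | cond_false hx _ ih =>
    cases h₂ with
    | cond_true hx' _ => exact absurd hx hx'
    | cond_false _ a => obtain ⟨rfl, rfl⟩ := ih a; exact ⟨rfl, rfl⟩
  | loop_true hx _ _ ih₁ ih₂ =>
    cases h₂ with
    | loop_true _ a b =>
      obtain ⟨rfl, rfl⟩ := ih₁ a
      obtain ⟨rfl, rfl⟩ := ih₂ b
      exact ⟨rfl, rfl⟩
    | loop_false hx' => exact absurd hx' hx
  | loop_false hx =>
    cases h₂ with
    | loop_true hx' _ _ => exact absurd hx hx'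
    | loop_false _ => exact ⟨rfl, rfl⟩

/-- Started on `input`, the program `p` halts after at most `T` steps, and `r₀` is then nonzero
("yes") or zero ("no") according to whether `answer` holds. -/
def RAMProg.DecidesWithin (p : RAMProg) (input : RAMState) (answer : Prop) (T : ℝ) : Prop :=
  ∃ (t : ℕ) (σ : RAMState), RAMExec p input t σ ∧ (t : ℝ) ≤ T ∧ (σ.reg 0 ≠ 0 ↔ answer)

/-! ### Input layout -/

/-- A finite list of numbers as the contents of an array, zero elsewhere. -/
def vectorArray {c : ℕ} (f : Fin c → ℕ) : ℕ → ℕ :=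
  fun i => if h : i < c then f ⟨i, h⟩ else 0

/-- An `r × c` matrix as the contents of an array, row by row, zero elsewhere:
the entry `(i, j)` is at position `i * c + j`. -/
def matrixArray {r c : ℕ} (f : Fin r → Fin c → ℕ) : ℕ → ℕ :=
  vectorArray fun p : Fin (r * c) => f (finProdFinEquiv.symm p).1 (finProdFinEquiv.symm p).2

theorem matrixArray_apply {r c : ℕ} (f : Fin r → Fin c → ℕ) (i : Fin r) (j : Fin c) :
    matrixArray f (i * c + j) = f i j := by
  have h : (finProdFinEquiv (i, j) : Fin (r * c)).val = i * c + j := by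
    simp [finProdFinEquiv, mul_comm, add_comm]
  rw [← h]
  simp only [matrixArray, vectorArray, Fin.is_lt, dite_true, Fin.eta, Equiv.symm_apply_apply]

open Classical in
/-- The adjacency matrix of a graph with vertices `0, …, m - 1`, as the contents of an array. -/
noncomputable def adjacencyArray {m : ℕ} (G : SimpleGraph (Fin m)) : ℕ → ℕ :=
  matrixArray fun i j => if G.Adj i j then 1 else 0

/-- The contents of the first registers, zero elsewhere. -/
def registerList (l : List ℕ) : ℕ → ℕ := fun i => l.getD i 0

/-! ### Hereditary graph classes and the two problems -/

/-- A family of finite graphs, given on the vertex sets `{0, …, m - 1}`. -/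
abbrev GraphFamily : Type := ∀ m : ℕ, SimpleGraph (Fin m) → Prop

/-- Closed under taking induced subgraphs, as abstract graphs: a graph isomorphic to an induced
subgraph of a member is a member. -/
def GraphFamily.Hereditary (𝒢 : GraphFamily) : Prop :=
  ∀ (k m : ℕ) (G : SimpleGraph (Fin k)) (H : SimpleGraph (Fin m)),
    Nonempty (G ↪g H) → 𝒢 m H → 𝒢 k G

/-- An instance of Size bounded Maximum Weight Independent Set. -/
structure SbMWIS : Type where
  /-- number of vertices -/
  m : ℕ
  G : SimpleGraph (Fin m)
  k : ℕ
  ρ : ℕ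
  k_pos : 0 < k
  ρ_pos : 0 < ρ
  w : Fin m → ℕ

/-- There is an independent set of size at most `k` and weight at least `ρ`. -/
def SbMWIS.IsYes (I : SbMWIS) : Prop :=
  ∃ S : Finset (Fin I.m), I.G.IsIndepSet (S : Set (Fin I.m)) ∧ S.card ≤ I.k ∧
    I.ρ ≤ ∑ v ∈ S, I.w v

/-- The input: `r₀ = m`, `r₁ = k`, `r₂ = ρ`, `A₀` the adjacency matrix, `A₁` the weights. -/
noncomputable def SbMWIS.input (I : SbMWIS) : RAMState where
  reg := registerList [I.m, I.k, I.ρ]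
  arr
    | 0 => adjacencyArray I.G
    | 1 => vectorArray I.w
    | _ => fun _ => 0

/-- An instance of Size bounded Conflict free Fair Allocation. -/
structure SbCFFA : Type where
  /-- number of agents -/
  n : ℕ
  /-- number of jobs -/
  m : ℕ
  u : Fin n → Fin m → ℕ
  s : ℕ
  η : ℕ
  s_pos : 0 < s
  η_pos : 0 < η
  /-- conflict graph -/
  H : SimpleGraph (Fin m)

/-- There are pairwise disjoint bundles, one for each agent, each of them independent in the
conflict graph, of size at most `s`, and of utility at least `η` for its agent. -/
def SbCFFA.IsYes (J : SbCFFA) : Prop :=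
  ∃ φ : Fin J.n → Finset (Fin J.m),
    (∀ a, J.H.IsIndepSet (φ a : Set (Fin J.m)) ∧ (φ a).card ≤ J.s ∧ J.η ≤ ∑ x ∈ φ a, J.u a x) ∧
    ∀ a a', a ≠ a' → Disjoint (φ a) (φ a')

/-- The input: `r₀ = n`, `r₁ = m`, `r₂ = s`, `r₃ = η`, `A₀` the adjacency matrix of the conflict
graph, `A₁` the `n × m` matrix of utilities. -/
noncomputable def SbCFFA.input (J : SbCFFA) : RAMState where
  reg := registerList [J.n, J.m, J.s, J.η]
  arr
    | 0 => adjacencyArray J.H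
    | 1 => matrixArray J.u
    | _ => fun _ => 0

/-!
The proof derandomises colour coding. Let `k = n * s` be the largest number of jobs that a solution
can allocate. Colour the jobs so that the jobs of a solution get pairwise different colours
(`SbCFFA.IsYes.exists_set`). Then it is enough to give the agents disjoint *colour sets*, and the
colour sets that can serve the first `a + 1` agents arise from those for the first `a` agents by
adding a disjoint colour set in which the next agent finds a bundle (`SbCFFA.reach_succ_iff`).
Whether an agent finds a bundle inside a colour set is a single question to the given algorithm `B`
for independent sets on the same graph, where the jobs with other colours get weight zero
(`SbCFFA.subproblem_isYes`). A step for one agent ranges over pairs of disjoint colour sets, that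
is, over ternary strings, so with `k'` colours a colouring costs `3 ^ k'` calls of `B`, up to
polynomial factors.

Using exactly `k` colours would leave no room for the cost of a deterministic family of colourings:
`e ^ k * 3 ^ k` is already the bound that is claimed, and no factor exponential in `k` can be lost.
The remedy is to use slightly more colours. A set of `b = 15 * a` elements is coloured injectively
with `16 * a` colours by a random function with probability about `(16 / e ^ 16) ^ a`
(`injective_probability_bound`), so that a greedy choice yields a table of about `(e ^ 16 / 16) ^ a`
functions that serve all sets of `b` elements (`exists_perfectTable`). The cost per block of `b`
elements is `(e ^ 16 / 16 * 3 ^ 16) ^ a`, which is smaller than `(3 * e) ^ (15 * a)` by the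
exponential factor `(16 / (3 * e)) ^ a`. For a large constant `a` this pays for everything else,
including a spare factor two for each block (`exists_block_constants`). The block size and its table
are constants that are written into the program.

To cut the set to be coloured into blocks, the elements are sent down a heap-shaped binary tree with
`lam + 1` leaves, where `lam + 1` is about `(k + log m) / b`. At each node a residue modulo a small
number keeps the elements of the set apart (`exists_mod_injOn`), and a threshold splits them between
the two children in the right proportion (`exists_threshold`). All moduli, all thresholds, and the
index of the function from the table at each leaf are guessed (`exists_heapColor_injOn`). Since the
numbers at a node are polynomial in the number of leaves below it, only exponentially many guesses
arise, with a constant factor for each leaf (`placeValue_heapRadix_le`).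

The remaining part is the program itself. `Runs` is a small logic for the total correctness and the
time of programs. The program `B` is embedded with renamed registers and arrays (`RAMProg.embed`);
its arrays carry stamps with the number of the run, so that they need not be cleared between two of
the many calls (`runs_callProg`). The marks of the dynamic programme (`runs_agentProg`) are written
to a fresh part of an array for each agent, for the same reason. The main loop counts through all
guesses in a mixed radix system (`runs_allocProg`).

In the time bound, the factor polynomial in `lam` is absorbed by the spare factor two for each
block, the rounding in `lam` costs a factor `(3 * e) ^ b`, and the term `log m` a factor polynomial
in `m` (`guesses_mul_strings_le`). So the factor `(n * s) ^ log (n * s)` of the claim is not used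
beyond its being at least one.
-/

/-! ### Injective residues -/

/-- A positive number below `2 ^ n` fails to be divisible by some `p ≤ 2 * n`: otherwise it would be
divisible by `centralBinom n`, all of whose prime power divisors are at most `2 * n`. -/
theorem exists_not_dvd_of_lt_two_pow {n D : ℕ} (hn : 0 < n) (hD : 0 < D) (hlt : D < 2 ^ n) :
    ∃ p, 1 ≤ p ∧ p ≤ 2 * n ∧ ¬ p ∣ D := by
  by_contra! hcon
  have hdvd : Nat.centralBinom n ∣ D := by
    rw [← Nat.factorization_le_iff_dvd (Nat.centralBinom_ne_zero n) hD.ne']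
    intro p
    by_cases hp : p.Prime
    · rw [← hp.pow_dvd_iff_le_factorization hD.ne']
      refine hcon _ (Nat.one_le_pow _ _ hp.pos) ?_
      exact Nat.pow_factorization_choose_le (by omega)
    · simp [Nat.factorization_eq_zero_of_not_prime _ hp]
  have h1 := Nat.le_of_dvd hD hdvd
  have h2 : 2 ^ n ≤ Nat.centralBinom n := by
    have : ∀ n : ℕ, 2 ^ n ≤ Nat.centralBinom n := by
      intro n
      induction n with
      | zero => simp
      | succ k ih =>
        have h := Nat.succ_mul_centralBinom_succ k
        have h3 : (k + 1) * 2 ^ (k + 1) ≤ (k + 1) * Nat.centralBinom (k + 1) := by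
          rw [h, pow_succ]
          nlinarith
        exact Nat.le_of_mul_le_mul_left h3 (by omega)
    exact this n
  omega

/-- Few numbers below `2 ^ κ` are distinguished by their residues modulo a small number. -/
theorem exists_mod_injOn {κ : ℕ} (hκ : 0 < κ) (S : Finset ℕ) (hS : S.card ≤ κ)
    (hlt : ∀ x ∈ S, x < 2 ^ κ) :
    ∃ p, 1 ≤ p ∧ p ≤ 2 * κ ^ 3 ∧ Set.InjOn (fun x => x % p) (S : Set ℕ) := by
  classical
  set D := ∏ z ∈ (S ×ˢ S).filter (fun z => z.1 < z.2), (z.2 - z.1) with hD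
  have hDpos : 0 < D := Finset.prod_pos fun z hz => by
    have := (Finset.mem_filter.1 hz).2
    omega
  have h2 : 2 ≤ 2 ^ κ := by
    calc 2 = 2 ^ 1 := rfl
      _ ≤ 2 ^ κ := Nat.pow_le_pow_right (by norm_num) hκ
  have hDle : D ≤ (2 ^ κ - 1) ^ (κ * κ) := by
    refine (Finset.prod_le_pow_card _ _ (2 ^ κ - 1) fun z hz => ?_).trans
      (Nat.pow_le_pow_right (by omega) ?_)
    · have h := Finset.mem_filter.1 hz
      have := hlt _ (Finset.mem_product.1 h.1).2
      omega
    · calc _ ≤ (S ×ˢ S).card := Finset.card_filter_le _ _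
        _ = S.card * S.card := Finset.card_product _ _
        _ ≤ κ * κ := Nat.mul_le_mul hS hS
  have hDlt : D < 2 ^ (κ ^ 3) := by
    calc D ≤ (2 ^ κ - 1) ^ (κ * κ) := hDle
      _ < (2 ^ κ) ^ (κ * κ) := Nat.pow_lt_pow_left (by omega) (by positivity)
      _ = 2 ^ (κ ^ 3) := by rw [← pow_mul]; ring_nf
  obtain ⟨p, hp1, hp2, hpD⟩ := exists_not_dvd_of_lt_two_pow (by positivity) hDpos hDlt
  have key : ∀ x ∈ S, ∀ y ∈ S, x < y → x % p ≠ y % p := by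
    intro x hx y hy hxy h
    refine hpD ((Nat.dvd_of_mod_eq_zero (Nat.sub_mod_eq_zero_of_mod_eq h.symm)).trans ?_)
    exact Finset.dvd_prod_of_mem (fun z : ℕ × ℕ => z.2 - z.1) (a := (x, y))
      (by simp [hx, hy, hxy])
  refine ⟨p, hp1, hp2, fun x hx y hy h => ?_⟩
  rcases lt_trichotomy x y with h' | h' | h'
  · exact absurd h (key x hx y hy h')
  · exact h'
  · exact absurd h.symm (key y hy x hx h')

/-! ### Perfect hash families of constant size -/

/-- Greedy covering: if every element of `𝒮` is hit by a fraction at least `p` of all `f`, then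
`τ` choices of `f` hit all of `𝒮` as soon as `#𝒮 * (1 - p) ^ τ < 1`. -/
theorem exists_covering_family {F S : Type*} [Fintype F] [Nonempty F] [DecidableEq S]
    (good : F → S → Prop) (p : ℝ) (hp : p ≤ 1) (τ : ℕ) (𝒮 : Finset S)
    (hgood : ∀ s ∈ 𝒮, p * Fintype.card F ≤ (Nat.card {f : F // good f s} : ℝ))
    (hτ : (𝒮.card : ℝ) * (1 - p) ^ τ < 1) :
    ∃ g : ℕ → F, ∀ s ∈ 𝒮, ∃ i < τ, good (g i) s := by
  classical
  induction τ generalizing 𝒮 with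
  | zero =>
    have : 𝒮 = ∅ := by
      rw [← Finset.card_eq_zero]
      have h : (𝒮.card : ℝ) < 1 := by simpa using hτ
      exact_mod_cast Nat.lt_one_iff.1 (by exact_mod_cast h)
    exact ⟨fun _ => Classical.arbitrary F, by simp [this]⟩
  | succ τ ih =>
    have hsum : ∑ _f : F, p * 𝒮.card ≤ ∑ f : F, ((𝒮.filter fun s => good f s).card : ℝ) := by
      calc ∑ _f : F, p * 𝒮.card = ∑ s ∈ 𝒮, p * Fintype.card F := by
            simp; ring
        _ ≤ ∑ s ∈ 𝒮, (Nat.card {f : F // good f s} : ℝ) := Finset.sum_le_sum hgood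
        _ = ∑ s ∈ 𝒮, ∑ f : F, if good f s then (1 : ℝ) else 0 := by
            refine Finset.sum_congr rfl fun s _ => ?_
            rw [Nat.card_eq_fintype_card, Fintype.card_subtype]
            simp
        _ = ∑ f : F, ((𝒮.filter fun s => good f s).card : ℝ) := by
            rw [Finset.sum_comm]
            simp
    obtain ⟨f, -, hf⟩ := Finset.exists_le_of_sum_le Finset.univ_nonempty hsum
    have hcard : ((𝒮.filter fun s => ¬ good f s).card : ℝ) ≤ (1 - p) * 𝒮.card := by
      have := Finset.card_filter_add_card_filter_not (s := 𝒮) (fun s => good f s)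
      have h' : ((𝒮.filter fun s => good f s).card : ℝ) +
        ((𝒮.filter fun s => ¬ good f s).card : ℝ) = 𝒮.card := by exact_mod_cast this
      linarith
    obtain ⟨g, hg⟩ := ih (𝒮.filter fun s => ¬ good f s)
      (fun s hs => hgood s (Finset.mem_filter.1 hs).1) (by
        calc _ ≤ (1 - p) * 𝒮.card * (1 - p) ^ τ :=
              mul_le_mul_of_nonneg_right hcard (pow_nonneg (by linarith) _)
          _ = (𝒮.card : ℝ) * (1 - p) ^ (τ + 1) := by ring
          _ < 1 := hτ)
    refine ⟨fun i => if i = τ then f else g i, fun s hs => ?_⟩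
    by_cases h : good f s
    · exact ⟨τ, by omega, by simpa using h⟩
    · obtain ⟨i, hi, hgi⟩ := hg s (Finset.mem_filter.2 ⟨hs, h⟩)
      exact ⟨i, by omega, by simpa [hi.ne] using hgi⟩

theorem descFactorial_mul_pow_le_card_injOn {N q : ℕ} (S : Finset (Fin N)) :
    q.descFactorial S.card * q ^ (N - S.card) ≤
      Nat.card {f : Fin N → Fin q // Set.InjOn f (S : Set (Fin N))} := by
  classical
  have h1 : Fintype.card ((S ↪ Fin q) × ({x // x ∉ S} → Fin q)) =
      q.descFactorial S.card * q ^ (N - S.card) := by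
    rw [Fintype.card_prod, Fintype.card_embedding_eq, Fintype.card_fun, Fintype.card_fin,
      Fintype.card_coe]
    congr 2
    rw [Fintype.card_subtype_compl, Fintype.card_fin, Fintype.card_coe]
  rw [← h1, Nat.card_eq_fintype_card]
  refine Fintype.card_le_of_injective (fun z => ⟨fun i => if h : i ∈ S then z.1 ⟨i, h⟩
      else z.2 ⟨i, h⟩,
    ?_⟩) ?_
  · intro x hx y hy hxy
    have hx' : x ∈ S := hx
    have hy' : y ∈ S := hy
    simpa [hx', hy'] using hxy
  · rintro ⟨e, g⟩ ⟨e', g'⟩ h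
    have h' := congrFun (Subtype.ext_iff.1 h)
    refine Prod.ext ?_ ?_
    · ext ⟨i, hi⟩
      have := h' i
      simp only [hi, dite_true] at this
      simpa using congrArg Fin.val this
    · funext ⟨i, hi⟩
      have := h' i
      simpa [hi] using this

/-- A random function from a set to `16 * a` colours is injective on a given set of `15 * a`
elements with probability at least `(16 / e ^ 16) ^ a`. -/
theorem injective_probability_bound (a : ℕ) (ha : 0 < a) :
    (16 / Real.exp 16) ^ a * ((16 * a : ℕ) : ℝ) ^ (15 * a) ≤
        ((16 * a).descFactorial (15 * a) : ℝ) := by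
  have h1 : ((16 * a : ℕ) : ℝ) ^ (16 * a) / ((16 * a).factorial : ℝ) ≤
      Real.exp ((16 * a : ℕ) : ℝ) :=
    Real.pow_div_factorial_le_exp _ (by positivity) _
  have h2 := Nat.factorial_mul_descFactorial (show 15 * a ≤ 16 * a by omega)
  rw [show 16 * a - 15 * a = a by omega] at h2
  have h3 : (a.factorial : ℝ) ≤ (a : ℝ) ^ a := by exact_mod_cast Nat.factorial_le_pow a
  have hfac : (0 : ℝ) < ((16 * a).factorial : ℝ) := by positivity
  rw [div_le_iff₀ hfac] at h1
  have h2' : (a.factorial : ℝ) * ((16 * a).descFactorial (15 * a) : ℝ) =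
      ((16 * a).factorial : ℝ) := by
    exact_mod_cast h2
  have hexp : Real.exp ((16 * a : ℕ) : ℝ) = Real.exp 16 ^ a := by
    rw [← Real.exp_nat_mul]; congr 1; push_cast; ring
  rw [hexp, ← h2'] at h1
  have ha' : (0 : ℝ) < (a : ℝ) ^ a := by positivity
  have hE : (0 : ℝ) < Real.exp 16 ^ a := by positivity
  rw [div_pow, div_mul_eq_mul_div, div_le_iff₀ hE]
  have h4 : ((16 * a : ℕ) : ℝ) ^ (16 * a) =
      (a : ℝ) ^ a * (16 ^ a * ((16 * a : ℕ) : ℝ) ^ (15 * a)) := by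
    rw [show 16 * a = a + 15 * a by omega, pow_add]
    rw [show a + 15 * a = 16 * a by omega]
    push_cast
    rw [mul_pow]; ring
  rw [h4] at h1
  have h5 : Real.exp 16 ^ a * ((a.factorial : ℝ) * ((16 * a).descFactorial (15 * a) : ℝ)) ≤
      (a : ℝ) ^ a * (((16 * a).descFactorial (15 * a) : ℝ) * Real.exp 16 ^ a) := by
    have : (0 : ℝ) ≤ ((16 * a).descFactorial (15 * a) : ℝ) * Real.exp 16 ^ a := by positivity
    nlinarith
  exact le_of_mul_le_mul_left (h1.trans h5) ha'

/-- Functions `i ↦ tab (t * N + i)`, for `t < τ`, from `N` elements to `q` colours, stored in a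
single table, such that every set of at most `b` elements is mapped injectively by one of them. -/
structure PerfectTable (N b q τ : ℕ) where
  tab : ℕ → ℕ
  lt : ∀ i, tab i < q
  eq_zero : ∀ i, τ * N ≤ i → tab i = 0
  exists_injOn : ∀ S : Finset ℕ, S.card ≤ b → (∀ x ∈ S, x < N) →
    ∃ t < τ, Set.InjOn (fun i => tab (t * N + i)) (S : Set ℕ)

theorem exists_perfectTable (a N : ℕ) (ha : 0 < a) (hN : 15 * a ≤ N) :
    ∃ τ : ℕ, 0 < τ ∧ (τ : ℝ) ≤ 2 * ((15 * a * N : ℕ) : ℝ) * (Real.exp 16 / 16) ^ a ∧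
      Nonempty (PerfectTable N (15 * a) (16 * a) τ) := by
  classical
  set p : ℝ := (16 / Real.exp 16) ^ a with hp
  have h16 : (16 : ℝ) ≤ Real.exp 16 := by
    have := Real.add_one_le_exp (16 : ℝ); linarith
  have hp0 : 0 < p := by positivity
  have hp1 : p ≤ 1 := pow_le_one₀ (by positivity) (by rw [div_le_one (by positivity)]; exact h16)
  have hpinv : p⁻¹ = (Real.exp 16 / 16) ^ a := by rw [hp, ← inv_pow, inv_div]
  set X : ℝ := ((15 * a * N : ℕ) : ℝ) with hX
  have hX1 : 1 ≤ X := by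
    have hN0 : 0 < N := by omega
    rw [hX]; exact_mod_cast Nat.succ_le_of_lt (Nat.mul_pos (by omega) hN0)
  set τ : ℕ := ⌊X / p⌋₊ + 1 with hτ
  have hτlt : X / p < τ := by rw [hτ]; push_cast; exact Nat.lt_floor_add_one _
  have hτle : (τ : ℝ) ≤ 2 * X * (Real.exp 16 / 16) ^ a := by
    rw [← hpinv, hτ]
    push_cast
    have h1 : (⌊X / p⌋₊ : ℝ) ≤ X / p := Nat.floor_le (by positivity)
    have h2 : 1 ≤ X / p := by rw [le_div_iff₀ hp0]; linarith
    rw [mul_assoc, ← div_eq_mul_inv]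
    linarith
  have : Nonempty (Fin (16 * a)) := ⟨⟨0, by omega⟩⟩
  obtain ⟨g, hg⟩ := exists_covering_family
    (F := Fin N → Fin (16 * a)) (S := Finset (Fin N))
    (fun f s => Set.InjOn f (s : Set (Fin N))) p hp1 τ (Finset.powersetCard (15 * a) Finset.univ)
    (by
      intro s hs
      have hs' := (Finset.mem_powersetCard.1 hs).2
      have h1 := descFactorial_mul_pow_le_card_injOn (q := 16 * a) s
      rw [hs'] at h1
      refine le_trans ?_ (Nat.cast_le.2 h1)
      rw [Fintype.card_fun, Fintype.card_fin, Fintype.card_fin]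
      push_cast
      have h2 := injective_probability_bound a ha
      rw [← hp] at h2
      push_cast at h2
      have h3 : (16 * (a : ℝ)) ^ N = (16 * (a : ℝ)) ^ (15 * a) * (16 * (a : ℝ)) ^ (N - 15 * a) := by
        rw [← pow_add]; congr 1; omega
      rw [h3, ← mul_assoc]
      exact mul_le_mul_of_nonneg_right h2 (by positivity))
    (by
      rw [Finset.card_powersetCard, Finset.card_univ, Fintype.card_fin]
      have h1 : ((N.choose (15 * a) : ℕ) : ℝ) ≤ Real.exp X := by
        have h2 : ((N.choose (15 * a) : ℕ) : ℝ) ≤ (N : ℝ) ^ (15 * a) := by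
          exact_mod_cast Nat.choose_le_pow N (15 * a)
        have h3 : (N : ℝ) ≤ Real.exp N := by
          have := Real.add_one_le_exp (N : ℝ); linarith
        calc _ ≤ (N : ℝ) ^ (15 * a) := h2
          _ ≤ Real.exp N ^ (15 * a) := pow_le_pow_left₀ (by positivity) h3 _
          _ = Real.exp X := by rw [← Real.exp_nat_mul, hX]; push_cast; ring_nf
      have h4 : (1 - p) ^ τ ≤ Real.exp (-(p * τ)) := by
        have := Real.one_sub_le_exp_neg p
        calc (1 - p) ^ τ ≤ Real.exp (-p) ^ τ := pow_le_pow_left₀ (by linarith) this _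
          _ = _ := by rw [← Real.exp_nat_mul]; ring_nf
      have h5 : X < p * τ := by rwa [div_lt_iff₀ hp0, mul_comm] at hτlt
      calc _ ≤ Real.exp X * Real.exp (-(p * τ)) :=
            mul_le_mul h1 h4 (pow_nonneg (by linarith) _) (by positivity)
        _ = Real.exp (X - p * τ) := by rw [← Real.exp_add]; ring_nf
        _ < 1 := by rw [Real.exp_lt_one_iff]; linarith)
  have hN0 : 0 < N := by omega
  refine ⟨τ, by omega, hτle, ⟨{
    tab := fun i => if i < τ * N then (g (i / N) ⟨i % N, Nat.mod_lt _ hN0⟩ : ℕ) else 0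
    lt := fun i => by
      split_ifs
      · exact Fin.is_lt _
      · omega
    eq_zero := fun i hi => if_neg (by omega)
    exists_injOn := ?_ }⟩⟩
  intro S hS hlt
  -- enlarge `S` to a set with exactly `15 * a` elements
  obtain ⟨S', hS', hS'c⟩ : ∃ S' : Finset (Fin N), (∀ x (hx : x ∈ S), (⟨x, hlt x hx⟩ : Fin N) ∈ S') ∧
      S'.card = 15 * a := by
    have hcard : (S.attachFin hlt).card ≤ 15 * a := by simpa using hS
    obtain ⟨S', h1, -, h2⟩ := Finset.exists_subsuperset_card_eq
      (Finset.subset_univ (S.attachFin hlt)) hcard (by simpa using hN)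
    exact ⟨S', fun x hx => h1 (by simpa [Finset.mem_attachFin] using hx), h2⟩
  obtain ⟨t, ht, hinj⟩ := hg S' (Finset.mem_powersetCard.2 ⟨Finset.subset_univ _, hS'c⟩)
  refine ⟨t, ht, ?_⟩
  have hval : ∀ x (hx : x ∈ S), (if t * N + x < τ * N then
      (g ((t * N + x) / N) ⟨(t * N + x) % N, Nat.mod_lt _ hN0⟩ : ℕ) else 0) =
      g t ⟨x, hlt x hx⟩ := by
    intro x hx
    have hxN := hlt x hx
    have h1 : t * N + x < τ * N := by nlinarith
    have h2 : (t * N + x) / N = t := by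
      rw [add_comm, Nat.add_mul_div_right _ _ hN0, Nat.div_eq_of_lt hxN, zero_add]
    have h3 : (t * N + x) % N = x := by
      rw [add_comm, Nat.add_mul_mod_self_right, Nat.mod_eq_of_lt hxN]
    simp only [h1, if_true, h2, h3]
  intro x hx y hy hxy
  simp only at hxy
  rw [hval x hx, hval y hy] at hxy
  have := hinj (hS' x hx) (hS' y hy) (Fin.ext hxy)
  simpa using this

/-- The constants of the algorithm. Because `3 * e < 16`, the cost per block of `b = 15 * a`
elements falls below `(3 * e) ^ b`, by any polynomial factor in `a`. -/
theorem exists_block_constants :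
    ∃ b q τ : ℕ, 32 ≤ b ∧ 0 < τ ∧ Nonempty (PerfectTable (2 * b ^ 3) b q τ) ∧
      ((2 * b ^ 3 : ℕ) : ℝ) ^ 4 * Real.exp 12 * τ * 3 ^ q ≤ (3 * Real.exp 1) ^ b / 2 := by
  have he : Real.exp 1 < 2.7182818286 := Real.exp_one_lt_d9
  have he0 : 0 < Real.exp 1 := Real.exp_pos 1
  set r : ℝ := 3 * Real.exp 1 / 16 with hr
  have hr0 : 0 < r := by positivity
  have hr1 : r < 1 := by rw [hr]; linarith
  have hlim := (tendsto_pow_const_mul_const_pow_of_abs_lt_one 16 (r := r)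
    (by rw [abs_of_pos hr0]; exact hr1)).const_mul (64 * Real.exp 12 * 15 ^ 16)
  rw [mul_zero] at hlim
  obtain ⟨a, ha, ha3⟩ := ((hlim.eventually (gt_mem_nhds (show (0 : ℝ) < 1 / 2 by norm_num))).and
    (Filter.eventually_ge_atTop 3)).exists
  obtain ⟨τ, hτ0, hτ, hT⟩ := exists_perfectTable a (2 * (15 * a) ^ 3) (by omega) (by
    have : 15 * a ≤ (15 * a) ^ 3 := Nat.le_self_pow (by norm_num) _
    omega)
  refine ⟨15 * a, 16 * a, τ, by omega, hτ0, hT, ?_⟩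
  have key : (3 : ℝ) ^ (16 * a) * (Real.exp 16 / 16) ^ a = (3 * Real.exp 1) ^ (15 * a) * r ^ a := by
    have h16 : Real.exp 16 = Real.exp 1 ^ 16 := by rw [← Real.exp_nat_mul]; norm_num
    rw [pow_mul, pow_mul (3 * Real.exp 1), ← mul_pow, ← mul_pow, h16, hr]
    congr 1; ring
  calc ((2 * (15 * a) ^ 3 : ℕ) : ℝ) ^ 4 * Real.exp 12 * τ * 3 ^ (16 * a)
      ≤ ((2 * (15 * a) ^ 3 : ℕ) : ℝ) ^ 4 * Real.exp 12 *
        (2 * ((15 * a * (2 * (15 * a) ^ 3) : ℕ) : ℝ) * (Real.exp 16 / 16) ^ a) * 3 ^ (16 * a) := by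
        gcongr
    _ = (64 * Real.exp 12 * 15 ^ 16) * a ^ 16 * ((3 : ℝ) ^ (16 * a) * (Real.exp 16 / 16) ^ a) := by
        push_cast; ring
    _ = (64 * Real.exp 12 * 15 ^ 16 * (a ^ 16 * r ^ a)) * (3 * Real.exp 1) ^ (15 * a) := by
        rw [key]; ring
    _ ≤ 1 / 2 * (3 * Real.exp 1) ^ (15 * a) := by gcongr
    _ = _ := by ring

/-! ### Splitting along a heap-shaped tree -/

/-- In the heap with internal nodes `0, …, lam - 1` (the children of `j` being `2 * j + 1` and
`2 * j + 2`) and leaves `lam, …, 2 * lam`: two to the length of the leftmost path below `j`. -/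
def heapCap (lam j : ℕ) : ℕ :=
  if lam ≤ j then 1 else 2 * heapCap lam (2 * j + 1)
termination_by lam - j

/-- The number of leaves below the node `j`. -/
def heapLeaves (lam j : ℕ) : ℕ :=
  if lam ≤ j then 1 else heapLeaves lam (2 * j + 1) + heapLeaves lam (2 * j + 2)
termination_by lam - j

/-- The path of the number `x` from the node `j` to a leaf: at each node `i` the number is replaced
by its residue modulo `G (2 * i) + 1`, and an internal node sends it to the left if the residue is
at most `G (2 * i + 1)`. The value is the leaf reached and the last residue. -/
def heapWalk (lam : ℕ) (G : ℕ → ℕ) (j x : ℕ) : ℕ × ℕ :=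
  if lam ≤ j then (j, x % (G (2 * j) + 1))
  else heapWalk lam G
    (if x % (G (2 * j) + 1) ≤ G (2 * j + 1) then 2 * j + 1 else 2 * j + 2) (x % (G (2 * j) + 1))
termination_by lam - j
decreasing_by split_ifs <;> omega

/-- The colouring described by `G`: each leaf has `q` colours of its own, and distributes them by
one of the functions in the table `tab`. -/
def heapColor (lam q N : ℕ) (tab G : ℕ → ℕ) (x : ℕ) : ℕ :=
  ((heapWalk lam G 0 x).1 - lam) * q +
    tab (G (2 * (heapWalk lam G 0 x).1 + 1) * N + (heapWalk lam G 0 x).2)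

/-- The number of values allowed for `G i`. -/
def heapRadix (lam N τ i : ℕ) : ℕ :=
  if i % 2 = 1 ∧ lam ≤ i / 2 then τ else N * heapCap lam (i / 2) ^ 3

theorem heapCap_of_le {lam j : ℕ} (h : lam ≤ j) : heapCap lam j = 1 := by
  rw [heapCap, if_pos h]

theorem heapCap_of_lt {lam j : ℕ} (h : j < lam) : heapCap lam j = 2 * heapCap lam (2 * j + 1) := by
  rw [heapCap, if_neg (by omega)]

theorem heapLeaves_of_le {lam j : ℕ} (h : lam ≤ j) : heapLeaves lam j = 1 := by
  rw [heapLeaves, if_pos h]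

theorem heapLeaves_of_lt {lam j : ℕ} (h : j < lam) :
    heapLeaves lam j = heapLeaves lam (2 * j + 1) + heapLeaves lam (2 * j + 2) := by
  rw [heapLeaves, if_neg (by omega)]

theorem heapWalk_of_le {lam j : ℕ} (h : lam ≤ j) (G : ℕ → ℕ) (x : ℕ) :
    heapWalk lam G j x = (j, x % (G (2 * j) + 1)) := by
  rw [heapWalk, if_pos h]

theorem heapWalk_of_lt {lam j : ℕ} (h : j < lam) (G : ℕ → ℕ) (x : ℕ) :
    heapWalk lam G j x = heapWalk lam G
      (if x % (G (2 * j) + 1) ≤ G (2 * j + 1) then 2 * j + 1 else 2 * j + 2)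
      (x % (G (2 * j) + 1)) := by
  rw [heapWalk, if_neg (by omega)]

/-- Induction from the leaves to the root. -/
theorem heap_induction {lam : ℕ} {p : ℕ → Prop} (leaf : ∀ j, lam ≤ j → p j)
    (node : ∀ j < lam, (∀ i, j < i → p i) → p j) (j : ℕ) : p j := by
  induction h : lam - j using Nat.strong_induction_on generalizing j with
  | _ d ih =>
    by_cases hj : lam ≤ j
    · exact leaf j hj
    · refine node j (by omega) fun i hi => ?_
      by_cases hi' : lam ≤ i
      · exact leaf i hi'
      · exact ih (lam - i) (by omega) i rfl

theorem heapCap_pos (lam j : ℕ) : 0 < heapCap lam j := by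
  induction j using heap_induction (lam := lam) with
  | leaf j h => rw [heapCap_of_le h]; norm_num
  | node j h ih => rw [heapCap_of_lt h]; have := ih (2 * j + 1) (by omega); omega

theorem heapCap_antitone (lam : ℕ) : ∀ j i, j ≤ i → heapCap lam i ≤ heapCap lam j := by
  refine heap_induction (lam := lam) (fun j h i hi => ?_) (fun j h ih i hi => ?_)
  · rw [heapCap_of_le h, heapCap_of_le (h.trans hi)]
  · by_cases hi' : lam ≤ i
    · rw [heapCap_of_le hi']; exact heapCap_pos _ _
    · rw [heapCap_of_lt h, heapCap_of_lt (by omega : i < lam)]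
      have := ih (2 * j + 1) (by omega) (2 * i + 1) (by omega)
      omega

/-- Neighbouring subtrees differ in height by at most one. -/
theorem heapCap_le_two_mul_succ (lam j : ℕ) :
    heapCap lam (2 * j + 1) ≤ 2 * heapCap lam (2 * j + 2) := by
  by_cases h : lam ≤ 2 * j + 1
  · rw [heapCap_of_le h, heapCap_of_le (by omega)]; norm_num
  · rw [heapCap_of_lt (by omega : 2 * j + 1 < lam)]
    have := heapCap_antitone lam (2 * j + 2) (2 * (2 * j + 1) + 1) (by omega)
    omega

theorem succ_mul_heapCap_le (lam j : ℕ) (hj : j ≤ 2 * lam) :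
    (j + 1) * heapCap lam j ≤ 2 * (lam + 1) := by
  induction j using heap_induction (lam := lam) with
  | leaf j h => rw [heapCap_of_le h]; omega
  | node j h ih =>
    rw [heapCap_of_lt h]
    have := ih (2 * j + 1) (by omega) (by omega)
    nlinarith

theorem heapLeaves_pos (lam j : ℕ) : 0 < heapLeaves lam j := by
  induction j using heap_induction (lam := lam) with
  | leaf j h => rw [heapLeaves_of_le h]; norm_num
  | node j h ih => rw [heapLeaves_of_lt h]; have := ih (2 * j + 1) (by omega); omega

theorem heapLeaves_le_heapCap (lam j : ℕ) : heapLeaves lam j ≤ heapCap lam j := by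
  induction j using heap_induction (lam := lam) with
  | leaf j h => rw [heapLeaves_of_le h, heapCap_of_le h]
  | node j h ih =>
    rw [heapLeaves_of_lt h, heapCap_of_lt h]
    have h1 := ih (2 * j + 1) (by omega)
    have h2 := ih (2 * j + 2) (by omega)
    have h3 := heapCap_antitone lam (2 * j + 1) (2 * j + 2) (by omega)
    omega

/-- For each `r ≤ lam` the nodes `r, …, 2 * r` form a cut of the heap. -/
theorem sum_heapLeaves (lam r : ℕ) (hr : r ≤ lam) :
    ∑ i ∈ Finset.range (r + 1), heapLeaves lam (r + i) = heapLeaves lam 0 := by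
  induction r with
  | zero => simp
  | succ r ih =>
    rw [← ih (by omega), Finset.sum_range_succ, Finset.sum_range_succ]
    conv_rhs => rw [Finset.sum_range_succ']
    rw [add_zero, heapLeaves_of_lt (by omega : r < lam), ← add_assoc,
      show r + 1 + r = 2 * r + 1 by omega]
    rw [Finset.sum_congr rfl fun i _ => show heapLeaves lam (r + 1 + i) =
        heapLeaves lam (r + (i + 1)) by
      congr 1; omega]
    ring_nf

theorem heapLeaves_zero (lam : ℕ) : heapLeaves lam 0 = lam + 1 := by
  rw [← sum_heapLeaves lam lam le_rfl, Finset.sum_congr rfl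
    fun i _ => heapLeaves_of_le (Nat.le_add_right lam i)]
  simp

theorem le_heapCap_zero (lam : ℕ) : lam + 1 ≤ heapCap lam 0 := by
  rw [← heapLeaves_zero]; exact heapLeaves_le_heapCap _ _

theorem heapRadix_pos {lam N τ : ℕ} (hN : 0 < N) (hτ : 0 < τ) (i : ℕ) :
    0 < heapRadix lam N τ i := by
  unfold heapRadix
  split_ifs
  · exact hτ
  · exact Nat.mul_pos hN (pow_pos (heapCap_pos _ _) _)

/-- A set of numbers can be cut by a threshold into parts of prescribed sizes. -/
theorem exists_threshold (F : Finset ℕ) (R A B : ℕ) (hA : 0 < A) (hR : 0 < R)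
    (hF : ∀ c ∈ F, c < R) (hcard : F.card ≤ A + B) :
    ∃ t < R, (F.filter (· ≤ t)).card ≤ A ∧ (F.filter (¬ · ≤ t)).card ≤ B := by
  set f : ℕ → ℕ := fun t => (F.filter (· ≤ t)).card with hf
  set t := Nat.findGreatest (fun t => f t ≤ A) (R - 1) with ht
  have h0 : f 0 ≤ A := by
    have : F.filter (· ≤ 0) ⊆ {0} := fun x hx => by
      have := (Finset.mem_filter.1 hx).2
      simp; omega
    have := Finset.card_le_card this
    simp only [Finset.card_singleton] at this
    simp only [hf]; omega
  have htA : f t ≤ A := Nat.findGreatest_spec (P := fun t => f t ≤ A) (Nat.zero_le _) h0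
  have htR : t ≤ R - 1 := Nat.findGreatest_le _
  refine ⟨t, by omega, htA, ?_⟩
  have hsplit := Finset.card_filter_add_card_filter_not (s := F) (fun c => c ≤ t)
  rcases htR.lt_or_eq with h | h
  · have h1 : ¬ f (t + 1) ≤ A := fun hle => by
      have := Nat.le_findGreatest (P := fun t => f t ≤ A) (by omega : t + 1 ≤ R - 1) hle
      omega
    have h2 : f (t + 1) ≤ f t + 1 := by
      have : F.filter (· ≤ t + 1) ⊆ insert (t + 1) (F.filter (· ≤ t)) := fun x hx => by
        have := Finset.mem_filter.1 hx
        simp only [Finset.mem_insert, Finset.mem_filter]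
        by_cases hx' : x = t + 1
        · exact Or.inl hx'
        · exact Or.inr ⟨this.1, by omega⟩
      exact (Finset.card_le_card this).trans (Finset.card_insert_le _ _)
    simp only [hf] at h1 h2
    omega
  · have : F.filter (fun c => ¬ c ≤ t) = ∅ := Finset.filter_eq_empty_iff.2 fun c hc => by
      have := hF c hc
      omega
    rw [this]; simp

theorem cube_le_two_pow {κ : ℕ} (h : 32 ≤ κ) : 128 * κ ^ 3 ≤ 2 ^ κ := by
  induction κ, h using Nat.le_induction with
  | base => norm_num
  | succ k hk ih =>
    rw [pow_succ 2]
    have : (k + 1) ^ 3 ≤ 2 * k ^ 3 := by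
      have h1 : 32 * k ^ 2 ≤ k ^ 3 := by nlinarith [sq_nonneg k]
      nlinarith
    omega

/-- The choice of the two values of `G` at a single node. -/
theorem exists_node_digits {b q τ : ℕ} (T : PerfectTable (2 * b ^ 3) b q τ) (hb : 32 ≤ b)
    (lam j : ℕ) (F : Finset ℕ) (hF : F.card ≤ b * heapLeaves lam j)
    (hlt : ∀ x ∈ F, x < 2 ^ (b * heapCap lam j)) :
    ∃ P < heapRadix lam (2 * b ^ 3) τ (2 * j), ∃ t < heapRadix lam (2 * b ^ 3) τ (2 * j + 1),
      Set.InjOn (fun x => x % (P + 1)) (F : Set ℕ) ∧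
      (j < lam → ((F.image (· % (P + 1))).filter (· ≤ t)).card ≤ b * heapLeaves lam (2 * j + 1) ∧
        ((F.image (· % (P + 1))).filter (¬ · ≤ t)).card ≤ b * heapLeaves lam (2 * j + 2)) ∧
      (lam ≤ j → Set.InjOn (fun c => T.tab (t * (2 * b ^ 3) + c))
        (F.image (· % (P + 1)) : Finset ℕ)) := by
  have hcap := heapCap_pos lam j
  have hκ : 0 < b * heapCap lam j := Nat.mul_pos (by omega) hcap
  obtain ⟨p, hp1, hp2, hinj⟩ := exists_mod_injOn hκ F
    (hF.trans (Nat.mul_le_mul_left _ (heapLeaves_le_heapCap _ _))) hlt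
  have hR : heapRadix lam (2 * b ^ 3) τ (2 * j) = 2 * b ^ 3 * heapCap lam j ^ 3 := by
    unfold heapRadix
    rw [if_neg (by omega), show 2 * j / 2 = j by omega]
  have hpR : p ≤ 2 * b ^ 3 * heapCap lam j ^ 3 := by rw [mul_assoc, ← mul_pow]; exact hp2
  obtain ⟨P, rfl⟩ : ∃ P, p = P + 1 := ⟨p - 1, by omega⟩
  have hF' : ∀ c ∈ F.image (· % (P + 1)), c < P + 1 := fun c hc => by
    obtain ⟨x, -, rfl⟩ := Finset.mem_image.1 hc
    exact Nat.mod_lt _ (by omega)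
  have hcard' : (F.image (· % (P + 1))).card ≤ F.card := Finset.card_image_le
  refine ⟨P, by omega, ?_⟩
  by_cases hj : lam ≤ j
  · have hR' : heapRadix lam (2 * b ^ 3) τ (2 * j + 1) = τ := by
      unfold heapRadix
      rw [if_pos ⟨by omega, by omega⟩]
    rw [heapLeaves_of_le hj, mul_one] at hF
    rw [heapCap_of_le hj] at hpR
    obtain ⟨t, ht, htinj⟩ := T.exists_injOn (F.image (· % (P + 1))) (hcard'.trans hF)
      (fun c hc => by have := hF' c hc; omega)
    exact ⟨t, by omega, hinj, fun h => by omega, fun _ => htinj⟩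
  · have hR' : heapRadix lam (2 * b ^ 3) τ (2 * j + 1) = 2 * b ^ 3 * heapCap lam j ^ 3 := by
      unfold heapRadix
      rw [if_neg (by omega), show (2 * j + 1) / 2 = j by omega]
    rw [heapLeaves_of_lt (by omega), mul_add] at hF
    obtain ⟨t, ht, h1, h2⟩ := exists_threshold (F.image (· % (P + 1)))
      (2 * b ^ 3 * heapCap lam j ^ 3) _ _
      (Nat.mul_pos (by omega : 0 < b) (heapLeaves_pos lam (2 * j + 1)))
      (by omega) (fun c hc => by have := hF' c hc; omega) (hcard'.trans hF)
    exact ⟨t, by omega, hinj, fun _ => ⟨h1, h2⟩, fun h => by omega⟩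

/-- The set of residues arriving at the node `j`, given the choices made at each node. -/
def heapPart (P t : ℕ → Finset ℕ → ℕ) (S : Finset ℕ) : ℕ → Finset ℕ
  | 0 => S
  | j + 1 =>
    let F := heapPart P t S (j / 2)
    if j % 2 = 0 then (F.image (· % (P (j / 2) F + 1))).filter (· ≤ t (j / 2) F)
    else (F.image (· % (P (j / 2) F + 1))).filter (¬ · ≤ t (j / 2) F)
decreasing_by all_goals exact Nat.lt_succ_of_le (Nat.div_le_self _ _)

theorem heapPart_left (P t : ℕ → Finset ℕ → ℕ) (S : Finset ℕ) (j : ℕ) :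
    heapPart P t S (2 * j + 1) = ((heapPart P t S j).image
      (· % (P j (heapPart P t S j) + 1))).filter (· ≤ t j (heapPart P t S j)) := by
  rw [heapPart]
  simp

theorem heapPart_right (P t : ℕ → Finset ℕ → ℕ) (S : Finset ℕ) (j : ℕ) :
    heapPart P t S (2 * j + 2) = ((heapPart P t S j).image
      (· % (P j (heapPart P t S j) + 1))).filter (¬ · ≤ t j (heapPart P t S j)) := by
  rw [heapPart]
  simp only [show (2 * j + 1) / 2 = j by omega]
  rw [if_neg (by omega)]

/-- Every small set is coloured injectively by one of the colourings. -/
theorem exists_heapColor_injOn {b q τ : ℕ} (T : PerfectTable (2 * b ^ 3) b q τ) (hb : 32 ≤ b)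
    (hτ : 0 < τ) (lam : ℕ) (S : Finset ℕ) (hS : S.card ≤ b * (lam + 1))
    (hlt : ∀ x ∈ S, x < 2 ^ (b * (lam + 1))) :
    ∃ G : ℕ → ℕ, (∀ i, G i < heapRadix lam (2 * b ^ 3) τ i) ∧
      Set.InjOn (heapColor lam q (2 * b ^ 3) T.tab G) (S : Set ℕ) := by
  have hN : 0 < 2 * b ^ 3 := by positivity
  have hchoice : ∀ (j : ℕ) (F : Finset ℕ), ∃ P t, P < heapRadix lam (2 * b ^ 3) τ (2 * j) ∧
      t < heapRadix lam (2 * b ^ 3) τ (2 * j + 1) ∧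
      ((F.card ≤ b * heapLeaves lam j ∧ ∀ x ∈ F, x < 2 ^ (b * heapCap lam j)) →
      Set.InjOn (fun x => x % (P + 1)) (F : Set ℕ) ∧
      (j < lam → ((F.image (· % (P + 1))).filter (· ≤ t)).card ≤ b * heapLeaves lam (2 * j + 1) ∧
        ((F.image (· % (P + 1))).filter (¬ · ≤ t)).card ≤ b * heapLeaves lam (2 * j + 2)) ∧
      (lam ≤ j → Set.InjOn (fun c => T.tab (t * (2 * b ^ 3) + c))
        (F.image (· % (P + 1)) : Finset ℕ))) := by
    intro j F
    by_cases h : F.card ≤ b * heapLeaves lam j ∧ ∀ x ∈ F, x < 2 ^ (b * heapCap lam j)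
    · obtain ⟨P, hP, t, ht, h'⟩ := exists_node_digits T hb lam j F h.1 h.2
      exact ⟨P, t, hP, ht, fun _ => h'⟩
    · exact ⟨0, 0, heapRadix_pos hN hτ _, heapRadix_pos hN hτ _, fun h' => absurd h' h⟩
  choose P t hP ht hPt using hchoice
  set F := heapPart P t S with hFdef
  -- the digits at a node depend on the set of residues that arrives there
  set G : ℕ → ℕ := fun i =>
    if i % 2 = 0 then P (i / 2) (F (i / 2)) else t (i / 2) (F (i / 2)) with hG
  have hG0 : ∀ j, G (2 * j) = P j (F j) := fun j => by
    simp only [hG]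
    rw [if_pos (by omega), show 2 * j / 2 = j by omega]
  have hG1 : ∀ j, G (2 * j + 1) = t j (F j) := fun j => by
    simp only [hG]
    rw [if_neg (by omega), show (2 * j + 1) / 2 = j by omega]
  have hleft : ∀ j, F (2 * j + 1) =
      ((F j).image (· % (G (2 * j) + 1))).filter (· ≤ G (2 * j + 1)) :=
    fun j => by rw [hG0, hG1]; exact heapPart_left P t S j
  have hright : ∀ j, F (2 * j + 2) =
      ((F j).image (· % (G (2 * j) + 1))).filter (¬ · ≤ G (2 * j + 1)) :=
    fun j => by rw [hG0, hG1]; exact heapPart_right P t S j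
  have hGlt : ∀ i, G i < heapRadix lam (2 * b ^ 3) τ i := fun i => by
    rcases Nat.even_or_odd' i with ⟨j, rfl | rfl⟩
    · rw [hG0]; exact hP _ _
    · rw [hG1]; exact ht _ _
  -- a residue at an internal node is small enough for the next hash step
  have hresidue : ∀ j < lam, ∀ i, (i = 2 * j + 1 ∨ i = 2 * j + 2) →
      heapRadix lam (2 * b ^ 3) τ (2 * j) ≤ 2 ^ (b * heapCap lam i) := by
    intro j hj i hi
    have h1 : heapCap lam j ≤ 4 * heapCap lam i := by
      have h2 := heapCap_le_two_mul_succ lam j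
      rw [heapCap_of_lt hj]
      rcases hi with rfl | rfl <;> omega
    have h3 : 32 ≤ b * heapCap lam i := by
      have := heapCap_pos lam i
      nlinarith
    refine le_trans ?_ (cube_le_two_pow h3)
    unfold heapRadix
    rw [if_neg (by omega), show 2 * j / 2 = j by omega]
    calc 2 * b ^ 3 * heapCap lam j ^ 3 ≤ 2 * b ^ 3 * (4 * heapCap lam i) ^ 3 := by gcongr
      _ = 128 * (b * heapCap lam i) ^ 3 := by ring
  have hinv : ∀ j ≤ 2 * lam, (F j).card ≤ b * heapLeaves lam j ∧
      ∀ x ∈ F j, x < 2 ^ (b * heapCap lam j) := by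
    intro j
    induction j using Nat.strong_induction_on with
    | _ j ih =>
      intro hj
      rcases Nat.eq_zero_or_pos j with rfl | hj0
      · have hF0 : F 0 = S := by rw [hFdef, heapPart]
        rw [hF0, heapLeaves_zero]
        refine ⟨hS, fun x hx => (hlt x hx).trans_le ?_⟩
        exact Nat.pow_le_pow_right (by norm_num) (Nat.mul_le_mul_left _ (le_heapCap_zero lam))
      · obtain ⟨i, hi⟩ : ∃ i, j = 2 * i + 1 ∨ j = 2 * i + 2 := ⟨(j - 1) / 2, by omega⟩
        have hilam : i < lam := by omega
        have h' := (hPt i (F i) (ih i (by omega) (by omega))).2.1 hilam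
        have hmem : ∀ x ∈ (F i).image (· % (G (2 * i) + 1)), x < 2 ^ (b * heapCap lam j) := by
          intro x hx
          obtain ⟨y, -, rfl⟩ := Finset.mem_image.1 hx
          have h1 := Nat.mod_lt y (Nat.succ_pos (G (2 * i)))
          have h2 := hGlt (2 * i)
          have h3 := hresidue i hilam j hi
          simp only [Nat.succ_eq_add_one] at h1
          omega
        rw [← hG0, ← hG1, ← hleft, ← hright] at h'
        rcases hi with rfl | rfl
        · refine ⟨h'.1, fun x hx => hmem x ?_⟩
          rw [hleft] at hx
          exact (Finset.mem_filter.1 hx).1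
        · refine ⟨h'.2, fun x hx => hmem x ?_⟩
          rw [hright] at hx
          exact (Finset.mem_filter.1 hx).1
  have hmodinj : ∀ j ≤ 2 * lam, Set.InjOn (fun x => x % (G (2 * j) + 1)) (F j : Set ℕ) :=
    fun j hj => by rw [hG0]; exact (hPt j (F j) (hinv j hj)).1
  have hchild : ∀ j, ∀ x ∈ F j, x % (G (2 * j) + 1) ∈
      F (if x % (G (2 * j) + 1) ≤ G (2 * j + 1) then 2 * j + 1 else 2 * j + 2) := by
    intro j x hx
    have hmem : x % (G (2 * j) + 1) ∈ (F j).image (· % (G (2 * j) + 1)) :=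
      Finset.mem_image_of_mem _ hx
    split_ifs with h
    · rw [hleft]; exact Finset.mem_filter.2 ⟨hmem, h⟩
    · rw [hright]; exact Finset.mem_filter.2 ⟨hmem, h⟩
  have hwalk : ∀ j, j ≤ 2 * lam → ∀ x ∈ F j, ∃ i, lam ≤ i ∧ i ≤ 2 * lam ∧
      (heapWalk lam G j x).1 = i ∧
      (heapWalk lam G j x).2 ∈ (F i).image (· % (G (2 * i) + 1)) := by
    refine heap_induction (lam := lam) (fun j h hj x hx => ?_) (fun j h ih hj x hx => ?_)
    · rw [heapWalk_of_le h]
      exact ⟨j, h, hj, rfl, Finset.mem_image_of_mem _ hx⟩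
    · rw [heapWalk_of_lt h]
      refine ih _ ?_ ?_ _ (hchild j x hx) <;> split_ifs <;> omega
  have hwalkinj : ∀ j, j ≤ 2 * lam → ∀ x ∈ F j, ∀ y ∈ F j,
      heapWalk lam G j x = heapWalk lam G j y → x = y := by
    -- the leaf reached determines the branch, as the two branches lead to disjoint sets of leaves
    have hbranch : ∀ j x, ∃ d, ∃ r < 2 ^ d, (heapWalk lam G j x).1 + 1 = (j + 1) * 2 ^ d + r := by
      refine heap_induction (lam := lam) (fun j h x => ?_) (fun j h ih x => ?_)
      · rw [heapWalk_of_le h]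
        exact ⟨0, 0, by norm_num, by simp⟩
      · rw [heapWalk_of_lt h]
        split_ifs
        · obtain ⟨d, r, hr, h⟩ := ih (2 * j + 1) (by omega) (x % (G (2 * j) + 1))
          exact ⟨d + 1, r, by rw [pow_succ]; omega, by rw [h]; ring⟩
        · obtain ⟨d, r, hr, h⟩ := ih (2 * j + 2) (by omega) (x % (G (2 * j) + 1))
          exact ⟨d + 1, r + 2 ^ d, by rw [pow_succ]; omega, by rw [h]; ring⟩
    have hdisj : ∀ j x y, (heapWalk lam G (2 * j + 1) x).1 ≠ (heapWalk lam G (2 * j + 2) y).1 := by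
      intro j x y h
      obtain ⟨d, r, hr, h1⟩ := hbranch (2 * j + 1) x
      obtain ⟨d', r', hr', h2⟩ := hbranch (2 * j + 2) y
      rw [h, h2] at h1
      have hlog1 : (2 * j + 1 + 1) * 2 ^ d + r < (2 * j + 3) * 2 ^ d := by nlinarith
      rcases lt_or_ge d' d with hd | hd
      · obtain ⟨e, rfl⟩ := Nat.exists_eq_add_of_lt hd
        have e1 : 2 ^ (d' + e + 1) = 2 * (2 ^ d' * 2 ^ e) := by ring
        have e2 := Nat.one_le_two_pow (n := e)
        have e3 := Nat.one_le_two_pow (n := d')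
        rw [e1] at h1
        have e4 : 2 ^ d' ≤ 2 ^ d' * 2 ^ e := Nat.le_mul_of_pos_right _ (by omega)
        nlinarith
      · obtain ⟨e, rfl⟩ := Nat.exists_eq_add_of_le hd
        have e2 := Nat.one_le_two_pow (n := e)
        have e1 : 2 ^ (d + e) = 2 ^ d * 2 ^ e := by ring
        rw [e1] at h1
        have e4 : 2 ^ d ≤ 2 ^ d * 2 ^ e := Nat.le_mul_of_pos_right _ (by omega)
        nlinarith
    refine heap_induction (lam := lam) (fun j h hj x hx y hy hxy => ?_)
      (fun j h ih hj x hx y hy hxy => ?_)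
    · rw [heapWalk_of_le h, heapWalk_of_le h] at hxy
      exact hmodinj j hj hx hy (Prod.mk.inj hxy).2
    · have h1 := hchild j x hx
      have h2 := hchild j y hy
      rw [heapWalk_of_lt h, heapWalk_of_lt h] at hxy
      refine hmodinj j hj hx hy ?_
      split_ifs at h1 h2 hxy with hx' hy' hy'
      · exact ih _ (by omega) (by omega) _ h1 _ h2 hxy
      · exact absurd (congrArg Prod.fst hxy) (hdisj j _ _)
      · exact absurd (congrArg Prod.fst hxy.symm) (hdisj j _ _)
      · exact ih _ (by omega) (by omega) _ h1 _ h2 hxy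
  refine ⟨G, hGlt, fun x hx y hy hxy => ?_⟩
  have hF0 : F 0 = S := by rw [hFdef, heapPart]
  refine hwalkinj 0 (by omega) x (hF0 ▸ hx) y (hF0 ▸ hy) ?_
  obtain ⟨i, hi1, hi2, hix, hmx⟩ := hwalk 0 (by omega) x (hF0 ▸ hx)
  obtain ⟨i', hi1', -, hiy, hmy⟩ := hwalk 0 (by omega) y (hF0 ▸ hy)
  unfold heapColor at hxy
  rw [hix, hiy] at hxy
  have hlt1 := T.lt (G (2 * i + 1) * (2 * b ^ 3) + (heapWalk lam G 0 x).2)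
  have hlt2 := T.lt (G (2 * i' + 1) * (2 * b ^ 3) + (heapWalk lam G 0 y).2)
  have hq : 0 < q := by omega
  have hii : i = i' := by
    have := congrArg (· / q) hxy
    simp only [add_comm (_ * q), Nat.add_mul_div_right _ _ hq, Nat.div_eq_of_lt hlt1,
      Nat.div_eq_of_lt hlt2] at this
    omega
  subst hii
  refine Prod.ext (hix.trans hiy.symm) ?_
  have hinj := (hPt i (F i) (hinv i hi2)).2.2 hi1
  rw [← hG0, ← hG1] at hinj
  exact hinj hmx hmy (Nat.add_left_cancel hxy)

theorem heapColor_lt {lam q N : ℕ} {tab : ℕ → ℕ} (htab : ∀ i, tab i < q) (G : ℕ → ℕ) (x : ℕ) :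
    heapColor lam q N tab G x < (lam + 1) * q := by
  have hleaf : ∀ j, j ≤ 2 * lam → ∀ x, (heapWalk lam G j x).1 ≤ 2 * lam := by
    refine heap_induction (lam := lam) (fun j h hj x => ?_) (fun j h ih hj x => ?_)
    · rw [heapWalk_of_le h]; exact hj
    · rw [heapWalk_of_lt h]
      exact ih _ (by split_ifs <;> omega) (by split_ifs <;> omega) _
  have h1 := hleaf 0 (by omega) x
  have h2 := htab (G (2 * (heapWalk lam G 0 x).1 + 1) * N + (heapWalk lam G 0 x).2)
  have h3 : ((heapWalk lam G 0 x).1 - lam) * q ≤ lam * q := Nat.mul_le_mul_right _ (by omega)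
  unfold heapColor
  rw [add_mul]
  omega

theorem heapColor_congr {lam q N : ℕ} {tab G G' : ℕ → ℕ}
    (h : ∀ i < 4 * lam + 2, G i = G' i) (x : ℕ) :
    heapColor lam q N tab G x = heapColor lam q N tab G' x := by
  have hwalk : ∀ j, j ≤ 2 * lam → ∀ x, heapWalk lam G j x = heapWalk lam G' j x ∧
      (heapWalk lam G j x).1 ≤ 2 * lam := by
    refine heap_induction (lam := lam) (fun j hj hj' x => ?_) (fun j hj ih hj' x => ?_)
    · rw [heapWalk_of_le hj, heapWalk_of_le hj, h _ (by omega)]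
      exact ⟨rfl, hj'⟩
    · rw [heapWalk_of_lt hj, heapWalk_of_lt hj, h (2 * j) (by omega), h (2 * j + 1) (by omega)]
      exact ih _ (by split_ifs <;> omega) (by split_ifs <;> omega) _
  obtain ⟨h1, h2⟩ := hwalk 0 (by omega) x
  unfold heapColor
  rw [h _ (by omega), h1]

/-! ### Mixed radix representations -/

/-- The place values of the mixed radix system with radices `Q 0, Q 1, …`. -/
def placeValue (Q : ℕ → ℕ) (i : ℕ) : ℕ := ∏ k ∈ Finset.range i, Q k

/-- The digits of `c` in the mixed radix system with radices `Q 0, Q 1, …`. -/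
def mixedDigit (Q : ℕ → ℕ) (c i : ℕ) : ℕ := c % placeValue Q (i + 1) / placeValue Q i

theorem placeValue_zero (Q : ℕ → ℕ) : placeValue Q 0 = 1 := by simp [placeValue]

theorem placeValue_succ (Q : ℕ → ℕ) (i : ℕ) : placeValue Q (i + 1) = placeValue Q i * Q i := by
  simp [placeValue, Finset.prod_range_succ]

theorem placeValue_pos {Q : ℕ → ℕ} (hQ : ∀ i, 0 < Q i) (i : ℕ) : 0 < placeValue Q i :=
  Finset.prod_pos fun k _ => hQ k

theorem placeValue_const (r i : ℕ) : placeValue (fun _ => r) i = r ^ i := by simp [placeValue]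

theorem placeValue_dvd (Q : ℕ → ℕ) {i j : ℕ} (h : i ≤ j) : placeValue Q i ∣ placeValue Q j :=
  Finset.prod_dvd_prod_of_subset _ _ _ (Finset.range_subset_range.2 h)

theorem mixedDigit_lt {Q : ℕ → ℕ} (hQ : ∀ i, 0 < Q i) (c i : ℕ) : mixedDigit Q c i < Q i := by
  unfold mixedDigit
  rw [Nat.div_lt_iff_lt_mul (placeValue_pos hQ i), mul_comm, ← placeValue_succ]
  exact Nat.mod_lt _ (placeValue_pos hQ _)

/-- Every sequence of digits is represented by a number. -/
theorem exists_mixedDigit_eq {Q : ℕ → ℕ} (hQ : ∀ i, 0 < Q i) (d : ℕ → ℕ)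
    (hd : ∀ i, d i < Q i) (N : ℕ) :
    ∃ c < placeValue Q N, ∀ i < N, mixedDigit Q c i = d i := by
  induction N with
  | zero => exact ⟨0, by simp [placeValue_zero], by simp⟩
  | succ N ih =>
    obtain ⟨c, hc, h⟩ := ih
    have hlt : c + d N * placeValue Q N < placeValue Q (N + 1) := by
      rw [placeValue_succ]
      have := hd N
      calc c + d N * placeValue Q N < (d N + 1) * placeValue Q N := by rw [add_mul]; omega
        _ ≤ Q N * placeValue Q N := Nat.mul_le_mul_right _ this
        _ = _ := mul_comm _ _
    refine ⟨_, hlt, fun i hi => ?_⟩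
    rcases Nat.lt_succ_iff_lt_or_eq.1 hi with hi | rfl
    · rw [← h i hi]
      unfold mixedDigit
      congr 1
      obtain ⟨e, he⟩ := placeValue_dvd Q (Nat.succ_le_of_lt hi)
      rw [he, show d N * (placeValue Q (i.succ) * e) = placeValue Q (i + 1) * (d N * e) by
        simp only [Nat.succ_eq_add_one]; ring, Nat.add_mul_mod_self_left]
    · unfold mixedDigit
      rw [Nat.mod_eq_of_lt hlt, Nat.add_mul_div_right _ _ (placeValue_pos hQ _),
        Nat.div_eq_of_lt hc, zero_add]

/-! ### The number of colourings -/

theorem prod_heapCap_le (lam : ℕ) :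
    ((∏ j ∈ Finset.range (2 * lam + 1), heapCap lam j : ℕ) : ℝ) ≤ Real.exp 2 ^ (lam + 1) := by
  set M := 2 * (lam + 1) with hM
  have h1 : (∏ j ∈ Finset.range (2 * lam + 1), heapCap lam j) * (2 * lam + 1).factorial ≤
      M ^ (2 * lam + 1) := by
    rw [← Finset.prod_range_add_one_eq_factorial, ← Finset.prod_mul_distrib]
    refine (Finset.prod_le_pow_card _ _ M fun j hj => ?_).trans (by simp)
    rw [mul_comm]
    exact succ_mul_heapCap_le lam j (by have := Finset.mem_range.1 hj; omega)
  have h2 : ((∏ j ∈ Finset.range (2 * lam + 1), heapCap lam j : ℕ) : ℝ) * (M.factorial : ℝ) ≤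
      (M : ℝ) ^ M := by
    have : (∏ j ∈ Finset.range (2 * lam + 1), heapCap lam j) * M.factorial ≤ M ^ M := by
      rw [show M = 2 * lam + 1 + 1 by omega, Nat.factorial_succ, pow_succ,
        ← show M = 2 * lam + 1 + 1 by omega]
      calc _ = (∏ j ∈ Finset.range (2 * lam + 1), heapCap lam j) * (2 * lam + 1).factorial * M := by
            ring
        _ ≤ _ := Nat.mul_le_mul_right _ h1
    exact_mod_cast this
  have h3 := Real.pow_div_factorial_le_exp (M : ℝ) (by positivity) M
  have hfac : (0 : ℝ) < (M.factorial : ℝ) := by positivity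
  calc _ ≤ (M : ℝ) ^ M / (M.factorial : ℝ) := by rwa [le_div_iff₀ hfac]
    _ ≤ Real.exp M := h3
    _ = Real.exp 2 ^ (lam + 1) := by
      rw [← Real.exp_nat_mul, hM]; push_cast; ring_nf

/-- There are only exponentially many colourings, since `∏ heapCap` is at most `N ^ N / N!` for
`N = 2 * (lam + 1)`. -/
theorem placeValue_heapRadix_le {lam N τ : ℕ} (hN : 0 < N) (hτ : 0 < τ) :
    (placeValue (heapRadix lam N τ) (4 * lam + 2) : ℝ) ≤
        ((N : ℝ) ^ 4 * Real.exp 12 * τ) ^ (lam + 1) := by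
  have hsplit : ∀ n, placeValue (heapRadix lam N τ) (2 * n) = ∏ j ∈ Finset.range n,
      (heapRadix lam N τ (2 * j) * heapRadix lam N τ (2 * j + 1)) := by
    intro n
    induction n with
    | zero => simp [placeValue]
    | succ n ih =>
      rw [Finset.prod_range_succ, ← ih, show 2 * (n + 1) = 2 * n + 1 + 1 by ring,
        placeValue_succ, placeValue_succ]
      ring
  have hle : placeValue (heapRadix lam N τ) (4 * lam + 2) ≤
      ∏ j ∈ Finset.range (2 * lam + 1),
          ((N * heapCap lam j ^ 3) ^ 2 * if lam ≤ j then τ else 1) := by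
    rw [show 4 * lam + 2 = 2 * (2 * lam + 1) by ring, hsplit]
    refine Finset.prod_le_prod' fun j _ => ?_
    unfold heapRadix
    rw [if_neg (by omega : ¬ (2 * j % 2 = 1 ∧ _)), show 2 * j / 2 = j by omega,
      show (2 * j + 1) / 2 = j by omega]
    have hpos : 0 < N * heapCap lam j ^ 3 := Nat.mul_pos hN (pow_pos (heapCap_pos _ _) _)
    split_ifs with h1 h2 h2
    · rw [sq]
      nlinarith [Nat.mul_le_mul_right (N * heapCap lam j ^ 3 * τ) hpos]
    · omega
    · omega
    · rw [sq, mul_one]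
  have hτprod : (∏ j ∈ Finset.range (2 * lam + 1), if lam ≤ j then τ else 1) = τ ^ (lam + 1) := by
    rw [show 2 * lam + 1 = lam + (lam + 1) by ring, Finset.prod_range_add]
    rw [Finset.prod_eq_one fun j hj => if_neg (by have := Finset.mem_range.1 hj; omega), one_mul,
      Finset.prod_congr rfl fun j _ => if_pos (Nat.le_add_right lam j)]
    simp
  have hprod : ∏ j ∈ Finset.range (2 * lam + 1),
      ((N * heapCap lam j ^ 3) ^ 2 * if lam ≤ j then τ else 1)
      = N ^ (2 * (2 * lam + 1)) * (∏ j ∈ Finset.range (2 * lam + 1), heapCap lam j) ^ 6 *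
        τ ^ (lam + 1) := by
    rw [Finset.prod_mul_distrib, hτprod, ← Finset.prod_pow]
    congr 1
    rw [Finset.prod_congr rfl fun j _ => show (N * heapCap lam j ^ 3) ^ 2 =
        N ^ 2 * heapCap lam j ^ 6 by
      ring, Finset.prod_mul_distrib]
    simp [← pow_mul]
  calc (placeValue (heapRadix lam N τ) (4 * lam + 2) : ℝ)
      ≤ ((N ^ (2 * (2 * lam + 1)) * (∏ j ∈ Finset.range (2 * lam + 1), heapCap lam j) ^ 6 *
        τ ^ (lam + 1) : ℕ) : ℝ) := by rw [← hprod]; exact_mod_cast hle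
    _ = (N : ℝ) ^ (2 * (2 * lam + 1)) *
        ((∏ j ∈ Finset.range (2 * lam + 1), heapCap lam j : ℕ) : ℝ) ^ 6 * (τ : ℝ) ^ (lam + 1) := by
        push_cast; ring
    _ ≤ (N : ℝ) ^ (4 * (lam + 1)) * (Real.exp 2 ^ (lam + 1)) ^ 6 * (τ : ℝ) ^ (lam + 1) := by
        have hN1 : (1 : ℝ) ≤ N := by exact_mod_cast hN
        have := prod_heapCap_le lam
        have h4 : 2 * (2 * lam + 1) ≤ 4 * (lam + 1) := by omega
        have h5 := pow_le_pow_right₀ hN1 h4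
        gcongr
    _ = _ := by
        rw [mul_pow, mul_pow, ← pow_mul, ← pow_mul,
          show Real.exp 12 = Real.exp 2 ^ 6 by rw [← Real.exp_nat_mul]; norm_num, ← pow_mul]
        ring

/-! ### Fair allocations and colour sets -/

/-- The bundle-finding problem for one agent, with utilities `u`, when only jobs with colours in `Z`
may be used. -/
def SbCFFA.HasBundle (J : SbCFFA) (u : Fin J.m → ℕ) (col : ℕ → ℕ) (Z : Finset ℕ) : Prop :=
  ∃ S : Finset (Fin J.m), J.H.IsIndepSet (S : Set (Fin J.m)) ∧ S.card ≤ J.s ∧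
    J.η ≤ ∑ x ∈ S, u x ∧ ∀ x ∈ S, col x ∈ Z

/-- The colour set `X` is the disjoint union of colour sets in which the agents before agent `a`
find bundles. -/
def SbCFFA.Reach (J : SbCFFA) (col : ℕ → ℕ) : ℕ → Finset ℕ → Prop
  | 0, X => X = ∅
  | a + 1, X => ∃ (h : a < J.n) (Y Z : Finset ℕ), Disjoint Y Z ∧ Y ∪ Z = X ∧ J.Reach col a Y ∧
      J.HasBundle (J.u ⟨a, h⟩) col Z

theorem SbCFFA.Reach.exists_bundles {J : SbCFFA} {col : ℕ → ℕ} {a : ℕ} {X : Finset ℕ}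
    (h : J.Reach col a X) :
    ∃ φ : ℕ → Finset (Fin J.m),
      (∀ i, (hi : i < J.n) → i < a → J.H.IsIndepSet (φ i : Set (Fin J.m)) ∧ (φ i).card ≤ J.s ∧
        J.η ≤ ∑ x ∈ φ i, J.u ⟨i, hi⟩ x) ∧
      (∀ i < a, ∀ i' < a, i ≠ i' → Disjoint (φ i) (φ i')) ∧ ∀ i < a, ∀ x ∈ φ i, col x ∈ X := by
  induction a generalizing X with
  | zero => exact ⟨fun _ => ∅, by simp, by simp, by simp⟩
  | succ a ih =>
    obtain ⟨ha, Y, Z, hYZ, rfl, hY, S, hS1, hS2, hS3, hS4⟩ := h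
    obtain ⟨φ, h1, h2, h3⟩ := ih hY
    have hdisj : ∀ i < a, Disjoint (φ i) S := fun i hi => Finset.disjoint_left.2 fun x hx hx' =>
      Finset.disjoint_left.1 hYZ (h3 i hi x hx) (hS4 x hx')
    refine ⟨Function.update φ a S, ?_, ?_, ?_⟩
    · intro i hi hia
      by_cases h : i = a
      · subst h; simpa using ⟨hS1, hS2, hS3⟩
      · simpa [h] using h1 i hi (by omega)
    · intro i hi i' hi' hne
      by_cases h : i = a
      · subst h
        simpa [hne.symm] using (hdisj i' (by omega)).symm
      · by_cases h' : i' = a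
        · subst h'
          simpa [hne] using hdisj i (by omega)
        · simpa [h, h'] using h2 i (by omega) i' (by omega) hne
    · intro i hi x hx
      by_cases h : i = a
      · subst h
        exact Finset.mem_union_right _ (hS4 x (by simpa using hx))
      · exact Finset.mem_union_left _ (h3 i (by omega) x (by simpa [h] using hx))

theorem SbCFFA.Reach.isYes {J : SbCFFA} {col : ℕ → ℕ} {X : Finset ℕ} (h : J.Reach col J.n X) :
    J.IsYes := by
  obtain ⟨φ, h1, h2, -⟩ := h.exists_bundles
  exact ⟨fun a => φ a, fun a => h1 a a.2 a.2,
    fun a a' hne => h2 a a.2 a' a'.2 fun h => hne (Fin.ext h)⟩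

theorem SbCFFA.reach_image {J : SbCFFA} {col : ℕ → ℕ} {a : ℕ} {X : Finset ℕ}
    {φ : Fin J.n → Finset (Fin J.m)}
    (hφ : ∀ a, J.H.IsIndepSet (φ a : Set (Fin J.m)) ∧ (φ a).card ≤ J.s ∧ J.η ≤ ∑ x ∈ φ a, J.u a x)
    (hdisj : ∀ a a', a ≠ a' → Disjoint (φ a) (φ a'))
    (hinj : Set.InjOn (fun x : Fin J.m => col x) {x | ∃ a, x ∈ φ a}) (ha : a ≤ J.n)
    (hX : X = ((Finset.univ.filter fun i : Fin J.n => (i : ℕ) < a).biUnion φ).image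
      fun x : Fin J.m => col x) :
    J.Reach col a X := by
  induction a generalizing X with
  | zero => simp [hX, SbCFFA.Reach]
  | succ a ih =>
    refine ⟨ha, _, (φ ⟨a, ha⟩).image fun x : Fin J.m => col x, ?_, ?_, ih (by omega) rfl, φ ⟨a, ha⟩,
      (hφ _).1, (hφ _).2.1, (hφ _).2.2, fun x hx => Finset.mem_image_of_mem _ hx⟩
    · rw [Finset.disjoint_left]
      intro c hc hc'
      obtain ⟨x, hx, rfl⟩ := Finset.mem_image.1 hc
      obtain ⟨y, hy, hxy⟩ := Finset.mem_image.1 hc'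
      obtain ⟨i, hi, hxi⟩ := Finset.mem_biUnion.1 hx
      have hia : (i : ℕ) < a := (Finset.mem_filter.1 hi).2
      have : y = x := hinj ⟨_, hy⟩ ⟨_, hxi⟩ hxy
      subst this
      exact Finset.disjoint_left.1 (hdisj i ⟨a, ha⟩ fun h => by
        rw [h] at hia; simp at hia) hxi hy
    · rw [hX, ← Finset.image_union]
      congr 1
      ext x
      simp only [Finset.mem_union, Finset.mem_biUnion, Finset.mem_filter, Finset.mem_univ, true_and]
      constructor
      · rintro (⟨i, hi, hx⟩ | hx)
        · exact ⟨i, by omega, hx⟩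
        · exact ⟨⟨a, ha⟩, by simp, hx⟩
      · rintro ⟨i, hi, hx⟩
        by_cases h : (i : ℕ) = a
        · right
          have : i = ⟨a, ha⟩ := Fin.ext h
          rwa [this] at hx
        · exact Or.inl ⟨i, by omega, hx⟩

/-- A solution is found by every colouring that is injective on the allocated jobs. -/
theorem SbCFFA.IsYes.exists_set {J : SbCFFA} (h : J.IsYes) :
    ∃ S : Finset ℕ, S.card ≤ J.n * J.s ∧ (∀ x ∈ S, x < J.m) ∧
      ∀ (col : ℕ → ℕ) (q : ℕ), Set.InjOn col (S : Set ℕ) → (∀ x, col x < q) →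
        ∃ X ⊆ Finset.range q, J.Reach col J.n X := by
  classical
  obtain ⟨φ, hφ, hdisj⟩ := h
  refine ⟨(Finset.univ.biUnion φ).image Fin.val, ?_, ?_, ?_⟩
  · refine Finset.card_image_le.trans (Finset.card_biUnion_le.trans ?_)
    refine (Finset.sum_le_sum fun a _ => (hφ a).2.1).trans ?_
    simp
  · intro x hx
    obtain ⟨y, -, rfl⟩ := Finset.mem_image.1 hx
    exact y.2
  · intro col q hcol hq
    refine ⟨_, ?_, SbCFFA.reach_image hφ hdisj ?_ le_rfl rfl⟩
    · intro c hc
      obtain ⟨x, -, rfl⟩ := Finset.mem_image.1 hc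
      exact Finset.mem_range.2 (hq _)
    rintro x ⟨a, hx⟩ y ⟨a', hy⟩ hxy
    refine Fin.ext (hcol ?_ ?_ hxy)
    · simp only [Finset.coe_image]
      exact ⟨x, by simp; exact ⟨a, hx⟩, rfl⟩
    · simp only [Finset.coe_image]
      exact ⟨y, by simp; exact ⟨a', hy⟩, rfl⟩

/-! ### Reasoning about programs -/

infixr:60 " ;; " => RAMProg.seq

/-- The program contains an instruction that writes to the register `x`. -/
def RAMProg.SetsReg (x : ℕ) : RAMProg → Prop
  | .skip => False
  | .const y _ => x = y
  | .add y _ _ => x = y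
  | .sub y _ _ => x = y
  | .load y _ _ => x = y
  | .store _ _ _ => False
  | .seq p q => p.SetsReg x ∨ q.SetsReg x
  | .cond _ p q => p.SetsReg x ∨ q.SetsReg x
  | .loop _ p => p.SetsReg x

/-- The program contains an instruction that writes to the array `b`. -/
def RAMProg.SetsArr (b : ℕ) : RAMProg → Prop
  | .skip => False
  | .const _ _ => False
  | .add _ _ _ => False
  | .sub _ _ _ => False
  | .load _ _ _ => False
  | .store b' _ _ => b = b'
  | .seq p q => p.SetsArr b ∨ q.SetsArr b
  | .cond _ p q => p.SetsArr b ∨ q.SetsArr b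
  | .loop _ p => p.SetsArr b

@[simp] theorem RAMState.setReg_reg (σ : RAMState) (x v y : ℕ) :
    (σ.setReg x v).reg y = if y = x then v else σ.reg y := by
  simp [RAMState.setReg, Function.update_apply]

@[simp] theorem RAMState.setReg_arr (σ : RAMState) (x v : ℕ) : (σ.setReg x v).arr = σ.arr := rfl

@[simp] theorem RAMState.setArr_reg (σ : RAMState) (b i v : ℕ) : (σ.setArr b i v).reg = σ.reg := rfl

@[simp] theorem RAMState.setArr_arr (σ : RAMState) (b i v b' : ℕ) :
    (σ.setArr b i v).arr b' = if b' = b then Function.update (σ.arr b) i v else σ.arr b' := by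
  simp [RAMState.setArr, Function.update_apply]

/-- The states `σ` and `τ` agree on everything that `p` does not write to. -/
structure Agree (p : RAMProg) (σ τ : RAMState) : Prop where
  reg : ∀ x, ¬ p.SetsReg x → τ.reg x = σ.reg x
  arr : ∀ b, ¬ p.SetsArr b → τ.arr b = σ.arr b

theorem RAMExec.agree {p : RAMProg} {σ τ : RAMState} {t : ℕ} (h : RAMExec p σ t τ) :
    Agree p σ τ := by
  induction h with
  | skip => exact ⟨fun _ _ => rfl, fun _ _ => rfl⟩
  | const x a σ | add x y z σ | sub x y z σ | load x b y σ =>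
    exact ⟨fun z hz => by simp [show ¬ z = x from hz], fun _ _ => rfl⟩
  | store b x y σ => exact ⟨fun _ _ => rfl, fun c hc => by simp [show ¬ c = b from hc]⟩
  | seq _ _ ih₁ ih₂ =>
    exact ⟨fun x hx => (ih₂.reg x fun h => hx (Or.inr h)).trans (ih₁.reg x fun h => hx (Or.inl h)),
      fun x hx => (ih₂.arr x fun h => hx (Or.inr h)).trans (ih₁.arr x fun h => hx (Or.inl h))⟩
  | cond_true _ _ ih =>
    exact ⟨fun x hx => ih.reg x fun h => hx (Or.inl h), fun x hx => ih.arr x fun h => hx (Or.inl h)⟩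
  | cond_false _ _ ih =>
    exact ⟨fun x hx => ih.reg x fun h => hx (Or.inr h), fun x hx => ih.arr x fun h => hx (Or.inr h)⟩
  | loop_true _ _ _ ih₁ ih₂ =>
    exact ⟨fun x hx => (ih₂.reg x hx).trans (ih₁.reg x hx),
      fun x hx => (ih₂.arr x hx).trans (ih₁.arr x hx)⟩
  | loop_false => exact ⟨fun _ _ => rfl, fun _ _ => rfl⟩

/-- Started in `σ`, the program `p` halts after at most `T` steps in a state satisfying `Q`. -/
def Runs (p : RAMProg) (σ : RAMState) (T : ℕ) (Q : RAMState → Prop) : Prop :=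
  ∃ t τ, RAMExec p σ t τ ∧ t ≤ T ∧ Q τ

namespace Runs

variable {p q : RAMProg} {σ : RAMState} {T T' T₁ T₂ x y z a b : ℕ} {Q R : RAMState → Prop}

theorem of_le (h : Runs p σ T Q) (hT : T ≤ T') : Runs p σ T' Q := by
  obtain ⟨t, τ, h, ht, hQ⟩ := h
  exact ⟨t, τ, h, ht.trans hT, hQ⟩

theorem imp (h : Runs p σ T R) (k : ∀ τ, Agree p σ τ → R τ → Q τ) : Runs p σ T Q := by
  obtain ⟨t, τ, h, ht, hQ⟩ := h
  exact ⟨t, τ, h, ht, k τ h.agree hQ⟩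

theorem seq (h : Runs p σ T₁ R) (k : ∀ τ, Agree p σ τ → R τ → Runs q τ T₂ Q) :
    Runs (p ;; q) σ (T₁ + T₂) Q := by
  obtain ⟨t, τ, h, ht, hQ⟩ := h
  obtain ⟨t', τ', h', ht', hQ'⟩ := k τ h.agree hQ
  exact ⟨_, τ', h.seq h', by omega, hQ'⟩

theorem skip (h : Q σ) : Runs .skip σ 1 Q := ⟨_, _, .skip σ, le_rfl, h⟩

theorem const (h : Q (σ.setReg x a)) : Runs (.const x a) σ 1 Q := ⟨_, _, .const x a σ, le_rfl, h⟩

theorem add (h : Q (σ.setReg x (σ.reg y + σ.reg z))) : Runs (.add x y z) σ 1 Q :=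
  ⟨_, _, .add x y z σ, le_rfl, h⟩

theorem sub (h : Q (σ.setReg x (σ.reg y - σ.reg z))) : Runs (.sub x y z) σ 1 Q :=
  ⟨_, _, .sub x y z σ, le_rfl, h⟩

theorem load (h : Q (σ.setReg x (σ.arr b (σ.reg y)))) : Runs (.load x b y) σ 1 Q :=
  ⟨_, _, .load x b y σ, le_rfl, h⟩

theorem store (h : Q (σ.setArr b (σ.reg x) (σ.reg y))) : Runs (.store b x y) σ 1 Q :=
  ⟨_, _, .store b x y σ, le_rfl, h⟩

theorem const_seq (h : Runs q (σ.setReg x a) T Q) : Runs (.const x a ;; q) σ (1 + T) Q :=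
  (const (Q := fun τ => τ = σ.setReg x a) rfl).seq fun _ _ e => e ▸ h

theorem add_seq (h : Runs q (σ.setReg x (σ.reg y + σ.reg z)) T Q) :
    Runs (.add x y z ;; q) σ (1 + T) Q :=
  (add (Q := fun τ => τ = σ.setReg x (σ.reg y + σ.reg z)) rfl).seq fun _ _ e => e ▸ h

theorem sub_seq (h : Runs q (σ.setReg x (σ.reg y - σ.reg z)) T Q) :
    Runs (.sub x y z ;; q) σ (1 + T) Q :=
  (sub (Q := fun τ => τ = σ.setReg x (σ.reg y - σ.reg z)) rfl).seq fun _ _ e => e ▸ h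

theorem load_seq (h : Runs q (σ.setReg x (σ.arr b (σ.reg y))) T Q) :
    Runs (.load x b y ;; q) σ (1 + T) Q :=
  (load (Q := fun τ => τ = σ.setReg x (σ.arr b (σ.reg y))) rfl).seq fun _ _ e => e ▸ h

theorem store_seq (h : Runs q (σ.setArr b (σ.reg x) (σ.reg y)) T Q) :
    Runs (.store b x y ;; q) σ (1 + T) Q :=
  (store (Q := fun τ => τ = σ.setArr b (σ.reg x) (σ.reg y)) rfl).seq fun _ _ e => e ▸ h

theorem cond (h₁ : σ.reg x ≠ 0 → Runs p σ T Q) (h₂ : σ.reg x = 0 → Runs q σ T Q) :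
    Runs (.cond x p q) σ (T + 1) Q := by
  by_cases hx : σ.reg x = 0
  · obtain ⟨t, τ, h, ht, hQ⟩ := h₂ hx
    exact ⟨_, τ, .cond_false hx h, by omega, hQ⟩
  · obtain ⟨t, τ, h, ht, hQ⟩ := h₁ hx
    exact ⟨_, τ, .cond_true hx h, by omega, hQ⟩

/-- A loop with invariant `Inv` and decreasing measure `μ`. -/
theorem loop (Inv : RAMState → Prop) (μ : RAMState → ℕ)
    (h : ∀ τ, Agree p σ τ → Inv τ → τ.reg x ≠ 0 → Runs p τ T (fun τ' => Inv τ' ∧ μ τ' < μ τ))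
    (hσ : Inv σ) : Runs (.loop x p) σ (μ σ * (T + 1) + 1) (fun τ => Inv τ ∧ τ.reg x = 0) := by
  have key : ∀ n τ, Agree p σ τ → Inv τ → μ τ = n →
      Runs (.loop x p) τ (μ τ * (T + 1) + 1) (fun τ => Inv τ ∧ τ.reg x = 0) := by
    intro n
    induction n using Nat.strong_induction_on with
    | _ n ih =>
      intro τ hag hτ hn
      by_cases hx : τ.reg x = 0
      · exact ⟨1, τ, .loop_false hx, by omega, hτ, hx⟩
      · obtain ⟨t, τ', h1, ht, hI, hμ⟩ := h τ hag hτ hx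
        have h1a := h1.agree
        obtain ⟨t', τ'', h2, ht', hQ⟩ := ih (μ τ') (hn ▸ hμ) τ'
          ⟨fun x hx => (h1a.reg x hx).trans (hag.reg x hx),
            fun x hx => (h1a.arr x hx).trans (hag.arr x hx)⟩ hI rfl
        refine ⟨_, τ'', .loop_true hx h1 h2, ?_, hQ⟩
        have : (μ τ' + 1) * (T + 1) ≤ μ τ * (T + 1) := Nat.mul_le_mul_right _ hμ
        rw [add_mul] at this
        omega
  exact key _ σ ⟨fun _ _ => rfl, fun _ _ => rfl⟩ hσ rfl

end Runs

/-- `for r_i := 0, …, r_N - 1 do body`; the register `t` holds the number of remaining rounds. -/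
def forLoop (i N t : ℕ) (body : RAMProg) : RAMProg :=
  .const i 0 ;; .sub t N i ;; .loop t (body ;; .const t 1 ;; .add i i t ;; .sub t N i)

@[simp] theorem forLoop_setsReg (i N t : ℕ) (body : RAMProg) (x : ℕ) :
    (forLoop i N t body).SetsReg x ↔ x = i ∨ x = t ∨ body.SetsReg x := by
  simp [forLoop, RAMProg.SetsReg]
  tauto

@[simp] theorem forLoop_setsArr (i N t : ℕ) (body : RAMProg) (b : ℕ) :
    (forLoop i N t body).SetsArr b ↔ body.SetsArr b := by
  simp [forLoop, RAMProg.SetsArr]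

theorem Runs.forLoop {i N t : ℕ} {body : RAMProg} {σ : RAMState} {T n : ℕ}
    (Inv : ℕ → RAMState → Prop) (hN : σ.reg N = n)
    (hside : (i ≠ N ∧ i ≠ t ∧ N ≠ t) ∧ ¬ body.SetsReg i ∧ ¬ body.SetsReg N)
    (hi : ∀ j τ v, Inv j τ → Inv j (τ.setReg i v)) (ht : ∀ j τ v, Inv j τ → Inv j (τ.setReg t v))
    (h0 : Inv 0 σ)
    (hstep : ∀ j < n, ∀ τ, Agree (forLoop i N t body) σ τ → τ.reg i = j → Inv j τ →
      Runs body τ T (Inv (j + 1))) :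
    Runs (forLoop i N t body) σ (n * (T + 4) + 3) (fun τ => Inv n τ) := by
  obtain ⟨⟨hiN, hit, hNt⟩, hbi, hbN⟩ := hside
  have hag : Agree (_root_.forLoop i N t body) σ
      ((σ.setReg i 0).setReg t ((σ.setReg i 0).reg N - (σ.setReg i 0).reg i)) := by
    refine ⟨fun x hx => ?_, fun _ _ => rfl⟩
    simp only [forLoop_setsReg, not_or] at hx
    simp [hx.1, hx.2.1]
  refine Runs.of_le (.const_seq (.sub_seq ((Runs.loop
    (fun τ => Agree (_root_.forLoop i N t body) σ τ ∧ τ.reg i ≤ n ∧ τ.reg N = n ∧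
      τ.reg t = n - τ.reg i ∧ Inv (τ.reg i) τ) (fun τ => n - τ.reg i)
    (T := T + 3) ?_ ?_).imp ?_))) ?_
  · rintro τ - ⟨h1, h2, h3, h4, h5⟩ h6
    have hlt : τ.reg i < n := by omega
    refine Runs.seq (T₂ := 3) (hstep _ hlt τ h1 rfl h5) fun τ' h7 h8 => ?_
    refine .const_seq (.add_seq (.sub ?_))
    have e1 := h7.reg i hbi
    have e2 := h7.reg N hbN
    refine ⟨⟨⟨fun x hx => ?_, fun c hc => ?_⟩, ?_, ?_, ?_, ?_⟩, ?_⟩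
    · rw [forLoop_setsReg] at hx
      push Not at hx
      simp only [RAMState.setReg_reg, hx.1, hx.2.1, if_false]
      rw [h7.reg x hx.2.2, h1.reg x (by rw [forLoop_setsReg]; push Not; exact hx)]
    · rw [forLoop_setsArr] at hc
      simp only [RAMState.setReg_arr]
      rw [h7.arr c hc, h1.arr c (by rw [forLoop_setsArr]; exact hc)]
    · simp [hit, e1]; omega
    · simp [hNt, hiN.symm, e2, h3]
    · simp [hit, e1, e2, hNt, hiN.symm, h3]
    · have : (((τ'.setReg t 1).setReg i ((τ'.setReg t 1).reg i + (τ'.setReg t 1).reg t)).setReg t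
        ((((τ'.setReg t 1).setReg i ((τ'.setReg t 1).reg i + (τ'.setReg t 1).reg t))).reg N -
        (((τ'.setReg t 1).setReg i ((τ'.setReg t 1).reg i + (τ'.setReg t 1).reg t))).reg i)).reg i =
        τ.reg i + 1 := by simp [hit, e1]
      rw [this]
      exact ht _ _ _ (hi _ _ _ (ht _ _ _ h8))
    · simp [hit, e1]; omega
  · refine ⟨hag, ?_, ?_, ?_, ?_⟩
    · simp [hit]
    · simp [hNt, hiN.symm, hN]
    · simp [hit, hiN.symm, hN]
    · have : ((σ.setReg i 0).setReg t ((σ.setReg i 0).reg N - (σ.setReg i 0).reg i)).reg i = 0 := by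
        simp [hit]
      rw [this]
      exact ht _ _ _ (hi _ _ _ h0)
  · rintro τ - ⟨⟨h1, h2, h3, h4, h5⟩, h6⟩
    have : τ.reg i = n := by omega
    rwa [this] at h5
  · simp only [RAMState.setReg_reg, hit, if_false, if_true, Nat.sub_zero, Nat.add_assoc,
      Nat.reduceAdd]
    omega

/-! ### Arithmetic subroutines -/

/-- `r₃₁ := r₃₂ * r₃₃`, using `r₃₂` as a counter. -/
def mulProg : RAMProg :=
  .const 31 0 ;; .loop 32 (.add 31 31 33 ;; .const 30 1 ;; .sub 32 32 30)

theorem runs_mulProg (σ : RAMState) :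
    Runs mulProg σ (4 * σ.reg 32 + 2) (fun τ => τ.reg 31 = σ.reg 32 * σ.reg 33) := by
  refine Runs.of_le (.const_seq ((Runs.loop
    (fun τ => τ.reg 33 = σ.reg 33 ∧ τ.reg 31 + τ.reg 32 * σ.reg 33 = σ.reg 32 * σ.reg 33)
    (fun τ => τ.reg 32) (T := 3) ?_ ?_).imp ?_)) ?_
  · rintro τ - ⟨h1, h2⟩ h3
    refine .add_seq (.const_seq (.sub ?_))
    obtain ⟨k, hk⟩ := Nat.exists_eq_succ_of_ne_zero h3
    simp only [RAMState.setReg_reg]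
    simp [h1, ← h2, hk]
    ring
  · simp
  · rintro τ - ⟨⟨h1, h2⟩, h3⟩
    simpa [h3] using h2
  · simp
    omega

/-- `(r₂₇, r₂₉, r₃₄) := (r₂₇ % r₂₈, r₂₇ / r₂₈, 1)`. -/
def divProg : RAMProg :=
  .const 34 1 ;; .const 29 0 ;; .add 30 27 34 ;; .sub 30 30 28 ;;
    .loop 30 (.sub 27 27 28 ;; .add 29 29 34 ;; .add 30 27 34 ;; .sub 30 30 28)

theorem runs_divProg (σ : RAMState) (h : 0 < σ.reg 28) :
    Runs divProg σ (5 * (σ.reg 27 / σ.reg 28) + 5)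
      (fun τ => τ.reg 27 = σ.reg 27 % σ.reg 28 ∧ τ.reg 29 = σ.reg 27 / σ.reg 28 ∧
        τ.reg 34 = 1) := by
  refine Runs.of_le (.const_seq (.const_seq (.add_seq (.sub_seq ((Runs.loop
    (fun τ => τ.reg 34 = 1 ∧ τ.reg 28 = σ.reg 28 ∧ τ.reg 30 = τ.reg 27 + 1 - σ.reg 28 ∧
      τ.reg 27 + τ.reg 29 * σ.reg 28 = σ.reg 27)
    (fun τ => τ.reg 27 / σ.reg 28) (T := 4) ?_ ?_).imp ?_))))) ?_
  · rintro τ - ⟨h1, h2, h3, h4⟩ h5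
    refine .sub_seq (.add_seq (.add_seq (.sub ?_)))
    have hle : σ.reg 28 ≤ τ.reg 27 := by omega
    simp only [RAMState.setReg_reg]
    simp only [h1, h2]
    simp
    have e : τ.reg 27 / σ.reg 28 = (τ.reg 27 - σ.reg 28) / σ.reg 28 + 1 := Nat.div_eq_sub_div h hle
    refine ⟨?_, ?_⟩
    · rw [add_mul, one_mul]; omega
    · omega
  · simp
  · rintro τ - ⟨⟨h1, h2, h3, h4⟩, h5⟩
    have hlt : τ.reg 27 < σ.reg 28 := by omega
    rw [← h4, Nat.add_mul_mod_self_right, Nat.mod_eq_of_lt hlt, Nat.add_mul_div_right _ _ h,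
      Nat.div_eq_of_lt hlt]
    simp [h1]
  · simp
    omega

/-- The digits of `r₂₇` in the mixed radix system with `r_N` places, whose place values are in the
array `w`, are written to the array `G`. -/
def decodeProg (N w G : ℕ) : RAMProg :=
  forLoop 17 N 5 (.const 34 1 ;; .sub 25 N 17 ;; .sub 25 25 34 ;; .load 28 w 25 ;; divProg ;;
    .store G 25 29)

theorem runs_decodeProg {N w G : ℕ} (hwG : w ≠ G) (hN : N ≤ 8 ∧ N ≠ 5) {Q : ℕ → ℕ} {n M c : ℕ}
    (hQ : ∀ i, 0 < Q i) (hM : ∀ i < n, Q i ≤ M) (σ : RAMState) (hn : σ.reg N = n)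
    (hw : ∀ i < n, σ.arr w i = placeValue Q i) (hc : σ.reg 27 = c) (hlt : c < placeValue Q n) :
    Runs (decodeProg N w G) σ (n * (5 * M + 14) + 3)
      (fun τ => ∀ i < n, τ.arr G i = mixedDigit Q c i) := by
  obtain ⟨hN8, hN5⟩ := hN
  refine ((Runs.forLoop (n := n) (T := 5 * M + 10)
    (fun j τ => τ.reg 27 = c % placeValue Q (n - j) ∧
      ∀ i < n, n - j ≤ i → τ.arr G i = mixedDigit Q c i) hn ?_ ?_ ?_ ?_ ?_).of_le ?_).imp ?_
  · simp [divProg, RAMProg.SetsReg]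
    omega
  · intro j τ v h
    simpa using h
  · intro j τ v h
    simpa using h
  · refine ⟨?_, fun i hi hi' => by omega⟩
    rw [hc, Nat.sub_zero, Nat.mod_eq_of_lt hlt]
  · rintro j hj τ hag hτ ⟨h1, h2⟩
    have hτN : τ.reg N = n := by
      rw [hag.reg N (by simp [divProg, RAMProg.SetsReg]; omega), hn]
    have hτw : τ.arr w = σ.arr w := hag.arr w (by simp [divProg, RAMProg.SetsArr, hwG])
    obtain ⟨k, hk⟩ : ∃ k, n - j = k + 1 := ⟨n - j - 1, by omega⟩
    have hkn : k < n := by omega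
    have hidx : n - j - 1 = k := by omega
    have hpv := placeValue_pos hQ k
    have hdiv : c % placeValue Q (k + 1) / placeValue Q k < Q k := mixedDigit_lt hQ c k
    refine Runs.of_le (.const_seq (.sub_seq (.sub_seq (.load_seq (Runs.seq (runs_divProg _ ?_)
      fun τ' hag' h' => .store ?_))))) ?_
    · simp [hτN, hτ, hidx, hτw, hw k hkn, hpv, (show N ≠ 34 by omega)]
    · simp [hτN, hτ, hτw, hw k hkn, h1, hk, (show N ≠ 34 by omega)] at h'
      have e25 : τ'.reg 25 = k := by
        rw [hag'.reg 25 (by simp [divProg, RAMProg.SetsReg])]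
        simp [hτN, hτ, hidx, (show N ≠ 34 by omega)]
      have eG : τ'.arr G = τ.arr G := by
        rw [hag'.arr G (by simp [divProg, RAMProg.SetsArr])]
        rfl
      refine ⟨?_, fun i hi hi' => ?_⟩
      · simp only [RAMState.setArr_reg]
        rw [h'.1, show n - (j + 1) = k by omega]
        exact Nat.mod_mod_of_dvd _ (placeValue_dvd Q (Nat.le_succ k))
      · simp only [RAMState.setArr_arr, if_true, e25, h'.2.1, eG, Function.update_apply]
        split_ifs with hik
        · rw [hik]; rfl
        · exact h2 i hi (by omega)
    · simp [hτN, hτ, hτw, hw k hkn, h1, hk, (show N ≠ 34 by omega)]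
      have := hM k hkn
      omega
  · rw [show 5 * M + 10 + 4 = 5 * M + 14 by ring]
  · rintro τ - ⟨-, h⟩ i hi
    exact h i hi (by omega)

/-! ### Running a program inside another one -/

/-- All registers mentioned in the program are smaller than this number. -/
def RAMProg.regBound : RAMProg → ℕ
  | .skip => 0
  | .const x _ => x + 1
  | .add x y z => x + y + z + 1
  | .sub x y z => x + y + z + 1
  | .load x _ y => x + y + 1
  | .store _ x y => x + y + 1
  | .seq p q => p.regBound + q.regBound
  | .cond x p q => x + 1 + p.regBound + q.regBound
  | .loop x p => x + 1 + p.regBound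

/-- The program with its register `r_x` renamed to `r_(x + 64)` and its array `A_b` kept in
`A_(2 * b + 32)`. An entry counts as written in the current run only if its stamp, in
`A_(2 * b + 33)`, equals the number `r₆₂` of the run; all other entries count as zero. So the arrays
need not be cleared between two runs, and a run costs only a constant factor more time. -/
def RAMProg.embed : RAMProg → RAMProg
  | .skip => .skip
  | .const x a => .const (x + 64) a
  | .add x y z => .add (x + 64) (y + 64) (z + 64)
  | .sub x y z => .sub (x + 64) (y + 64) (z + 64)
  | .load x b y => .load 63 (2 * b + 33) (y + 64) ;; .sub 63 62 63 ;;
      .cond 63 (.const (x + 64) 0) (.load (x + 64) (2 * b + 32) (y + 64))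
  | .store b x y => .store (2 * b + 32) (x + 64) (y + 64) ;; .store (2 * b + 33) (x + 64) 62
  | .seq p q => p.embed ;; q.embed
  | .cond x p q => .cond (x + 64) p.embed q.embed
  | .loop x p => .loop (x + 64) p.embed

theorem RAMProg.embed_setsReg (p : RAMProg) {x : ℕ} (hx : x < 63) : ¬ p.embed.SetsReg x := by
  induction p with
  | skip => simp [embed, SetsReg]
  | const | add | sub | load | store => simp [embed, SetsReg]; try omega
  | seq p q ihp ihq => simp [embed, SetsReg, ihp, ihq]
  | cond y p q ihp ihq => simp [embed, SetsReg, ihp, ihq]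
  | loop y p ihp => simp [embed, SetsReg, ihp]

theorem RAMProg.embed_setsArr (p : RAMProg) {b : ℕ} (hb : b < 32) : ¬ p.embed.SetsArr b := by
  induction p with
  | skip => simp [embed, SetsArr]
  | const | add | sub | load | store => simp [embed, SetsArr]; try omega
  | seq p q ihp ihq => simp [embed, SetsArr, ihp, ihq]
  | cond y p q ihp ihq => simp [embed, SetsArr, ihp, ihq]
  | loop y p ihp => simp [embed, SetsArr, ihp]

/-- No entry has a stamp from a future run. -/
def StampsLe (σ : RAMState) : Prop := ∀ b i, σ.arr (2 * b + 33) i ≤ σ.reg 62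

/-- The state `σ` represents the state `τ` of an embedded program with registers below `N`. -/
structure Represents (N : ℕ) (σ τ : RAMState) : Prop where
  reg : ∀ x < N, σ.reg (x + 64) = τ.reg x
  stamps : StampsLe σ
  arr : ∀ b i, τ.arr b i = if σ.arr (2 * b + 33) i = σ.reg 62 then σ.arr (2 * b + 32) i else 0

theorem Represents.setReg {N : ℕ} {σ τ : RAMState} (h : Represents N σ τ) {x v : ℕ} :
    Represents N (σ.setReg (x + 64) v) (τ.setReg x v) := by
  refine ⟨fun y hy => ?_, fun b i => ?_, fun b i => ?_⟩
  · simp [h.reg y hy]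
  · simpa [show ¬ 62 = x + 64 by omega] using h.stamps b i
  · simpa [show ¬ 62 = x + 64 by omega] using h.arr b i

theorem RAMExec.embed {p : RAMProg} {τ τ' : RAMState} {t : ℕ} (h : RAMExec p τ t τ') {N : ℕ}
    (hN : p.regBound ≤ N) {σ : RAMState} (hσ : Represents N σ τ) :
    Runs p.embed σ (4 * t) (fun σ' => Represents N σ' τ') := by
  induction h generalizing σ with
  | skip =>
    refine (Runs.skip ?_).of_le (by norm_num : 1 ≤ 4 * 1)
    exact hσ
  | const x a τ =>
    refine (Runs.const ?_).of_le (by norm_num : 1 ≤ 4 * 1)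
    exact hσ.setReg
  | add x y z τ =>
    simp only [RAMProg.regBound] at hN
    refine (Runs.add ?_).of_le (by norm_num)
    rw [hσ.reg y (by omega), hσ.reg z (by omega)]
    exact hσ.setReg
  | sub x y z τ =>
    simp only [RAMProg.regBound] at hN
    refine (Runs.sub ?_).of_le (by norm_num)
    rw [hσ.reg y (by omega), hσ.reg z (by omega)]
    exact hσ.setReg
  | load x b y τ =>
    simp only [RAMProg.regBound] at hN
    have hy := hσ.reg y (by omega)
    have hst := hσ.stamps b (τ.reg y)
    -- the scratch register is not part of the represented state
    have h63 : ∀ v w, Represents N ((σ.setReg 63 v).setReg 63 w) τ := fun v w =>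
      ⟨fun x hx => by simpa using hσ.reg x hx, fun b i => by simpa using hσ.stamps b i,
        fun b i => by simpa using hσ.arr b i⟩
    refine Runs.of_le (.load_seq (.sub_seq (.cond (T := 1) (fun h => .const ?_)
      fun h => .load ?_))) (by norm_num)
    · rw [hσ.arr b (τ.reg y), if_neg ?_]
      · exact (h63 _ _).setReg
      · simp [hy] at h
        omega
    · rw [hσ.arr b (τ.reg y), if_pos ?_]
      · have hy' : ∀ v w, ((σ.setReg 63 v).setReg 63 w).reg (y + 64) = τ.reg y := by simp [hy]
        simp only [hy', RAMState.setReg_arr]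
        exact (h63 _ _).setReg
      · simp [hy] at h
        omega
  | store b x y τ =>
    simp only [RAMProg.regBound] at hN
    have hx := hσ.reg x (by omega)
    have hy := hσ.reg y (by omega)
    refine Runs.of_le (.store_seq (.store ?_)) (by norm_num)
    simp only [RAMState.setArr_reg, hx, hy]
    refine ⟨fun z hz => by simpa using hσ.reg z hz, fun c i => ?_, fun c i => ?_⟩
    · have := hσ.stamps c i
      simp only [RAMState.setArr_arr, RAMState.setArr_reg]
      rw [if_neg (by omega : ¬ 2 * b + 33 = 2 * b + 32)]
      split_ifs with h1 h2
      · obtain rfl : c = b := by omega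
        simp only [Function.update_apply]
        split_ifs
        · exact le_rfl
        · exact this
      · omega
      · exact this
    · have := hσ.arr c i
      simp only [RAMState.setArr_arr, RAMState.setArr_reg]
      rw [if_neg (by omega : ¬ 2 * b + 33 = 2 * b + 32),
        if_neg (by omega : ¬ 2 * c + 32 = 2 * b + 33),
        if_neg (by omega : ¬ 2 * c + 33 = 2 * b + 32)]
      by_cases hcb : c = b
      · subst hcb
        simp only [Function.update_apply, if_true]
        by_cases hi : i = τ.reg x
        · simp [hi]
        · simp [hi, this]
      · rw [if_neg hcb, if_neg (by omega : ¬ 2 * c + 33 = 2 * b + 33),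
          if_neg (by omega : ¬ 2 * c + 32 = 2 * b + 32)]
        exact this
  | seq _ _ ih₁ ih₂ =>
    simp only [RAMProg.regBound] at hN
    refine Runs.of_le (Runs.seq (ih₁ (by omega) hσ) fun σ' _ h' => ih₂ (by omega) h') ?_
    omega
  | cond_true hx _ ih =>
    simp only [RAMProg.regBound] at hN
    refine Runs.of_le (.cond (fun _ => ih (by omega) hσ) fun h => ?_) (by omega)
    rw [hσ.reg _ (by omega)] at h
    exact absurd h hx
  | cond_false hx _ ih =>
    simp only [RAMProg.regBound] at hN
    refine Runs.of_le (.cond (fun h => ?_) fun _ => ih (by omega) hσ) (by omega)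
    rw [hσ.reg _ (by omega)] at h
    exact absurd hx h
  | @loop_true x p _ _ _ t₁ t₂ hx _ _ ih₁ ih₂ =>
    have hN' := hN
    simp only [RAMProg.regBound] at hN
    obtain ⟨s₁, σ₁, e₁, hs₁, h₁⟩ := ih₁ (by omega) hσ
    obtain ⟨s₂, σ₂, e₂, hs₂, h₂⟩ := ih₂ hN' h₁
    refine ⟨_, σ₂, .loop_true ?_ e₁ e₂, by omega, h₂⟩
    rw [hσ.reg _ (by omega)]
    exact hx
  | loop_false hx =>
    simp only [RAMProg.regBound] at hN
    refine ⟨1, σ, .loop_false ?_, by norm_num, hσ⟩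
    rw [hσ.reg _ (by omega)]
    exact hx

/-- `r₆₄, …, r_(63 + N) := 0`. -/
def resetProg : ℕ → RAMProg
  | 0 => .skip
  | k + 1 => resetProg k ;; .const (k + 64) 0

theorem resetProg_setsReg {N x : ℕ} (hx : x < 64) : ¬ (resetProg N).SetsReg x := by
  induction N with
  | zero => simp [resetProg, RAMProg.SetsReg]
  | succ k ih => simp [resetProg, RAMProg.SetsReg, ih]; omega

theorem resetProg_setsArr {N b : ℕ} : ¬ (resetProg N).SetsArr b := by
  induction N with
  | zero => simp [resetProg, RAMProg.SetsArr]
  | succ k ih => simp [resetProg, RAMProg.SetsArr, ih]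

theorem runs_resetProg (N : ℕ) (σ : RAMState) :
    Runs (resetProg N) σ (N + 1) (fun τ => ∀ x < N, τ.reg (x + 64) = 0) := by
  induction N with
  | zero => exact Runs.skip (by simp)
  | succ k ih =>
    refine Runs.seq ih fun τ _ h => .const fun x hx => ?_
    simp only [RAMState.setReg_reg]
    split_ifs with h'
    · rfl
    · exact h x (by omega)

/-! ### Calling the algorithm for independent sets -/

/-- The independent set problem that decides whether an agent with utilities `u` finds a bundle with
colours in `Z`: the jobs with other colours get weight zero, so that removing them from a solution
leaves a solution. -/
noncomputable def SbCFFA.subproblem (J : SbCFFA) (u : Fin J.m → ℕ) (col : ℕ → ℕ) (Z : Finset ℕ) :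
    SbMWIS where
  m := J.m
  G := J.H
  k := J.s
  ρ := J.η
  k_pos := J.s_pos
  ρ_pos := J.η_pos
  w x := if col x ∈ Z then u x else 0

theorem SbCFFA.subproblem_isYes (J : SbCFFA) (u : Fin J.m → ℕ) (col : ℕ → ℕ) (Z : Finset ℕ) :
    (J.subproblem u col Z).IsYes ↔ J.HasBundle u col Z := by
  constructor
  · rintro ⟨S, h1, h2, h3⟩
    refine ⟨Finset.filter (fun x : Fin J.m => col x ∈ Z) S,
      Set.Pairwise.mono (by exact_mod_cast Finset.filter_subset _ _) h1,
      (Finset.card_filter_le _ _).trans h2, ?_, fun x hx => (Finset.mem_filter.1 hx).2⟩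
    · exact h3.trans_eq (Finset.sum_filter (fun x : Fin J.m => col x ∈ Z) u).symm
  · rintro ⟨S, h1, h2, h3, h4⟩
    refine ⟨S, h1, h2, h3.trans (Finset.sum_le_sum fun x hx => ?_)⟩
    simp [subproblem, h4 x hx]

/-- Calls the program `B` on the subproblem of the jobs whose colour has digit zero in `A₇`.
The colours are in `A₁₀`, and `r₂₂` is the position of the utilities of the agent in `A₁`.
The answer is returned in `r₆₄`. -/
def callProg (B : RAMProg) : RAMProg :=
  .const 34 1 ;; .add 62 62 34 ;; resetProg (B.regBound + 3) ;;
  .add 64 64 1 ;; .add 65 65 2 ;; .add 66 66 3 ;;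
  forLoop 25 9 5 (.load 36 0 25 ;; .store 32 25 36 ;; .store 33 25 62) ;;
  forLoop 25 1 5 (.load 36 10 25 ;; .load 36 7 36 ;;
    .cond 36 (.const 36 0) (.add 36 22 25 ;; .load 36 1 36) ;;
    .store 34 25 36 ;; .store 35 25 62) ;;
  B.embed

theorem callProg_setsReg (B : RAMProg) {x : ℕ} (hx : x < 62)
    (h : x ≠ 34 ∧ x ≠ 25 ∧ x ≠ 5 ∧ x ≠ 36) : ¬ (callProg B).SetsReg x := by
  simp [callProg, RAMProg.SetsReg, resetProg_setsReg (show x < 64 by omega),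
    B.embed_setsReg (show x < 63 by omega)]
  omega

theorem callProg_setsArr (B : RAMProg) {b : ℕ} (hb : b < 32) : ¬ (callProg B).SetsArr b := by
  simp [callProg, RAMProg.SetsArr, resetProg_setsArr, B.embed_setsArr hb]
  omega

theorem runs_callProg {B : RAMProg} {J : SbCFFA} {TB : ℕ}
    (hB : ∀ (u : Fin J.m → ℕ) (col : ℕ → ℕ) (Z : Finset ℕ),
      ∃ t τ, RAMExec B (J.subproblem u col Z).input t τ ∧ t ≤ TB ∧
        (τ.reg 0 ≠ 0 ↔ (J.subproblem u col Z).IsYes))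
    (σ : RAMState) (hσm : σ.reg 1 = J.m) (hσs : σ.reg 2 = J.s) (hση : σ.reg 3 = J.η)
    (hσmm : σ.reg 9 = J.m * J.m) (hσH : σ.arr 0 = adjacencyArray J.H)
    (hσu : σ.arr 1 = matrixArray J.u) (a : Fin J.n) (ha : σ.reg 22 = a * J.m)
    (col : ℕ → ℕ) (hcol : ∀ x < J.m, σ.arr 10 x = col x)
    (Z : Finset ℕ) (hZ : ∀ x < J.m, σ.arr 7 (col x) = 0 ↔ col x ∈ Z) (hst : StampsLe σ) :
    Runs (callProg B) σ (4 * TB + 7 * (J.m * J.m) + 12 * J.m + B.regBound + 20)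
      (fun τ => (τ.reg 64 ≠ 0 ↔ J.HasBundle (J.u a) col Z) ∧ StampsLe τ) := by
  set I := J.subproblem (J.u a) col Z with hI
  obtain ⟨t, τB, hexec, ht, hans⟩ := hB (J.u a) col Z
  set run := σ.reg 62 + 1 with hrun
  -- registers
  refine Runs.of_le (.const_seq (.add_seq (Runs.seq (runs_resetProg _ _) fun σ₁ hag₁ h₁ =>
    .add_seq (.add_seq (.add_seq (T := 7 * (J.m * J.m) + 12 * J.m + 6 + 4 * TB) ?_))))) ?_
  swap
  · omega
  have r₁ : ∀ x < 64, σ₁.reg x = ((σ.setReg 34 1).setReg 62 (σ.reg 62 + 1)).reg x := by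
    intro x hx
    rw [hag₁.reg x (resetProg_setsReg hx)]
    simp
  have a₁ : σ₁.arr = σ.arr := by
    funext b
    rw [hag₁.arr b resetProg_setsArr]
    rfl
  obtain ⟨σ₂, hσ₂⟩ : ∃ σ₂, σ₂ = ((σ₁.setReg 64 (σ₁.reg 64 + σ₁.reg 1)).setReg 65
    ((σ₁.setReg 64 (σ₁.reg 64 + σ₁.reg 1)).reg 65 +
        (σ₁.setReg 64 (σ₁.reg 64 + σ₁.reg 1)).reg 2)).setReg
    66 (((σ₁.setReg 64 (σ₁.reg 64 + σ₁.reg 1)).setReg 65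
    ((σ₁.setReg 64 (σ₁.reg 64 + σ₁.reg 1)).reg 65 +
      (σ₁.setReg 64 (σ₁.reg 64 + σ₁.reg 1)).reg 2)).reg 66 +
      ((σ₁.setReg 64 (σ₁.reg 64 + σ₁.reg 1)).setReg 65
    ((σ₁.setReg 64 (σ₁.reg 64 + σ₁.reg 1)).reg 65 +
      (σ₁.setReg 64 (σ₁.reg 64 + σ₁.reg 1)).reg 2)).reg 3) := ⟨_, rfl⟩
  rw [← hσ₂]
  have e64 : ∀ x < B.regBound + 3, σ₂.reg (x + 64) = I.input.reg x := by
    intro x hx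
    have h0 := h₁ 0 (by omega)
    have h1 := h₁ 1 (by omega)
    have h2 := h₁ 2 (by omega)
    have hx0 := h₁ x hx
    simp at h0 h1 h2
    rw [hσ₂]
    simp only [RAMState.setReg_reg, SbMWIS.input, registerList]
    rcases x with _ | _ | _ | x
    · simp [h0, r₁ 1 (by omega), hσm, hI, SbCFFA.subproblem]
    · simp [h1, r₁ 2 (by omega), hσs, hI, SbCFFA.subproblem]
    · simp [h2, r₁ 3 (by omega), hση, hI, SbCFFA.subproblem]
    · simpa using hx0
  have r₂ : ∀ x < 64, σ₂.reg x = ((σ.setReg 34 1).setReg 62 (σ.reg 62 + 1)).reg x := by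
    intro x hx
    rw [← r₁ x hx, hσ₂]
    simp [show x ≠ 64 by omega, show x ≠ 65 by omega, show x ≠ 66 by omega]
  have a₂ : σ₂.arr = σ.arr := by rw [hσ₂, ← a₁]; rfl
  clear hσ₂ h₁ hag₁ r₁ a₁
  have r62 : σ₂.reg 62 = run := by rw [r₂ 62 (by omega)]; simp [hrun]
  have r9 : σ₂.reg 9 = J.m * J.m := by rw [r₂ 9 (by omega)]; simpa using hσmm
  have r1 : σ₂.reg 1 = J.m := by rw [r₂ 1 (by omega)]; simpa using hσm
  have r22 : σ₂.reg 22 = a * J.m := by rw [r₂ 22 (by omega)]; simpa using ha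
  have old : ∀ b i, σ₂.arr (2 * b + 33) i < run := fun b i => by
    rw [a₂]; exact Nat.lt_succ_of_le (hst b i)
  -- the adjacency matrix
  refine Runs.of_le (Runs.seq (Runs.forLoop (n := J.m * J.m) (T := 3)
    (fun j τ => ∀ i, (i < j → τ.arr 33 i = run ∧ τ.arr 32 i = I.input.arr 0 i) ∧
      (¬ i < j → τ.arr 33 i < run)) r9 (by simp [RAMProg.SetsReg]) (fun _ _ _ h => h)
          (fun _ _ _ h => h)
      ?_ ?_) (T₂ := J.m * 11 + 3 + 4 * TB) ?_) ?_
  · exact fun i => ⟨fun h => by omega, fun _ => old 0 i⟩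
  · intro j hj τ hag hτ hinv
    refine .load_seq (.store_seq (.store ?_))
    have e0 : τ.arr 0 = I.input.arr 0 := by
      rw [hag.arr 0 (by simp [RAMProg.SetsArr]), a₂, hσH]; rfl
    have e62 : τ.reg 62 = run := by rw [hag.reg 62 (by simp [RAMProg.SetsReg]), r62]
    intro i
    simp [hτ, e62, e0, Function.update_apply]
    refine ⟨fun hi => ?_, fun hi => ?_⟩
    · by_cases h : i = j
      · simp [h]
      · simpa [h] using (hinv i).1 (by omega)
    · rw [if_neg (by omega)]
      exact (hinv i).2 (by omega)
  swap
  · omega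
  intro σ₃ hag₃ h₃
  have e62 : σ₃.reg 62 = run := by rw [hag₃.reg 62 (by simp [RAMProg.SetsReg]), r62]
  have e1 : σ₃.reg 1 = J.m := by rw [hag₃.reg 1 (by simp [RAMProg.SetsReg]), r1]
  have e22 : σ₃.reg 22 = a * J.m := by rw [hag₃.reg 22 (by simp [RAMProg.SetsReg]), r22]
  have eA : ∀ b, b ≠ 32 → b ≠ 33 → σ₃.arr b = σ.arr b := fun b hb hb' => by
    rw [hag₃.arr b (by simp [RAMProg.SetsArr]; omega), a₂]
  have eR : ∀ x < B.regBound + 3, σ₃.reg (x + 64) = I.input.reg x := fun x hx => by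
    rw [hag₃.reg _ (by simp [RAMProg.SetsReg]), e64 x hx]
  -- the weights
  refine Runs.of_le (Runs.seq (Runs.forLoop (n := J.m) (T := 7)
    (fun j τ => ∀ i, (i < j → τ.arr 35 i = run ∧ τ.arr 34 i = I.input.arr 1 i) ∧
      (¬ i < j → τ.arr 35 i < run)) e1 (by simp [RAMProg.SetsReg]) (fun _ _ _ h => h)
          (fun _ _ _ h => h)
      ?_ ?_) (T₂ := 4 * TB) ?_) ?_
  · refine fun i => ⟨fun h => by omega, fun _ => ?_⟩
    rw [eA 35 (by norm_num) (by norm_num), ← a₂]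
    exact old 1 i
  · intro j hj τ hag hτ hinv
    have g62 : τ.reg 62 = run := by rw [hag.reg 62 (by simp [RAMProg.SetsReg]), e62]
    have g22 : τ.reg 22 = a * J.m := by rw [hag.reg 22 (by simp [RAMProg.SetsReg]), e22]
    have gA : ∀ b < 32, τ.arr b = σ.arr b := fun b hb => by
      rw [hag.arr b (by simp [RAMProg.SetsArr]; omega), eA b (by omega) (by omega)]
    have hw : I.input.arr 1 j = if col j ∈ Z then J.u a ⟨j, hj⟩ else 0 := by
      have hj' : j < I.m := hj
      simp only [SbMWIS.input, vectorArray, hj', dite_true]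
      rfl
    refine .load_seq (.load_seq (Runs.seq (T₁ := 3) (R := fun τ' => τ'.reg 36 = I.input.arr 1 j)
      (.cond (fun h => (Runs.const ?_).of_le (by norm_num)) (fun h => .add_seq (.load ?_)))
      (T₂ := 2) fun τ' hag' h' => .store_seq (.store ?_)))
    · simp [hτ, gA, hcol j hj] at h
      rw [hZ j hj] at h
      simp [hw, h]
    · simp [hτ, gA, hcol j hj] at h
      rw [hZ j hj] at h
      simp [hw, h, hτ, gA, g22, hσu]
      exact matrixArray_apply J.u a ⟨j, hj⟩
    · have k25 : τ'.reg 25 = j := by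
        rw [hag'.reg 25 (by simp [RAMProg.SetsReg])]
        simpa using hτ
      have k62 : τ'.reg 62 = run := by
        rw [hag'.reg 62 (by simp [RAMProg.SetsReg])]
        simpa using g62
      have kA : τ'.arr = τ.arr := by
        funext b
        rw [hag'.arr b (by simp [RAMProg.SetsArr])]
        rfl
      intro i
      simp [k25, k62, kA, h', Function.update_apply]
      refine ⟨fun hi => ?_, fun hi => ?_⟩
      · by_cases h : i = j
        · simp [h]
        · simpa [h] using (hinv i).1 (by omega)
      · rw [if_neg (by omega)]
        exact (hinv i).2 (by omega)
  swap
  · omega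
  intro σ₄ hag₄ h₄
  have f62 : σ₄.reg 62 = run := by rw [hag₄.reg 62 (by simp [RAMProg.SetsReg]), e62]
  have f32 : σ₄.arr 32 = σ₃.arr 32 := hag₄.arr 32 (by simp [RAMProg.SetsArr])
  have f33 : σ₄.arr 33 = σ₃.arr 33 := hag₄.arr 33 (by simp [RAMProg.SetsArr])
  have fA : ∀ b, 36 ≤ b → σ₄.arr b = σ.arr b := fun b hb => by
    rw [hag₄.arr b (by simp [RAMProg.SetsArr]; omega), eA b (by omega) (by omega)]
  have hrep : Represents (B.regBound + 3) σ₄ I.input := by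
    refine ⟨fun x hx => ?_, fun b i => ?_, fun b i => ?_⟩
    · rw [hag₄.reg _ (by simp [RAMProg.SetsReg]), eR x hx]
    · rw [f62]
      rcases b with _ | _ | b
      · have := h₃ i
        rw [mul_zero, zero_add, f33]
        by_cases hi : i < J.m * J.m
        · exact (this.1 hi).1.le
        · exact (this.2 hi).le
      · have := h₄ i
        by_cases hi : i < J.m
        · exact (this.1 hi).1.le
        · exact (this.2 hi).le
      · rw [fA _ (by omega), ← a₂]
        exact (old (b + 1 + 1) i).le
    · rw [f62]
      rcases b with _ | _ | b
      · have := h₃ i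
        rw [mul_zero, zero_add, zero_add, f33, f32]
        by_cases hi : i < J.m * J.m
        · rw [if_pos (this.1 hi).1, (this.1 hi).2]
        · rw [if_neg (this.2 hi).ne]
          simp only [SbMWIS.input, adjacencyArray, matrixArray, vectorArray]
          exact dif_neg hi
      · have := h₄ i
        by_cases hi : i < J.m
        · rw [if_pos (this.1 hi).1, ← (this.1 hi).2]
        · rw [if_neg (this.2 hi).ne]
          simp only [SbMWIS.input, vectorArray]
          exact dif_neg hi
      · rw [fA _ (by omega), ← a₂, if_neg (old (b + 1 + 1) i).ne]
        simp [SbMWIS.input]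
  refine ((hexec.embed (Nat.le_add_right _ 3) hrep).of_le (by omega)).imp fun τ _ hτ => ?_
  refine ⟨?_, hτ.stamps⟩
  rw [show (64 : ℕ) = 0 + 64 by norm_num, hτ.reg 0 (by omega), hans]
  exact J.subproblem_isYes _ _ _

/-! ### Preparing the constants -/

/-- `r₁₂ := ∏ Q i` and `A₃[i] := placeValue Q i`, for the radices `Q i` in the array `A₂`. -/
def weightProg : RAMProg :=
  .const 12 1 ;; forLoop 17 7 5 (.store 3 17 12 ;; .load 32 2 17 ;; .const 33 0 ;; .add 33 33 12 ;;
    mulProg ;; .const 12 0 ;; .add 12 12 31)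

theorem runs_weightProg {Q : ℕ → ℕ} {n M : ℕ} (hM : ∀ i < n, Q i ≤ M) (σ : RAMState)
    (hn : σ.reg 7 = n) (hQ : ∀ i < n, σ.arr 2 i = Q i) :
    Runs weightProg σ (n * (4 * M + 12) + 4)
      (fun τ => τ.reg 12 = placeValue Q n ∧ ∀ i < n, τ.arr 3 i = placeValue Q i) := by
  refine Runs.of_le (.const_seq (Runs.forLoop (n := n) (T := 4 * M + 8)
    (fun j τ => τ.reg 12 = placeValue Q j ∧ ∀ i < j, τ.arr 3 i = placeValue Q i)
    (by simpa using hn) (by simp [mulProg, RAMProg.SetsReg]) ?_ ?_ ?_ ?_)) ?_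
  · intro j τ v h; simpa using h
  · intro j τ v h; simpa using h
  · simp [placeValue_zero]
  · rintro j hj τ hag hτ ⟨h1, h2⟩
    have e2 : τ.arr 2 = σ.arr 2 := hag.arr 2 (by simp [mulProg, RAMProg.SetsArr])
    refine Runs.of_le (.store_seq (.load_seq (.const_seq (.add_seq (Runs.seq (runs_mulProg _)
      fun τ' hag' h' => .const_seq (.add ?_)))))) ?_
    · simp [hτ, e2, hQ j hj, h1] at h'
      have e3 := hag'.arr 3 (by simp [mulProg, RAMProg.SetsArr])
      simp [hτ, h1] at e3
      simp only [RAMState.setReg_arr, e3, RAMState.setReg_reg, Function.update_apply]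
      refine ⟨by simp [h', placeValue_succ, mul_comm], fun i hi => ?_⟩
      split_ifs with h
      · rw [h]
      · exact h2 i (by omega)
    · simp [hτ, e2, hQ j hj]
      have := hM j hj
      omega
  · have : n * (4 * M + 8 + 4) = n * (4 * M + 12) := by ring
    omega

/-- `r₁₀ := 3 ^ r₈` and `r₁₁ := 2 ^ r₈`, with the smaller powers in the arrays `A₆` and `A₈`. -/
def powerProg : RAMProg :=
  .const 10 1 ;; .const 11 1 ;; forLoop 17 8 5 (.store 6 17 10 ;; .add 36 10 10 ;; .add 10 36 10 ;;
    .store 8 17 11 ;; .add 11 11 11)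

theorem runs_powerProg {q : ℕ} (σ : RAMState) (hq : σ.reg 8 = q) :
    Runs powerProg σ (9 * q + 5) (fun τ => τ.reg 10 = 3 ^ q ∧ τ.reg 11 = 2 ^ q ∧
      ∀ i < q, τ.arr 6 i = 3 ^ i ∧ τ.arr 8 i = 2 ^ i) := by
  refine Runs.of_le (.const_seq (.const_seq (Runs.forLoop (n := q) (T := 5)
    (fun j τ => τ.reg 10 = 3 ^ j ∧ τ.reg 11 = 2 ^ j ∧
      ∀ i < j, τ.arr 6 i = 3 ^ i ∧ τ.arr 8 i = 2 ^ i)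
    (by simpa using hq) (by simp [RAMProg.SetsReg]) ?_ ?_ ?_ ?_))) ?_
  · intro j τ v h; simpa using h
  · intro j τ v h; simpa using h
  · simp
  · rintro j hj τ hag hτ ⟨h1, h2, h3⟩
    refine .store_seq (.add_seq (.add_seq (.store_seq (.add ?_))))
    simp [hτ, h1, h2, Function.update_apply]
    refine ⟨by ring, by ring, fun i hi => ?_⟩
    split_ifs with h
    · simp [h]
    · exact h3 i (by omega)
  · omega

/-- `r₃₈` becomes a number with `r₁ ≤ 2 ^ r₃₈ ≤ 2 * r₁ + 1`. -/
def logProg : RAMProg :=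
  .const 34 1 ;; .const 38 0 ;; .const 39 1 ;; .sub 36 1 39 ;;
    .loop 36 (.add 39 39 39 ;; .add 38 38 34 ;; .sub 36 1 39)

theorem runs_logProg (σ : RAMState) :
    Runs logProg σ (4 * σ.reg 1 + 5)
      (fun τ => σ.reg 1 ≤ 2 ^ τ.reg 38 ∧ 2 ^ τ.reg 38 ≤ 2 * σ.reg 1 + 1) := by
  refine Runs.of_le (.const_seq (.const_seq (.const_seq (.sub_seq ((Runs.loop
    (fun τ => τ.reg 1 = σ.reg 1 ∧ τ.reg 34 = 1 ∧ τ.reg 39 = 2 ^ τ.reg 38 ∧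
      τ.reg 36 = σ.reg 1 - τ.reg 39 ∧ τ.reg 39 ≤ 2 * σ.reg 1 + 1)
    (fun τ => σ.reg 1 - τ.reg 39) (T := 3) ?_ ?_).imp ?_))))) ?_
  · rintro τ - ⟨h1, h2, h3, h4, h5⟩ h6
    refine .add_seq (.add_seq (.sub ?_))
    have hpos : 0 < τ.reg 39 := by rw [h3]; positivity
    simp [h1, h2]
    refine ⟨⟨by rw [h3, pow_succ]; ring, by omega⟩, by omega⟩
  · simp
  · rintro τ - ⟨⟨h1, h2, h3, h4, h5⟩, h6⟩
    rw [← h3]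
    omega
  · simp
    omega

/-- `A₂[i] := heapRadix lam N τ i` for all `i < 2 * r₃₅`, where `lam` is in `r₆`. -/
def radixProg (N τ : ℕ) : RAMProg :=
  forLoop 16 35 5 (.const 34 1 ;; .const 25 0 ;; .add 25 25 16 ;; .const 26 N ;; .sub 36 6 25 ;;
    .loop 36 (.add 25 25 25 ;; .add 25 25 34 ;; .add 26 26 26 ;; .add 26 26 26 ;; .add 26 26 26 ;;
      .sub 36 6 25) ;;
    .add 37 16 16 ;; .store 2 37 26 ;; .sub 36 6 16 ;; .cond 36 .skip (.const 26 τ) ;;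
    .add 37 37 34 ;; .store 2 37 26)

theorem runs_radixProg (N τ₀ lam n : ℕ) (σ : RAMState) (hlam : σ.reg 6 = lam) (hn : σ.reg 35 = n) :
    Runs (radixProg N τ₀) σ (n * (7 * lam + 17) + 3)
      (fun τ => ∀ i < 2 * n, τ.arr 2 i = heapRadix lam N τ₀ i) := by
  refine Runs.of_le (Runs.forLoop (n := n) (T := 7 * lam + 13)
    (fun j τ => ∀ i < 2 * j, τ.arr 2 i = heapRadix lam N τ₀ i)
    (by simpa using hn) (by simp [RAMProg.SetsReg]) ?_ ?_ ?_ ?_) ?_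
  · intro j τ v h; simpa using h
  · intro j τ v h; simpa using h
  · simp
  · intro j hj τ hag hτ h
    have e6 : τ.reg 6 = lam := by rw [hag.reg 6 (by simp [RAMProg.SetsReg]), hlam]
    refine Runs.of_le (.const_seq (.const_seq (.add_seq (.const_seq (.sub_seq (Runs.seq
      (Runs.loop (fun τ' => τ'.reg 26 * heapCap lam (τ'.reg 25) ^ 3 = N * heapCap lam j ^ 3 ∧
        τ'.reg 36 = lam - τ'.reg 25 ∧ τ'.reg 34 = 1 ∧ τ'.reg 6 = lam) (fun τ' => lam - τ'.reg 25)
        (T := 6) ?_ ?_) fun τ₁ hag₁ h₁ => .add_seq (.store_seq (.sub_seq (Runs.seq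
      (R := fun τ' => τ'.reg 26 = if lam ≤ j then τ₀ else N * heapCap lam j ^ 3)
      (.cond (T := 1) (fun h => .skip ?_) (fun h => .const ?_)) fun τ₂ hag₂ h₂ =>
        .add_seq (.store ?_)))))))))) ?_
    rotate_right
    · simp [hτ, e6]
      omega
    · rintro τ' - ⟨h1, h2, h3, h4⟩ h5
      refine .add_seq (.add_seq (.add_seq (.add_seq (.add_seq (.sub ?_)))))
      simp [h3, h4]
      refine ⟨?_, by omega⟩
      rw [← h1, heapCap_of_lt (show τ'.reg 25 < lam by omega),
        show τ'.reg 25 + τ'.reg 25 + 1 = 2 * τ'.reg 25 + 1 by ring]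
      ring
    · simp [hτ, e6]
    all_goals
      obtain ⟨⟨g1, g2, g3, g4⟩, g5⟩ := h₁
      have hcap : τ₁.reg 26 = N * heapCap lam j ^ 3 := by
        rw [← g1, heapCap_of_le (by omega)]
        simp
      have e16 : τ₁.reg 16 = j := by
        rw [hag₁.reg 16 (by simp [RAMProg.SetsReg])]
        simpa using hτ
    · simp [g4, e16] at h
      simp [hcap, show ¬ lam ≤ j by omega]
    · simp [g4, e16] at h
      simp [show lam ≤ j by omega]
    · have e2 : τ₂.arr 2 = Function.update (τ.arr 2) (2 * j) (N * heapCap lam j ^ 3) := by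
        rw [hag₂.arr 2 (by simp [RAMProg.SetsArr])]
        simp [hcap, e16, hag₁.arr 2 (by simp [RAMProg.SetsArr]), two_mul]
      have e37 : τ₂.reg 37 = 2 * j := by
        rw [hag₂.reg 37 (by simp [RAMProg.SetsReg])]
        simp [e16, two_mul]
      have e34 : τ₂.reg 34 = 1 := by
        rw [hag₂.reg 34 (by simp [RAMProg.SetsReg])]
        simp [g3]
      intro i hi
      simp [e2, e37, e34, h₂, Function.update_apply]
      unfold heapRadix
      by_cases h1 : i = 2 * j + 1
      · rw [if_pos h1, h1, show (2 * j + 1) / 2 = j by omega]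
        simp only [show (2 * j + 1) % 2 = 1 by omega, true_and]
      · rw [if_neg h1]
        by_cases h2 : i = 2 * j
        · rw [if_pos h2, h2, if_neg (by omega), show 2 * j / 2 = j by omega]
        · rw [if_neg h2, h i (by omega)]
          rfl
  · have : n * (7 * lam + 13 + 4) = n * (7 * lam + 17) := by ring
    omega

/-- `A_b[i] := f i` for all `i < n`. -/
def writeTable (b : ℕ) (f : ℕ → ℕ) : ℕ → RAMProg
  | 0 => .skip
  | k + 1 => writeTable b f k ;; .const 36 k ;; .const 37 (f k) ;; .store b 36 37

theorem writeTable_setsReg {b n x : ℕ} {f : ℕ → ℕ} (hx : x ≠ 36 ∧ x ≠ 37) :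
    ¬ (writeTable b f n).SetsReg x := by
  induction n with
  | zero => simp [writeTable, RAMProg.SetsReg]
  | succ k ih => simp [writeTable, RAMProg.SetsReg, ih, hx]

theorem writeTable_setsArr {b n c : ℕ} {f : ℕ → ℕ} (hc : c ≠ b) :
    ¬ (writeTable b f n).SetsArr c := by
  induction n with
  | zero => simp [writeTable, RAMProg.SetsArr]
  | succ k ih => simp [writeTable, RAMProg.SetsArr, ih, hc]

theorem runs_writeTable (b : ℕ) (f : ℕ → ℕ) (n : ℕ) (σ : RAMState) :
    Runs (writeTable b f n) σ (3 * n + 1)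
      (fun τ => ∀ i, τ.arr b i = if i < n then f i else σ.arr b i) := by
  induction n with
  | zero => exact .skip (by simp)
  | succ k ih =>
    refine Runs.of_le (Runs.seq ih fun τ hag h => .const_seq (.const_seq (.store fun i => ?_)))
      (by omega)
    simp [Function.update_apply, h]
    by_cases h1 : i = k
    · simp [h1]
    · simp [h1, show i ≤ k ↔ i < k by omega]

/-! ### Evaluating a colouring -/

/-- `A₁₀[x] := heapColor lam q N tab G x` for all `x < r₁`, where `lam` is in `r₆`, the digits `G`
in `A₄` and `tab` in `A₉`. -/
def colorProg (N q : ℕ) : RAMProg :=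
  forLoop 14 1 5 (.const 34 1 ;; .const 27 0 ;; .add 27 27 14 ;; .const 35 0 ;; .add 36 35 35 ;;
    .load 28 4 36 ;; .add 28 28 34 ;; divProg ;; .sub 37 6 35 ;;
    .loop 37 (.add 36 36 34 ;; .load 38 4 36 ;; .sub 38 27 38 ;; .add 35 35 35 ;; .add 35 35 34 ;;
      .cond 38 (.add 35 35 34) .skip ;; .add 36 35 35 ;; .load 28 4 36 ;; .add 28 28 34 ;;
      divProg ;; .sub 37 6 35) ;;
    .add 36 36 34 ;; .load 32 4 36 ;; .const 33 N ;; mulProg ;; .add 31 31 27 ;; .load 38 9 31 ;;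
    .sub 32 35 6 ;; .const 33 q ;; mulProg ;; .add 38 31 38 ;; .store 10 14 38)

theorem runs_colorProg {N q lam m M : ℕ} {tab G : ℕ → ℕ} (σ : RAMState) (h6 : σ.reg 6 = lam)
    (h1 : σ.reg 1 = m) (hG : ∀ i < 4 * lam + 2, σ.arr 4 i = G i) (htab : σ.arr 9 = tab)
    (hM : ∀ i < 4 * lam + 2, G i ≤ M) :
    Runs (colorProg N q) σ (m * (5 * m + (lam + 1) * (5 * M + 30) + 4 * M + 60) + 3)
      (fun τ => ∀ x < m, τ.arr 10 x = heapColor lam q N tab G x) := by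
  refine Runs.of_le (Runs.forLoop (n := m) (T := 5 * m + lam * (5 * M + 17) + 4 * M + 4 * lam + 40)
    (fun j τ => ∀ x < j, τ.arr 10 x = heapColor lam q N tab G x) h1
    (by simp [divProg, mulProg, RAMProg.SetsReg]) ?_ ?_ ?_ ?_) ?_
  · intro j τ v h; simpa using h
  · intro j τ v h; simpa using h
  · simp
  · intro x hx τ hag hτ h
    have e6 : τ.reg 6 = lam := by rw [hag.reg 6 (by simp [divProg, mulProg, RAMProg.SetsReg]), h6]
    have e4 : τ.arr 4 = σ.arr 4 := hag.arr 4 (by simp [divProg, mulProg, RAMProg.SetsArr])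
    have e9 : τ.arr 9 = tab := by
      rw [hag.arr 9 (by simp [divProg, mulProg, RAMProg.SetsArr]), htab]
    have eG : ∀ i < 4 * lam + 2, τ.arr 4 i = G i := fun i hi => by rw [e4]; exact hG i hi
    refine Runs.of_le (.const_seq (.const_seq (.add_seq (.const_seq (.add_seq (.load_seq (.add_seq
      (Runs.seq (Runs.of_le (T' := 5 * m + 5) (runs_divProg _ ?_) ?_) fun τ₁ hag₁ h₁ =>
      .sub_seq (Runs.seq (Runs.of_le (T' := lam * (5 * M + 17) + 1) (Runs.loop
      (fun τ' => τ'.reg 35 ≤ 2 * lam ∧ τ'.reg 36 = 2 * τ'.reg 35 ∧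
        τ'.reg 37 = lam - τ'.reg 35 ∧ τ'.reg 34 = 1 ∧
        τ'.reg 27 % (G (2 * τ'.reg 35) + 1) = τ'.reg 27 ∧
        heapWalk lam G (τ'.reg 35) (τ'.reg 27) = heapWalk lam G 0 x)
      (fun τ' => lam - τ'.reg 35) (T := 5 * M + 16) ?_ ?_) ?_) fun τ₂ hag₂ h₂ =>
      .add_seq (.load_seq (.const_seq (Runs.seq (Runs.of_le (T' := 4 * M + 2) (runs_mulProg _) ?_)
      fun τ₃ hag₃ h₃ => .add_seq (.load_seq (.sub_seq (.const_seq (Runs.seq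
      (Runs.of_le (T' := 4 * lam + 2) (runs_mulProg _) ?_) fun τ₄ hag₄ h₄ => .add_seq
      (.store ?_))))))))))))))))) ?_
    rotate_right
    · nlinarith
    · simp
    · simp [hτ]
      exact (Nat.div_le_self _ _).trans hx.le
    · simp [hτ, eG 0 (by omega)] at h₁
      rintro τ' hag' ⟨g1, g2, g3, g4, g5, g6⟩ g7
      have f6 : τ'.reg 6 = lam := by
        rw [hag'.reg 6 (by simp [divProg, RAMProg.SetsReg])]
        simp
        rw [hag₁.reg 6 (by simp [divProg, RAMProg.SetsReg])]
        simp [e6]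
      have f4 : ∀ i < 4 * lam + 2, τ'.arr 4 i = G i := fun i hi => by
        rw [hag'.arr 4 (by simp [divProg, RAMProg.SetsArr])]
        simp
        rw [hag₁.arr 4 (by simp [divProg, RAMProg.SetsArr])]
        simp [eG i hi]
      have hlt : τ'.reg 35 < lam := by omega
      have hmod := Nat.mod_lt (τ'.reg 27) (Nat.succ_pos (G (2 * τ'.reg 35)))
      have hMc := hM (2 * τ'.reg 35) (by omega)
      obtain ⟨c, hc⟩ : ∃ c, c = if τ'.reg 27 ≤ G (2 * τ'.reg 35 + 1) then 2 * τ'.reg 35 + 1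
        else 2 * τ'.reg 35 + 2 := ⟨_, rfl⟩
      have hc2 : c ≤ 2 * lam := by rw [hc]; split_ifs <;> omega
      have hgt : τ'.reg 35 < c := by rw [hc]; split_ifs <;> omega
      refine Runs.of_le (.add_seq (.load_seq (.sub_seq (.add_seq (.add_seq (Runs.seq
        (R := fun τ'' => τ''.reg 35 = c) (.cond (T := 1) (fun h => .add ?_) (fun h => .skip ?_))
        fun τ₅ hag₅ h₅ => .add_seq (.load_seq (.add_seq (Runs.seq
        (Runs.of_le (T' := 5 * M + 5) (runs_divProg _ ?_) ?_) fun τ₆ hag₆ h₆ => .sub ?_))))))))) ?_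
      rotate_right
      · omega
      · simp [g2, g4, f4 (2 * τ'.reg 35 + 1) (by omega)] at h
        simp [g4, hc, show ¬ τ'.reg 27 ≤ G (2 * τ'.reg 35 + 1) by omega]
        ring
      · simp [g2, g4, f4 (2 * τ'.reg 35 + 1) (by omega)] at h
        simp [g4, hc, show τ'.reg 27 ≤ G (2 * τ'.reg 35 + 1) by omega]
        ring
      all_goals
        have e34 : τ₅.reg 34 = 1 := by
          rw [hag₅.reg 34 (by simp [RAMProg.SetsReg])]
          simp [g4]
        have e27 : τ₅.reg 27 = τ'.reg 27 := by
          rw [hag₅.reg 27 (by simp [RAMProg.SetsReg])]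
          simp
        have e4' : τ₅.arr 4 (2 * c) = G (2 * c) := by
          rw [hag₅.arr 4 (by simp [RAMProg.SetsArr])]
          exact f4 _ (by omega)
      · simp [e34]
      · simp [h₅, ← two_mul, e4', e34, e27]
        refine (Nat.div_le_self _ _).trans ?_
        simp only [Nat.succ_eq_add_one] at hmod
        omega
      · simp [h₅, ← two_mul, e4', e34, e27] at h₆
        have k35 : τ₆.reg 35 = c := by
          rw [hag₆.reg 35 (by simp [divProg, RAMProg.SetsReg])]
          simp [h₅]
        have k36 : τ₆.reg 36 = 2 * c := by
          rw [hag₆.reg 36 (by simp [divProg, RAMProg.SetsReg])]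
          simp [h₅, two_mul]
        have k6 : τ₆.reg 6 = lam := by
          rw [hag₆.reg 6 (by simp [divProg, RAMProg.SetsReg])]
          simp
          rw [hag₅.reg 6 (by simp [RAMProg.SetsReg])]
          simp [f6]
        simp [k35, k36, h₆.2.2, k6, h₆.1, hc2]
        refine ⟨?_, by omega⟩
        rw [← g6, heapWalk_of_lt hlt, g5, ← hc]
        by_cases hcl : lam ≤ c
        · rw [heapWalk_of_le hcl, heapWalk_of_le hcl, Nat.mod_mod]
        · rw [heapWalk_of_lt (by omega : c < lam), heapWalk_of_lt (by omega : c < lam), Nat.mod_mod]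
    · simp [hτ, eG 0 (by omega)] at h₁
      have k35 : τ₁.reg 35 = 0 := by
        rw [hag₁.reg 35 (by simp [divProg, RAMProg.SetsReg])]
        simp
      have k36 : τ₁.reg 36 = 0 := by
        rw [hag₁.reg 36 (by simp [divProg, RAMProg.SetsReg])]
        simp
      have k6 : τ₁.reg 6 = lam := by
        rw [hag₁.reg 6 (by simp [divProg, RAMProg.SetsReg])]
        simp [e6]
      simp [k35, k36, k6, h₁.2.2, h₁.1]
      by_cases hcl : lam ≤ 0
      · rw [heapWalk_of_le hcl, heapWalk_of_le hcl, Nat.mod_mod]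
      · rw [heapWalk_of_lt (by omega : 0 < lam), heapWalk_of_lt (by omega : 0 < lam), Nat.mod_mod]
    · have k35 : τ₁.reg 35 = 0 := by
        rw [hag₁.reg 35 (by simp [divProg, RAMProg.SetsReg])]
        simp
      simp [k35]
    all_goals
      obtain ⟨⟨g1, g2, g3, g4, g5, g6⟩, g7⟩ := h₂
      have hle : lam ≤ τ₂.reg 35 := by omega
      rw [heapWalk_of_le hle, g5] at g6
      have k4 : ∀ i < 4 * lam + 2, τ₂.arr 4 i = G i := fun i hi => by
        rw [hag₂.arr 4 (by simp [divProg, RAMProg.SetsArr])]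
        simp
        rw [hag₁.arr 4 (by simp [divProg, RAMProg.SetsArr])]
        simp [eG i hi]
      have k6 : τ₂.reg 6 = lam := by
        rw [hag₂.reg 6 (by simp [divProg, RAMProg.SetsReg])]
        simp
        rw [hag₁.reg 6 (by simp [divProg, RAMProg.SetsReg])]
        simp [e6]
    · simp [g2, g4, k4 (2 * τ₂.reg 35 + 1) (by omega)]
      exact hM _ (by omega)
    all_goals
      have l35 : τ₃.reg 35 = τ₂.reg 35 := by
        rw [hag₃.reg 35 (by simp [mulProg, RAMProg.SetsReg])]
        simp
      have l6 : τ₃.reg 6 = lam := by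
        rw [hag₃.reg 6 (by simp [mulProg, RAMProg.SetsReg])]
        simp [k6]
    · simp [l35, l6]
      omega
    · simp [g2, g4, k4 (2 * τ₂.reg 35 + 1) (by omega)] at h₃
      simp [l35, l6] at h₄
      have l27 : τ₃.reg 27 = τ₂.reg 27 := by
        rw [hag₃.reg 27 (by simp [mulProg, RAMProg.SetsReg])]
        simp
      have l9 : τ₃.arr 9 = tab := by
        rw [hag₃.arr 9 (by simp [mulProg, RAMProg.SetsArr])]
        simp
        rw [hag₂.arr 9 (by simp [divProg, RAMProg.SetsArr])]
        simp
        rw [hag₁.arr 9 (by simp [divProg, RAMProg.SetsArr])]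
        simp [e9]
      have m38 : τ₄.reg 38 = tab (G (2 * τ₂.reg 35 + 1) * N + τ₂.reg 27) := by
        rw [hag₄.reg 38 (by simp [mulProg, RAMProg.SetsReg])]
        simp [l9, l27, h₃]
      have m14 : τ₄.reg 14 = x := by
        rw [hag₄.reg 14 (by simp [mulProg, RAMProg.SetsReg])]
        simp
        rw [hag₃.reg 14 (by simp [mulProg, RAMProg.SetsReg])]
        simp
        rw [hag₂.reg 14 (by simp [divProg, RAMProg.SetsReg])]
        simp
        rw [hag₁.reg 14 (by simp [divProg, RAMProg.SetsReg])]
        simp [hτ]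
      have m10 : τ₄.arr 10 = τ.arr 10 := by
        rw [hag₄.arr 10 (by simp [mulProg, RAMProg.SetsArr])]
        simp
        rw [hag₃.arr 10 (by simp [mulProg, RAMProg.SetsArr])]
        simp
        rw [hag₂.arr 10 (by simp [divProg, RAMProg.SetsArr])]
        simp
        rw [hag₁.arr 10 (by simp [divProg, RAMProg.SetsArr])]
        simp
      intro y hy
      simp [m14, m10, m38, h₄, Function.update_apply]
      split_ifs with hyx
      · rw [hyx, heapColor, ← g6]
      · exact h y (by omega)
  · have h1 : 5 * m + lam * (5 * M + 17) + 4 * M + 4 * lam + 40 + 4 ≤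
        5 * m + (lam + 1) * (5 * M + 30) + 4 * M + 60 := by
      nlinarith
    have := Nat.mul_le_mul_left m h1
    omega

/-- Reads the ternary digits in `A₇`: `r₂₃` becomes the code of the set of places with digit one,
and `r₂₄` the code of the set of places with digit zero or one. -/
def maskProg : RAMProg :=
  .const 23 0 ;; .const 24 0 ;; forLoop 17 8 5 (.load 36 7 17 ;; .load 37 8 17 ;;
    .cond 36 (.const 34 1 ;; .sub 36 36 34 ;; .cond 36 .skip (.add 23 23 37 ;; .add 24 24 37))
      (.add 24 24 37))

theorem runs_maskProg {q : ℕ} (σ : RAMState) (hq : σ.reg 8 = q) (h8 : ∀ i < q, σ.arr 8 i = 2 ^ i) :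
    Runs maskProg σ (12 * q + 5) (fun τ =>
      τ.reg 23 = ∑ i ∈ (Finset.range q).filter (fun i => σ.arr 7 i = 1), 2 ^ i ∧
      τ.reg 24 = ∑ i ∈ (Finset.range q).filter (fun i => σ.arr 7 i ≤ 1), 2 ^ i) := by
  refine Runs.of_le (.const_seq (.const_seq (Runs.forLoop (n := q) (T := 8)
    (fun j τ =>
      τ.reg 23 = ∑ i ∈ (Finset.range j).filter (fun i => σ.arr 7 i = 1), 2 ^ i ∧
      τ.reg 24 = ∑ i ∈ (Finset.range j).filter (fun i => σ.arr 7 i ≤ 1), 2 ^ i)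
    (by simpa using hq) (by simp [RAMProg.SetsReg]) ?_ ?_ ?_ ?_))) ?_
  · intro j τ v h; simpa using h
  · intro j τ v h; simpa using h
  · simp
  · rintro j hj τ hag hτ ⟨h1, h2⟩
    have e7 : τ.arr 7 = σ.arr 7 := by rw [hag.arr 7 (by simp [RAMProg.SetsArr])]; rfl
    have e8 : τ.arr 8 j = 2 ^ j := by rw [hag.arr 8 (by simp [RAMProg.SetsArr])]; exact h8 j hj
    refine Runs.of_le (.load_seq (.load_seq (.cond (T := 5) (fun h => .const_seq (.sub_seq
      (.cond (T := 2) (fun h' => (Runs.skip ?_).of_le (by norm_num)) fun h' => .add_seq (.add ?_))))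
      fun h => (Runs.add ?_).of_le (by norm_num)))) (by norm_num)
    all_goals
      simp only [Finset.range_add_one, Finset.filter_insert]
    · simp [hτ, e7] at h h'
      simp [h1, h2, show ¬ σ.arr 7 j = 1 by omega, show ¬ σ.arr 7 j ≤ 1 by omega]
    · simp [hτ, e7] at h h'
      simp [h1, h2, hτ, e8, show σ.arr 7 j = 1 by omega]
      constructor <;> ring
    · simp [hτ, e7] at h
      simp [h1, h2, hτ, e8, h]
      ring
  · omega

/-! ### Coding colour sets by numbers -/

/-- The number whose binary digits are the elements of `X`. -/
def setCode (X : Finset ℕ) : ℕ := ∑ i ∈ X, 2 ^ i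

theorem setCode_injective : Function.Injective setCode := Finset.geomSum_injective le_rfl

theorem setCode_lt {q : ℕ} {X : Finset ℕ} (hX : X ⊆ Finset.range q) : setCode X < 2 ^ q := by
  have h : setCode X ≤ setCode (Finset.range q) := Finset.sum_le_sum_of_subset hX
  have h' : setCode (Finset.range q) = 2 ^ q - 1 := by
    have := Nat.geomSum_eq (le_refl 2) q
    simpa [setCode] using this
  have := Nat.one_le_two_pow (n := q)
  omega

/-- The places below `q` whose ternary digit in `z` is `d`. -/
def ternarySet (q z d : ℕ) : Finset ℕ :=
  (Finset.range q).filter fun i => mixedDigit (fun _ => 3) z i = d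

/-- The places below `q` whose ternary digit in `z` is at most one. -/
def ternarySupport (q z : ℕ) : Finset ℕ :=
  (Finset.range q).filter fun i => mixedDigit (fun _ => 3) z i ≤ 1

theorem ternarySet_subset (q z d : ℕ) : ternarySet q z d ⊆ Finset.range q :=
    Finset.filter_subset _ _

theorem ternarySupport_subset (q z : ℕ) : ternarySupport q z ⊆ Finset.range q :=
  Finset.filter_subset _ _

theorem ternarySupport_eq (q z : ℕ) :
    ternarySet q z 1 ∪ ternarySet q z 0 = ternarySupport q z := by
  ext i
  simp only [ternarySet, ternarySupport, Finset.mem_union, Finset.mem_filter]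
  constructor
  · rintro (⟨h, h'⟩ | ⟨h, h'⟩) <;> exact ⟨h, by omega⟩
  · rintro ⟨h, h'⟩
    rcases Nat.le_one_iff_eq_zero_or_eq_one.1 h' with h' | h'
    · exact Or.inr ⟨h, h'⟩
    · exact Or.inl ⟨h, h'⟩

theorem disjoint_ternarySet (q z : ℕ) : Disjoint (ternarySet q z 1) (ternarySet q z 0) := by
  rw [Finset.disjoint_left]
  intro i hi hi'
  have h1 := (Finset.mem_filter.1 hi).2
  have h2 := (Finset.mem_filter.1 hi').2
  omega

/-- Ternary strings enumerate the ways to split a colour set between a new agent and the earlier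
ones. -/
theorem SbCFFA.reach_succ_iff (J : SbCFFA) (col : ℕ → ℕ) (q : ℕ) (a : Fin J.n) {X : Finset ℕ}
    (hX : X ⊆ Finset.range q) :
    J.Reach col (a + 1) X ↔ ∃ z < 3 ^ q, ternarySupport q z = X ∧
      J.Reach col a (ternarySet q z 1) ∧ J.HasBundle (J.u a) col (ternarySet q z 0) := by
  constructor
  · rintro ⟨h, Y, Z, hYZ, rfl, hY, hZ⟩
    obtain ⟨z, hz, hd⟩ := exists_mixedDigit_eq (Q := fun _ => 3) (by simp)
      (fun i => if i ∈ Z then 0 else if i ∈ Y then 1 else 2)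
      (fun i => by split_ifs <;> norm_num) q
    rw [placeValue_const] at hz
    have h0 : ternarySet q z 0 = Z := by
      ext i
      simp only [ternarySet, Finset.mem_filter, Finset.mem_range]
      constructor
      · rintro ⟨hi, h⟩
        rw [hd i hi] at h
        split_ifs at h with h'
        exact h'
      · intro hi
        have hiq := Finset.mem_range.1 (hX (Finset.mem_union_right _ hi))
        exact ⟨hiq, by rw [hd i hiq]; simp [hi]⟩
    have h1 : ternarySet q z 1 = Y := by
      ext i
      simp only [ternarySet, Finset.mem_filter, Finset.mem_range]
      constructor
      · rintro ⟨hi, h⟩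
        rw [hd i hi] at h
        split_ifs at h with h' h''
        · exact h''
        · omega
      · intro hi
        have hiq := Finset.mem_range.1 (hX (Finset.mem_union_left _ hi))
        have : i ∉ Z := Finset.disjoint_left.1 hYZ hi
        exact ⟨hiq, by rw [hd i hiq]; simp [hi, this]⟩
    exact ⟨z, hz, by rw [← ternarySupport_eq, h0, h1], by rwa [h1], by rwa [h0]⟩
  · rintro ⟨z, -, rfl, h1, h2⟩
    exact ⟨a.2, _, _, disjoint_ternarySet q z, ternarySupport_eq q z, h1, h2⟩

/-! ### The algorithm for fair allocation -/

/-- The registers and arrays that stay fixed during the search contain the instance, the number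
`lam` of internal nodes of the heap, and the quantities derived from them. The number of colours is
`(lam + 1) * q`, and the colourings are numbered by the mixed radix system `heapRadix lam N τ`. -/
structure Ready (J : SbCFFA) (q N τ : ℕ) (tab : ℕ → ℕ) (lam : ℕ) (σ : RAMState) : Prop where
  r0 : σ.reg 0 = J.n
  r1 : σ.reg 1 = J.m
  r2 : σ.reg 2 = J.s
  r3 : σ.reg 3 = J.η
  r6 : σ.reg 6 = lam
  r7 : σ.reg 7 = 4 * lam + 2
  r8 : σ.reg 8 = (lam + 1) * q
  r9 : σ.reg 9 = J.m * J.m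
  r10 : σ.reg 10 = 3 ^ ((lam + 1) * q)
  r11 : σ.reg 11 = 2 ^ ((lam + 1) * q)
  r12 : σ.reg 12 = placeValue (heapRadix lam N τ) (4 * lam + 2)
  a0 : σ.arr 0 = adjacencyArray J.H
  a1 : σ.arr 1 = matrixArray J.u
  a3 : ∀ i < 4 * lam + 2, σ.arr 3 i = placeValue (heapRadix lam N τ) i
  a6 : ∀ i < (lam + 1) * q, σ.arr 6 i = 3 ^ i
  a8 : ∀ i < (lam + 1) * q, σ.arr 8 i = 2 ^ i
  a9 : σ.arr 9 = tab

theorem Ready.agree {J : SbCFFA} {q N τ : ℕ} {tab : ℕ → ℕ} {lam : ℕ} {σ σ' : RAMState} {p : RAMProg}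
    (h : Ready J q N τ tab lam σ) (hag : Agree p σ σ')
    (hr : ∀ x ∈ [0, 1, 2, 3, 6, 7, 8, 9, 10, 11, 12], ¬ p.SetsReg x)
    (ha : ∀ b ∈ [0, 1, 3, 6, 8, 9], ¬ p.SetsArr b) : Ready J q N τ tab lam σ' := by
  constructor
  · rw [hag.reg 0 (hr 0 (by simp)), h.r0]
  · rw [hag.reg 1 (hr 1 (by simp)), h.r1]
  · rw [hag.reg 2 (hr 2 (by simp)), h.r2]
  · rw [hag.reg 3 (hr 3 (by simp)), h.r3]
  · rw [hag.reg 6 (hr 6 (by simp)), h.r6]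
  · rw [hag.reg 7 (hr 7 (by simp)), h.r7]
  · rw [hag.reg 8 (hr 8 (by simp)), h.r8]
  · rw [hag.reg 9 (hr 9 (by simp)), h.r9]
  · rw [hag.reg 10 (hr 10 (by simp)), h.r10]
  · rw [hag.reg 11 (hr 11 (by simp)), h.r11]
  · rw [hag.reg 12 (hr 12 (by simp)), h.r12]
  · rw [hag.arr 0 (ha 0 (by simp)), h.a0]
  · rw [hag.arr 1 (ha 1 (by simp)), h.a1]
  · rw [hag.arr 3 (ha 3 (by simp))]; exact h.a3
  · rw [hag.arr 6 (ha 6 (by simp))]; exact h.a6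
  · rw [hag.arr 8 (ha 8 (by simp))]; exact h.a8
  · rw [hag.arr 9 (ha 9 (by simp)), h.a9]

/-- Treats one ternary string, whose number is in `r₁₆`: if the earlier agents can be served with
the colours of digit one, and the program `B` finds a bundle with colours of digit zero for the
current agent, then the union of the two colour sets is marked. The marks for the earlier agents
start at position `r₁₉` of `A₁₁`, the new ones at position `r₂₀`. -/
def splitProg (B : RAMProg) : RAMProg :=
  .const 27 0 ;; .add 27 27 16 ;; decodeProg 8 6 7 ;; maskProg ;; .add 36 19 23 ;; .load 37 11 36 ;;
    .cond 37 (callProg B ;; .cond 64 (.add 36 20 24 ;; .const 21 1 ;; .store 11 36 21) .skip) .skip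

/-- Treats one agent. The marks are written to a part of `A₁₁` that has not been used before. -/
def agentProg (B : RAMProg) : RAMProg :=
  .add 20 19 11 ;; .const 21 0 ;; forLoop 16 10 5 (splitProg B) ;; .const 19 0 ;; .add 19 19 20 ;;
    .add 22 22 1

/-- Treats one colouring, whose number is in `r₁₃`. -/
def guessProg (B : RAMProg) (q N : ℕ) : RAMProg :=
  .const 27 0 ;; .add 27 27 13 ;; decodeProg 7 3 4 ;; colorProg N q ;; .const 21 1 ;;
    .store 11 19 21 ;; .const 22 0 ;; forLoop 15 0 5 (agentProg B) ;; .add 19 19 11 ;; .add 18 18 21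

theorem splitProg_setsReg (B : RAMProg) {x : ℕ} (hx : x < 62)
    (h : x ≠ 5 ∧ x ≠ 17 ∧ x ≠ 21 ∧ (x < 23 ∨ 38 < x)) : ¬ (splitProg B).SetsReg x := by
  have := callProg_setsReg B hx (by omega)
  simp [splitProg, decodeProg, divProg, maskProg, RAMProg.SetsReg, this]
  omega

theorem splitProg_setsArr (B : RAMProg) {b : ℕ} (hb : b < 32) (h : b ≠ 7 ∧ b ≠ 11) :
    ¬ (splitProg B).SetsArr b := by
  have := callProg_setsArr B hb
  simp [splitProg, decodeProg, divProg, maskProg, RAMProg.SetsArr, this]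
  omega

theorem agentProg_setsReg (B : RAMProg) {x : ℕ} (hx : x < 62)
    (h : x ≠ 5 ∧ x ≠ 16 ∧ x ≠ 17 ∧ (x < 19 ∨ 38 < x)) : ¬ (agentProg B).SetsReg x := by
  have := splitProg_setsReg B hx (by omega)
  simp [agentProg, RAMProg.SetsReg, this]
  omega

theorem agentProg_setsArr (B : RAMProg) {b : ℕ} (hb : b < 32) (h : b ≠ 7 ∧ b ≠ 11) :
    ¬ (agentProg B).SetsArr b := by
  have := splitProg_setsArr B hb h
  simp [agentProg, RAMProg.SetsArr, this]

theorem guessProg_setsReg (B : RAMProg) (q N : ℕ) {x : ℕ} (h : x = 13 ∨ (x < 13 ∧ x ≠ 5)) :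
    ¬ (guessProg B q N).SetsReg x := by
  have := agentProg_setsReg B (x := x) (by omega) (by omega)
  simp [guessProg, decodeProg, divProg, colorProg, mulProg, RAMProg.SetsReg, this]
  omega

theorem guessProg_setsArr (B : RAMProg) (q N : ℕ) {b : ℕ} (hb : b < 32)
    (h : b ≠ 4 ∧ b ≠ 7 ∧ b ≠ 10 ∧ b ≠ 11) : ¬ (guessProg B q N).SetsArr b := by
  have := agentProg_setsArr B hb (by omega)
  simp [guessProg, decodeProg, divProg, colorProg, mulProg, RAMProg.SetsArr, this]
  omega

/-- `B` solves all subproblems of `J` within `TB` steps. -/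
def SolvesSubproblems (B : RAMProg) (J : SbCFFA) (TB : ℕ) : Prop :=
  ∀ (u : Fin J.m → ℕ) (col : ℕ → ℕ) (Z : Finset ℕ),
    ∃ t τ, RAMExec B (J.subproblem u col Z).input t τ ∧ t ≤ TB ∧
      (τ.reg 0 ≠ 0 ↔ (J.subproblem u col Z).IsYes)

/-- The colour sets marked in `A₁₁`, in the part that starts at position `β`. -/
def Marked (σ : RAMState) (β : ℕ) (X : Finset ℕ) : Prop := σ.arr 11 (β + setCode X) ≠ 0

/-- A bound for the time of `callProg`. -/
def callTime (B : RAMProg) (J : SbCFFA) (TB : ℕ) : ℕ :=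
  4 * TB + 7 * (J.m * J.m) + 12 * J.m + B.regBound + 20

theorem runs_splitProg {B : RAMProg} {J : SbCFFA} {TB q N τ₀ lam : ℕ} {tab : ℕ → ℕ}
    (hB : SolvesSubproblems B J TB) (σ : RAMState) (hσ : Ready J q N τ₀ tab lam σ) (a : Fin J.n)
    (col : ℕ → ℕ) (hcol : ∀ x < J.m, σ.arr 10 x = col x) (hcolq : ∀ x, col x < (lam + 1) * q)
    (β : ℕ) (h19 : σ.reg 19 = β) (h20 : σ.reg 20 = β + 2 ^ ((lam + 1) * q))
    (h22 : σ.reg 22 = a * J.m)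
    (hst : StampsLe σ) (z : ℕ) (hz : σ.reg 16 = z) (hzlt : z < 3 ^ ((lam + 1) * q))
    (hmark : Marked σ β (ternarySet ((lam + 1) * q) z 1) ↔
      J.Reach col a (ternarySet ((lam + 1) * q) z 1)) :
    Runs (splitProg B) σ (41 * ((lam + 1) * q) + callTime B J TB + 20) (fun τ =>
      StampsLe τ ∧
      ((J.Reach col a (ternarySet ((lam + 1) * q) z 1) ∧
          J.HasBundle (J.u a) col (ternarySet ((lam + 1) * q) z 0)) →
        τ.reg 21 = 1 ∧ τ.arr 11 = Function.update (σ.arr 11)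
          (β + 2 ^ ((lam + 1) * q) + setCode (ternarySupport ((lam + 1) * q) z)) 1) ∧
      (¬ (J.Reach col a (ternarySet ((lam + 1) * q) z 1) ∧
          J.HasBundle (J.u a) col (ternarySet ((lam + 1) * q) z 0)) →
        τ.reg 21 = σ.reg 21 ∧ τ.arr 11 = σ.arr 11)) := by
  set k := (lam + 1) * q with hk
  refine Runs.of_le (.const_seq (.add_seq (Runs.seq (runs_decodeProg (N := 8) (w := 6) (G := 7)
      (n := k) (M := 3) (c := z)
    (Q := fun _ => 3) (by norm_num) (by norm_num) (by norm_num) (by norm_num) _ ?_ ?_ ?_ ?_)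
    fun σ₁ hag₁ h₁ => Runs.seq (runs_maskProg (q := k) σ₁ ?_ ?_) fun σ₂ hag₂ h₂ =>
    .add_seq (.load_seq (.cond (T := callTime B J TB + 4)
      (fun h => Runs.seq (T₁ := callTime B J TB) (runs_callProg hB _ ?_ ?_ ?_ ?_ ?_ ?_ a ?_ col ?_
        (ternarySet k z 0) ?_ ?_)
        fun σ₃ hag₃ h₃ => .cond (T := 3) (fun h' => .add_seq (.const_seq (.store ?_)))
          fun h' => (Runs.skip ?_).of_le (by norm_num))
      fun h => (Runs.skip ?_).of_le (by omega)))))) ?_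
  rotate_right
  · ring_nf
    omega
  · simpa using hσ.r8
  · intro i hi
    simpa [placeValue_const] using hσ.a6 i hi
  · simpa using hz
  · simpa [placeValue_const] using hzlt
  all_goals
    have hrd₁ : Ready J q N τ₀ tab lam σ₁ := by
      have : Ready J q N τ₀ tab lam ((σ.setReg 27 0).setReg 27
          ((σ.setReg 27 0).reg 27 + (σ.setReg 27 0).reg 16)) :=
        hσ.agree (p := .const 27 0) ⟨fun x hx => by simp [show ¬ x = 27 from hx], fun _ _ => rfl⟩
          (by simp [RAMProg.SetsReg]) (by simp [RAMProg.SetsArr])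
      exact this.agree hag₁ (by simp [decodeProg, divProg, RAMProg.SetsReg])
        (by simp [decodeProg, divProg, RAMProg.SetsArr])
  · exact hrd₁.r8
  · exact hrd₁.a8
  all_goals
    have hrd₂ : Ready J q N τ₀ tab lam σ₂ := hrd₁.agree hag₂ (by simp [maskProg, RAMProg.SetsReg])
        (by simp [maskProg, RAMProg.SetsArr])
    have g : ∀ x, (18 ≤ x ∧ x ≤ 22 ∨ x = 62) → σ₂.reg x = σ.reg x := fun x hx => by
      rw [hag₂.reg x (by simp [maskProg, RAMProg.SetsReg]; omega),
        hag₁.reg x (by simp [decodeProg, divProg, RAMProg.SetsReg]; omega)]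
      simp [show x ≠ 27 by omega]
    have g' : ∀ b, b ≠ 7 → σ₂.arr b = σ.arr b := fun b hb => by
      rw [hag₂.arr b (by simp [maskProg, RAMProg.SetsArr]),
        hag₁.arr b (by simp [decodeProg, divProg, RAMProg.SetsArr]; omega)]
      rfl
    have g7 : ∀ i < k, σ₂.arr 7 i = mixedDigit (fun _ => 3) z i := fun i hi => by
      rw [hag₂.arr 7 (by simp [maskProg, RAMProg.SetsArr])]
      exact h₁ i hi
    have h23 : σ₂.reg 23 = setCode (ternarySet k z 1) := by
      rw [h₂.1]
      unfold setCode ternarySet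
      congr 1
      exact Finset.filter_congr fun i hi => by rw [h₁ i (Finset.mem_range.1 hi)]
    have h24 : σ₂.reg 24 = setCode (ternarySupport k z) := by
      rw [h₂.2]
      unfold setCode ternarySupport
      congr 1
      exact Finset.filter_congr fun i hi => by rw [h₁ i (Finset.mem_range.1 hi)]
    simp [g 19 (by norm_num), h19, h23, g' 11 (by norm_num)] at h
    unfold Marked at hmark
    have hst₂ : StampsLe σ₂ := fun b i => by
      rw [g' _ (by omega), g 62 (by norm_num)]; exact hst b i
  · simpa using hrd₂.r1
  · simpa using hrd₂.r2
  · simpa using hrd₂.r3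
  · simpa using hrd₂.r9
  · simpa using hrd₂.a0
  · simpa using hrd₂.a1
  · simpa [g 22 (by norm_num)] using h22
  · simpa [g' 10 (by norm_num)] using hcol
  · intro x hx
    simp [g7 (col x) (hcolq x), ternarySet, hcolq x]
  · intro b i
    simpa using hst₂ b i
  · have hreach := hmark.1 h
    refine ⟨fun b i => ?_, fun _ => ?_, fun hn => absurd ⟨hreach, h₃.1.1 h'⟩ hn⟩
    · have := h₃.2 b i
      simpa [show ¬ 2 * b + 33 = 11 by omega] using this
    · have e20 : σ₃.reg 20 = β + 2 ^ k := by
        rw [hag₃.reg 20 (callProg_setsReg B (by norm_num) (by norm_num))]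
        simp [g 20 (by norm_num), h20]
      have e24 : σ₃.reg 24 = setCode (ternarySupport k z) := by
        rw [hag₃.reg 24 (callProg_setsReg B (by norm_num) (by norm_num))]
        simp [h24]
      have e11 : σ₃.arr 11 = σ.arr 11 := by
        rw [hag₃.arr 11 (callProg_setsArr B (by norm_num))]
        simp [g' 11 (by norm_num)]
      simp [e20, e24, e11]
  · refine ⟨h₃.2, fun hn => absurd (h₃.1.2 hn.2) (by simpa using h'), fun _ => ⟨?_, ?_⟩⟩
    · rw [hag₃.reg 21 (callProg_setsReg B (by norm_num) (by norm_num))]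
      simp [g 21 (by norm_num)]
    · rw [hag₃.arr 11 (callProg_setsArr B (by norm_num))]
      simp [g' 11 (by norm_num)]
  · refine ⟨fun b i => by simpa using hst₂ b i, fun hn => absurd h (hmark.2 hn.1),
      fun _ => ⟨?_, ?_⟩⟩
    · simp [g 21 (by norm_num)]
    · simp [g' 11 (by norm_num)]

theorem Ready.setReg {J : SbCFFA} {q N τ : ℕ} {tab : ℕ → ℕ} {lam : ℕ} {σ : RAMState}
    (h : Ready J q N τ tab lam σ) {x v : ℕ} (hx : x ∉ [0, 1, 2, 3, 6, 7, 8, 9, 10, 11, 12]) :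
    Ready J q N τ tab lam (σ.setReg x v) :=
  h.agree (p := .const x 0) ⟨fun y hy => by simp [show ¬ y = x from hy], fun _ _ => rfl⟩
    (fun _ hy hy' => hx ((show _ = x from hy') ▸ hy)) fun _ _ h => h

theorem StampsLe.setReg {σ : RAMState} (h : StampsLe σ) {x v : ℕ} (hx : x ≠ 62) :
    StampsLe (σ.setReg x v) := fun b i => by
  simpa [show ¬ 62 = x from fun e => hx e.symm] using h b i

/-- The state of the dynamic programme after the first `a` agents have been treated, with `k`
colours: the colour sets that can serve these agents are marked at `r₁₉`, the rest of `A₁₁` behind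
them has not been used, and `r₂₁` says whether there is any such colour set. -/
structure ServedMarks (J : SbCFFA) (k : ℕ) (col : ℕ → ℕ) (a : ℕ) (σ : RAMState) : Prop where
  marked : ∀ X ⊆ Finset.range k, Marked σ (σ.reg 19) X ↔ J.Reach col a X
  fresh : ∀ i, σ.reg 19 + 2 ^ k ≤ i → σ.arr 11 i = 0
  flag : σ.reg 21 ≠ 0 ↔ ∃ X ⊆ Finset.range k, J.Reach col a X
  row : σ.reg 22 = a * J.m
  stamps : StampsLe σ

theorem ServedMarks.setReg {J : SbCFFA} {k : ℕ} {col : ℕ → ℕ} {a : ℕ} {σ : RAMState}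
    (h : ServedMarks J k col a σ) {x v : ℕ} (hx : x ≠ 19 ∧ x ≠ 21 ∧ x ≠ 22 ∧ x ≠ 62) :
    ServedMarks J k col a (σ.setReg x v) where
  marked X hX := by simpa [Marked, hx.1.symm] using h.marked X hX
  fresh i hi := h.fresh i (by simpa [hx.1.symm] using hi)
  flag := by simpa [hx.2.1.symm] using h.flag
  row := by simpa [hx.2.2.1.symm] using h.row
  stamps := h.stamps.setReg hx.2.2.2

theorem runs_agentProg {B : RAMProg} {J : SbCFFA} {TB q N τ₀ lam : ℕ} {tab : ℕ → ℕ}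
    (hB : SolvesSubproblems B J TB) (σ : RAMState) (hσ : Ready J q N τ₀ tab lam σ) (a : Fin J.n)
    (col : ℕ → ℕ) (hcol : ∀ x < J.m, σ.arr 10 x = col x) (hcolq : ∀ x, col x < (lam + 1) * q)
    (hserved : ServedMarks J ((lam + 1) * q) col a σ) :
    Runs (agentProg B) σ
      (3 ^ ((lam + 1) * q) * (41 * ((lam + 1) * q) + callTime B J TB + 24) + 8)
      (ServedMarks J ((lam + 1) * q) col (a + 1)) := by
  set k := (lam + 1) * q with hk
  set β := σ.reg 19 with hβ
  -- the string `z` describes an allocation to the first `a + 1` agents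
  let good : ℕ → Prop := fun z =>
    J.Reach col a (ternarySet k z 1) ∧ J.HasBundle (J.u a) col (ternarySet k z 0)
  refine Runs.of_le (.add_seq (.const_seq (Runs.seq (Runs.forLoop (n := 3 ^ k)
    (T := 41 * k + callTime B J TB + 20)
    (fun j τ => (∀ X ⊆ Finset.range k, Marked τ (β + 2 ^ k) X ↔
        ∃ z < j, ternarySupport k z = X ∧ good z) ∧
      (∀ i, β + 2 ^ k + 2 ^ k ≤ i → τ.arr 11 i = 0) ∧
      (∀ i < β + 2 ^ k, τ.arr 11 i = σ.arr 11 i) ∧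
      (τ.reg 21 ≠ 0 ↔ ∃ z < j, good z) ∧ StampsLe τ) ?_ ?_ ?_ ?_ ?_ ?_)
    fun τ hag hτ => .const_seq (.add_seq (.add ?_))))) ?_
  rotate_right
  · ring_nf
    omega
  · simpa using hσ.r10
  · simp [splitProg_setsReg B (x := 16) (by norm_num) (by norm_num),
      splitProg_setsReg B (x := 10) (by norm_num) (by norm_num)]
  · rintro j τ v ⟨h1, h2, h3, h4, h5⟩
    exact ⟨h1, h2, h3, by simpa using h4, h5.setReg (by norm_num)⟩
  · rintro j τ v ⟨h1, h2, h3, h4, h5⟩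
    exact ⟨h1, h2, h3, by simpa using h4, h5.setReg (by norm_num)⟩
  · refine ⟨fun X hX => ?_, fun i hi => hserved.fresh i ((Nat.le_add_right _ _).trans hi),
      fun _ _ => rfl, by simp,
      (hserved.stamps.setReg (by norm_num)).setReg (by norm_num)⟩
    simpa [Marked] using hserved.fresh _ (Nat.le_add_right _ _)
  · rintro j hj τ hag hτ ⟨h1, h2, h3, h4, h5⟩
    have hr : ∀ x, 18 ≤ x → x ≤ 22 → x ≠ 21 → τ.reg x =
        ((σ.setReg 20 (σ.reg 19 + σ.reg 11)).setReg 21 0).reg x := fun x hx hx' hx'' =>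
      hag.reg x (by
        simp [splitProg_setsReg B (x := x) (by omega) (by omega)]
        omega)
    have ha : ∀ b, b < 32 → b ≠ 7 → b ≠ 11 → τ.arr b = σ.arr b := fun b hb hb' hb'' => by
      rw [hag.arr b (by simp [splitProg_setsArr B hb ⟨hb', hb''⟩])]
      rfl
    have hrd : Ready J q N τ₀ tab lam τ := by
      refine Ready.agree ((hσ.setReg (x := 20) (by simp)).setReg (x := 21) (by simp)) hag ?_ ?_
      · intro x hx
        simp at hx
        simp [splitProg_setsReg B (x := x) (by omega) (by omega)]
        omega
      · intro b hb
        simp at hb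
        simp [splitProg_setsArr B (b := b) (by omega) (by omega)]
    refine (runs_splitProg hB τ hrd a col 
      (fun x hx => (congrFun (ha 10 (by norm_num) (by norm_num) (by norm_num)) x).trans
        (hcol x hx)) hcolq β ?_ ?_ ?_ h5 j hτ hj ?_).imp ?_
    · simp [hr 19, hβ]
    · simp [hr 20, hβ, hσ.r11]
    · simp [hr 22, hserved.row]
    · rw [← hserved.marked _ (ternarySet_subset k j 1)]
      unfold Marked
      rw [h3 _ (Nat.add_lt_add_left (setCode_lt (ternarySet_subset k j 1)) β)]
    · rintro τ' hag' ⟨g1, g2, g3⟩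
      simp only [← hk] at g2 g3
      by_cases hgood : good j
      · obtain ⟨e21, e11⟩ := g2 hgood
        have hlt := setCode_lt (ternarySupport_subset k j)
        refine ⟨fun X hX => ?_, fun i hi => ?_, fun i hi => ?_, ?_, g1⟩
        · have h1X := h1 X hX
          unfold Marked at h1X ⊢
          rw [e11, Function.update_apply]
          by_cases hXj : X = ternarySupport k j
          · subst hXj
            simpa using (⟨j, le_rfl, rfl, hgood⟩ :
              ∃ z ≤ j, ternarySupport k z = ternarySupport k j ∧ good z)
          · rw [if_neg (fun e => hXj (setCode_injective (by omega))), h1X]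
            exact ⟨fun ⟨z, hz, h⟩ => ⟨z, by omega, h⟩, fun ⟨z, hz, h, h'⟩ => ⟨z, by
              rcases Nat.lt_succ_iff_lt_or_eq.1 hz with hz | rfl
              · exact hz
              · exact absurd h.symm hXj, h, h'⟩⟩
        · rw [e11, Function.update_apply, if_neg (by omega)]
          exact h2 i hi
        · rw [e11, Function.update_apply, if_neg (by omega)]
          exact h3 i hi
        · simpa [e21] using (⟨j, le_rfl, hgood⟩ : ∃ z ≤ j, good z)
      · obtain ⟨e21, e11⟩ := g3 hgood
        have hz : ∀ P : ℕ → Prop, (∃ z < j + 1, P z ∧ good z) ↔ ∃ z < j, P z ∧ good z := fun P =>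
          ⟨fun ⟨z, hz, h, h'⟩ => ⟨z, by
            rcases Nat.lt_succ_iff_lt_or_eq.1 hz with hz | rfl
            · exact hz
            · exact absurd h' hgood, h, h'⟩, fun ⟨z, hz, h⟩ => ⟨z, by omega, h⟩⟩
        refine ⟨fun X hX => ?_, by rwa [e11], by rwa [e11], ?_, g1⟩
        · rw [hz (fun z => ternarySupport k z = X), ← h1 X hX]
          unfold Marked
          rw [e11]
        · rw [e21, h4]
          simpa using (hz fun _ => True).symm
  · obtain ⟨h1, h2, h3, h4, h5⟩ := hτ
    have e20 : τ.reg 20 = β + 2 ^ k := by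
      rw [hag.reg 20 (by simp [splitProg_setsReg B (x := 20) (by norm_num) (by norm_num)])]
      simp [hσ.r11, hβ, hk]
    have e22 : τ.reg 22 = a * J.m := by
      rw [hag.reg 22 (by simp [splitProg_setsReg B (x := 22) (by norm_num) (by norm_num)])]
      simp [hserved.row]
    have e1 : τ.reg 1 = J.m := by
      rw [hag.reg 1 (by simp [splitProg_setsReg B (x := 1) (by norm_num) (by norm_num)])]
      simp [hσ.r1]
    refine ⟨fun X hX => ?_, fun i hi => ?_, ?_, ?_,
      ((h5.setReg (by norm_num)).setReg (by norm_num)).setReg (by norm_num)⟩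
    · rw [J.reach_succ_iff col k a hX, ← h1 X hX]
      simp [Marked, e20]
    · exact h2 i (by simpa [e20] using hi)
    · simp only [RAMState.setReg_reg]
      simp only [show ¬ (21 = 22) by norm_num, show ¬ (21 = 19) by norm_num, if_false]
      rw [h4]
      constructor
      · rintro ⟨z, hz, hz'⟩
        exact ⟨_, ternarySupport_subset k z,
          (J.reach_succ_iff col k a (ternarySupport_subset k z)).2 ⟨z, hz, rfl, hz'⟩⟩
      · rintro ⟨X, hX, h⟩
        obtain ⟨z, hz, -, h'⟩ := (J.reach_succ_iff col k a hX).1 h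
        exact ⟨z, hz, h'⟩
    · simp [e22, e1, add_mul]

/-- The colouring with the number `c`. -/
def guessColor (lam q N τ : ℕ) (tab : ℕ → ℕ) (c : ℕ) : ℕ → ℕ :=
  heapColor lam q N tab (mixedDigit (heapRadix lam N τ) c)

/-- The colouring with the number `c` exhibits a solution of `J`. -/
def Succeeds (J : SbCFFA) (lam q N τ : ℕ) (tab : ℕ → ℕ) (c : ℕ) : Prop :=
  ∃ X ⊆ Finset.range ((lam + 1) * q), J.Reach (guessColor lam q N τ tab c) J.n X

/-- The state of the search after the colourings with numbers below `c`: the register `r₁₈` says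
whether one of them has succeeded, and `A₁₁` has not been used from position `r₁₉` on. -/
structure Searched (J : SbCFFA) (q N τ : ℕ) (tab : ℕ → ℕ) (lam c : ℕ) (σ : RAMState) : Prop where
  result : σ.reg 18 ≠ 0 ↔ ∃ c' < c, Succeeds J lam q N τ tab c'
  fresh : ∀ i, σ.reg 19 ≤ i → σ.arr 11 i = 0
  stamps : StampsLe σ

/-- A bound for the time of `agentProg`, where `k` is the number of colours. -/
def agentTime (B : RAMProg) (J : SbCFFA) (TB k : ℕ) : ℕ :=
  3 ^ k * (41 * k + callTime B J TB + 24) + 8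

/-- A bound for the time of `guessProg`, where `k` is the number of colours and the radices are at
most `M`. -/
def guessTime (B : RAMProg) (J : SbCFFA) (TB lam k M : ℕ) : ℕ :=
  J.n * (agentTime B J TB k + 4) + J.m * (5 * J.m + (lam + 1) * (5 * M + 30) + 4 * M + 60) +
    (4 * lam + 2) * (5 * M + 14) + 20

theorem runs_guessProg {B : RAMProg} {J : SbCFFA} {TB q N τ₀ lam M : ℕ} {tab : ℕ → ℕ}
    (hB : SolvesSubproblems B J TB) (hN : 0 < N) (hτ₀ : 0 < τ₀) (htab : ∀ i, tab i < q)
    (hM : ∀ i < 4 * lam + 2, heapRadix lam N τ₀ i ≤ M) (σ : RAMState)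
    (hσ : Ready J q N τ₀ tab lam σ) {c : ℕ} (hc : σ.reg 13 = c)
    (hlt : c < placeValue (heapRadix lam N τ₀) (4 * lam + 2))
    (hS : Searched J q N τ₀ tab lam c σ) :
    Runs (guessProg B q N) σ (guessTime B J TB lam ((lam + 1) * q) M)
      (Searched J q N τ₀ tab lam (c + 1)) := by
  set k := (lam + 1) * q with hk
  set G := mixedDigit (heapRadix lam N τ₀) c with hG
  have hQ : ∀ i, 0 < heapRadix lam N τ₀ i := heapRadix_pos hN hτ₀
  have hcolq : ∀ x, guessColor lam q N τ₀ tab c x < k := fun x => heapColor_lt htab _ x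
  refine Runs.of_le (.const_seq (.add_seq (Runs.seq (runs_decodeProg (N := 7) (w := 3) (G := 4)
    (n := 4 * lam + 2) (M := M) (c := c) (Q := heapRadix lam N τ₀) (by norm_num) (by norm_num) hQ hM
    _ ?_ ?_ ?_ hlt) fun σ₁ hag₁ h₁ => Runs.seq (runs_colorProg (N := N) (q := q) (lam := lam)
    (m := J.m) (M := M) (tab := tab) (G := G) σ₁ ?_ ?_ h₁ ?_ ?_) fun σ₂ hag₂ h₂ =>
    .const_seq (.store_seq (.const_seq (Runs.seq (Runs.forLoop (n := J.n) (T := agentTime B J TB k)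
    (ServedMarks J k (guessColor lam q N τ₀ tab c)) ?_ ?_ ?_ ?_ ?_ ?_) fun τ hag hτ =>
    .add_seq (.add ?_))))))) ?_
  rotate_right
  · unfold guessTime
    ring_nf
    omega
  · simpa using hσ.r7
  · intro i hi
    simpa using hσ.a3 i hi
  · simpa using hc
  all_goals
    have hrd₁ : Ready J q N τ₀ tab lam σ₁ := by
      refine Ready.agree ((hσ.setReg (x := 27) (by simp)).setReg (x := 27) (by simp)) hag₁ ?_ ?_
      · simp [decodeProg, divProg, RAMProg.SetsReg]
      · simp [decodeProg, divProg, RAMProg.SetsArr]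
  · exact hrd₁.r6
  · exact hrd₁.r1
  · exact hrd₁.a9
  · exact fun i hi => (mixedDigit_lt hQ c i).le.trans (hM i hi)
  all_goals
    have hrd₂ : Ready J q N τ₀ tab lam σ₂ := by
      refine hrd₁.agree hag₂ ?_ ?_
      · simp [colorProg, divProg, mulProg, RAMProg.SetsReg]
      · simp [colorProg, divProg, mulProg, RAMProg.SetsArr]
    have g : ∀ x, (x = 18 ∨ x = 19 ∨ x = 62) → σ₂.reg x = σ.reg x := fun x hx => by
      rw [hag₂.reg x (by simp [colorProg, divProg, mulProg, RAMProg.SetsReg]; omega),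
        hag₁.reg x (by simp [decodeProg, divProg, RAMProg.SetsReg]; omega)]
      simp [show x ≠ 27 by omega]
    have g' : ∀ b, 10 < b → σ₂.arr b = σ.arr b := fun b hb => by
      rw [hag₂.arr b (by simp [colorProg, divProg, mulProg, RAMProg.SetsArr]; omega),
        hag₁.arr b (by simp [decodeProg, divProg, RAMProg.SetsArr]; omega)]
      rfl
    have hst₂ : StampsLe σ₂ := fun b i => by
      rw [g' _ (by omega), g 62 (by norm_num)]
      exact hS.stamps b i
  · simpa using hrd₂.r0
  · simp [agentProg_setsReg B (x := 15) (by norm_num) (by norm_num),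
      agentProg_setsReg B (x := 0) (by norm_num) (by norm_num)]
  · exact fun j τ v h => h.setReg (by norm_num)
  · exact fun j τ v h => h.setReg (by norm_num)
  · have h19 := g 19 (by norm_num)
    refine ⟨fun X hX => ?_, fun i hi => ?_, ?_, by simp, ?_⟩
    · have h0 : setCode ∅ = 0 := by simp [setCode]
      simp [Marked, SbCFFA.Reach, h19, g' 11 (by norm_num), Function.update_apply, hS.fresh]
      rw [← h0]
      exact setCode_injective.eq_iff
    · have := Nat.one_le_two_pow (n := k)
      simp [h19] at hi
      simp [h19, g' 11 (by norm_num), show i ≠ σ.reg 19 by omega]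
      exact hS.fresh i (by omega)
    · simp [SbCFFA.Reach]
    · intro b i
      simpa [show ¬ 2 * b + 33 = 11 by omega] using hst₂ b i
  · intro j hj τ hag hτ h
    refine runs_agentProg (N := N) (τ₀ := τ₀) (tab := tab) hB τ ?_ ⟨j, hj⟩ _ ?_ hcolq h
    · have : Ready J q N τ₀ tab lam (((σ₂.setReg 21 1).setArr 11 ((σ₂.setReg 21 1).reg 19)
          ((σ₂.setReg 21 1).reg 21)).setReg 22 0) := by
        refine Ready.setReg ?_ (by simp)
        exact (hrd₂.setReg (x := 21) (v := 1) (by simp)).agree (p := .store 11 19 21)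
          ⟨fun _ _ => rfl, fun b hb => by simp [show ¬ b = 11 from hb]⟩ (by simp [RAMProg.SetsReg])
          (by simp [RAMProg.SetsArr])
      refine this.agree hag ?_ ?_
      · intro x hx
        simp at hx
        simp [agentProg_setsReg B (x := x) (by omega) (by omega)]
        omega
      · intro b hb
        simp at hb
        simp [agentProg_setsArr B (b := b) (by omega) (by omega)]
    · intro x hx
      rw [hag.arr 10 (by simp [agentProg_setsArr B (b := 10) (by norm_num) (by norm_num)])]
      change _ = heapColor lam q N tab G x
      simpa using h₂ x hx
  · have e18 : τ.reg 18 = σ.reg 18 := by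
      rw [hag.reg 18 (by simp [agentProg_setsReg B (x := 18) (by norm_num) (by norm_num)])]
      simp [g 18]
    have e11 : τ.reg 11 = 2 ^ k := by
      rw [hag.reg 11 (by simp [agentProg_setsReg B (x := 11) (by norm_num) (by norm_num)])]
      simp [hrd₂.r11, hk]
    refine ⟨?_, fun i hi => ?_, (hτ.stamps.setReg (by norm_num)).setReg (by norm_num)⟩
    · have h1 : (∃ c' < c + 1, Succeeds J lam q N τ₀ tab c') ↔
          (∃ c' < c, Succeeds J lam q N τ₀ tab c') ∨ Succeeds J lam q N τ₀ tab c := by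
        constructor
        · rintro ⟨c', hc', h⟩
          rcases Nat.lt_succ_iff_lt_or_eq.1 hc' with h' | rfl
          · exact Or.inl ⟨c', h', h⟩
          · exact Or.inr h
        · rintro (⟨c', hc', h⟩ | h)
          · exact ⟨c', by omega, h⟩
          · exact ⟨c, by omega, h⟩
      rw [h1, ← hS.result, show Succeeds J lam q N τ₀ tab c ↔ τ.reg 21 ≠ 0 from hτ.flag.symm]
      simp [e18]
      omega
    · simp [e11] at hi
      exact hτ.fresh i hi

/-- Computes the number `lam` of internal nodes of the heap into `r₆`, and the simplest quantities
derived from it. With `lg` in `r₃₈`, it is the least number with `n * s + lg < b * (lam + 1)`, so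
that the leaves have room for the allocated jobs, and the jobs are below `2 ^ (b * (lam + 1))`. -/
def paramProg (b q : ℕ) : RAMProg :=
  .const 32 0 ;; .add 32 32 0 ;; .const 33 0 ;; .add 33 33 2 ;; mulProg ;; .add 27 31 38 ;;
    .const 28 b ;; divProg ;; .const 6 0 ;; .add 6 6 29 ;; .add 35 6 6 ;; .add 35 35 34 ;;
    .add 7 35 35 ;; .add 32 6 34 ;; .const 33 q ;; mulProg ;; .const 8 0 ;; .add 8 8 31 ;;
    .const 32 0 ;; .add 32 32 1 ;; .const 33 0 ;; .add 33 33 1 ;; mulProg ;;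
    .const 9 0 ;; .add 9 9 31

theorem runs_paramProg {b q lam : ℕ} (hb : 0 < b) (σ : RAMState)
    (hlam : (σ.reg 0 * σ.reg 2 + σ.reg 38) / b = lam) :
    Runs (paramProg b q) σ (4 * σ.reg 0 + 4 * σ.reg 1 + 9 * lam + 40) (fun τ =>
      τ.reg 6 = lam ∧ τ.reg 7 = 4 * lam + 2 ∧ τ.reg 8 = (lam + 1) * q ∧
      τ.reg 9 = σ.reg 1 * σ.reg 1 ∧ τ.reg 35 = 2 * lam + 1) := by
  refine Runs.of_le (.const_seq (.add_seq (.const_seq (.add_seq (Runs.seq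
    (Runs.of_le (T' := 4 * σ.reg 0 + 2) (runs_mulProg _) ?_)
    fun σ₁ hag₁ h₁ => .add_seq (.const_seq (Runs.seq (Runs.of_le (T' := 5 * lam + 5)
    (runs_divProg _ ?_) ?_) fun σ₂ hag₂ h₂ =>
    .const_seq (.add_seq (.add_seq (.add_seq (.add_seq (.add_seq (.const_seq (Runs.seq
    (Runs.of_le (T' := 4 * (lam + 1) + 2) (runs_mulProg _) ?_) fun σ₃ hag₃ h₃ =>
    .const_seq (.add_seq (.const_seq (.add_seq (.const_seq (.add_seq (Runs.seq
    (Runs.of_le (T' := 4 * σ.reg 1 + 2) (runs_mulProg _) ?_) fun σ₄ hag₄ h₄ =>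
    .const_seq (.add ?_))))))))))))))))))))) ?_
  rotate_right
  · omega
  · simp
  · simpa using hb
  all_goals
    simp at h₁
    have e38 : σ₁.reg 38 = σ.reg 38 := by
      rw [hag₁.reg 38 (by simp [mulProg, RAMProg.SetsReg])]
      simp
  · simp [h₁, e38, hlam]
  all_goals
    simp [h₁, e38, hlam] at h₂
    obtain ⟨-, e29, e34⟩ := h₂
  · simp [e29, e34]
  all_goals
    simp [e29, e34] at h₃
    have e1 : σ₃.reg 1 = σ.reg 1 := by
      rw [hag₃.reg 1 (by simp [mulProg, RAMProg.SetsReg])]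
      simp
      rw [hag₂.reg 1 (by simp [divProg, RAMProg.SetsReg])]
      simp
      rw [hag₁.reg 1 (by simp [mulProg, RAMProg.SetsReg])]
      simp
  · simp [e1]
  · simp [e1] at h₄
    have e : ∀ x, x < 9 ∨ x = 35 → σ₄.reg x = if x = 8 then (lam + 1) * q else σ₃.reg x := by
      intro x hx
      rw [hag₄.reg x (by simp [mulProg, RAMProg.SetsReg]; omega)]
      simp [h₃, show x ≠ 33 by omega, show x ≠ 32 by omega]
      split_ifs <;> rfl
    have e' : ∀ x, x = 6 ∨ x = 7 ∨ x = 35 → σ₃.reg x =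
        if x = 6 then lam else if x = 7 then 4 * lam + 2 else 2 * lam + 1 := by
      intro x hx
      rw [hag₃.reg x (by simp [mulProg, RAMProg.SetsReg]; omega)]
      rcases hx with rfl | rfl | rfl <;> simp [e29, e34] <;> omega
    simp [e, e', h₄]

/-- Tabulates the powers of two and three, the place values of the system of colourings, and the
function `tab`. -/
def tableProg (N τ : ℕ) (tab : ℕ → ℕ) : RAMProg :=
  powerProg ;; radixProg N τ ;; weightProg ;; writeTable 9 tab (τ * N)

theorem runs_tableProg {q N τ₀ lam M : ℕ} {tab : ℕ → ℕ} (htab : ∀ i, τ₀ * N ≤ i → tab i = 0)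
    (hM : ∀ i < 4 * lam + 2, heapRadix lam N τ₀ i ≤ M) (σ : RAMState)
    (h6 : σ.reg 6 = lam) (h7 : σ.reg 7 = 4 * lam + 2) (h8 : σ.reg 8 = q)
    (h35 : σ.reg 35 = 2 * lam + 1) (h9 : ∀ i, σ.arr 9 i = 0) :
    Runs (tableProg N τ₀ tab) σ (9 * q + (2 * lam + 1) * (7 * lam + 17) +
        (4 * lam + 2) * (4 * M + 12) + 3 * (τ₀ * N) + 13) (fun τ =>
      τ.reg 10 = 3 ^ q ∧ τ.reg 11 = 2 ^ q ∧
      τ.reg 12 = placeValue (heapRadix lam N τ₀) (4 * lam + 2) ∧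
      (∀ i < 4 * lam + 2, τ.arr 3 i = placeValue (heapRadix lam N τ₀) i) ∧
      (∀ i < q, τ.arr 6 i = 3 ^ i) ∧ (∀ i < q, τ.arr 8 i = 2 ^ i) ∧ τ.arr 9 = tab) := by
  refine Runs.of_le (Runs.seq (runs_powerProg σ h8) fun σ₁ hag₁ h₁ => Runs.seq
    (runs_radixProg N τ₀ lam (2 * lam + 1) σ₁ ?_ ?_) fun σ₂ hag₂ h₂ => Runs.seq
    (runs_weightProg (Q := heapRadix lam N τ₀) hM σ₂ ?_ ?_) fun σ₃ hag₃ h₃ =>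
    (runs_writeTable 9 tab (τ₀ * N) σ₃).imp fun τ hag h => ?_) ?_
  rotate_right
  · omega
  · rw [hag₁.reg 6 (by simp [powerProg, RAMProg.SetsReg]), h6]
  · rw [hag₁.reg 35 (by simp [powerProg, RAMProg.SetsReg]), h35]
  · rw [hag₂.reg 7 (by simp [radixProg, RAMProg.SetsReg]),
      hag₁.reg 7 (by simp [powerProg, RAMProg.SetsReg]), h7]
  · exact fun i hi => h₂ i (by omega)
  · obtain ⟨k1, k2, k3⟩ := h₁
    have er : ∀ x, x = 10 ∨ x = 11 → τ.reg x = σ₁.reg x := fun x hx => by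
      rw [hag.reg x (writeTable_setsReg (by omega)),
        hag₃.reg x (by simp [weightProg, mulProg, RAMProg.SetsReg]; omega),
        hag₂.reg x (by simp [radixProg, RAMProg.SetsReg]; omega)]
    have ea : ∀ x, x = 6 ∨ x = 8 → τ.arr x = σ₁.arr x := fun x hx => by
      rw [hag.arr x (writeTable_setsArr (by omega)),
        hag₃.arr x (by simp [weightProg, mulProg, RAMProg.SetsArr]; omega),
        hag₂.arr x (by simp [radixProg, RAMProg.SetsArr]; omega)]
    refine ⟨by rw [er 10 (by norm_num), k1], by rw [er 11 (by norm_num), k2],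
      by rw [hag.reg 12 (writeTable_setsReg (by norm_num)), h₃.1], fun i hi => ?_,
      fun i hi => by rw [ea 6 (by norm_num), (k3 i hi).1],
      fun i hi => by rw [ea 8 (by norm_num), (k3 i hi).2], funext fun i => ?_⟩
    · rw [hag.arr 3 (writeTable_setsArr (by norm_num)), h₃.2 i hi]
    · rw [h i]
      split_ifs with hi
      · rfl
      · rw [hag₃.arr 9 (by simp [weightProg, mulProg, RAMProg.SetsArr]),
          hag₂.arr 9 (by simp [radixProg, RAMProg.SetsArr]),
          hag₁.arr 9 (by simp [powerProg, RAMProg.SetsArr]), h9, htab i (by omega)]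

/-- The algorithm for fair allocation that uses the program `B` for the subproblems of single
agents: it tries all colourings. -/
def allocProg (B : RAMProg) (b q τ : ℕ) (tab : ℕ → ℕ) : RAMProg :=
  (logProg ;; paramProg b q ;; tableProg (2 * b ^ 3) τ tab) ;;
    forLoop 13 12 5 (guessProg B q (2 * b ^ 3)) ;; .const 0 0 ;; .add 0 0 18

/-- A bound for the time of `allocProg`, where all radices are at most `M`. -/
def allocTime (B : RAMProg) (J : SbCFFA) (TB b q τ lam M : ℕ) : ℕ :=
  (4 * J.m + 5 + (4 * J.n + 4 * J.m + 9 * lam + 40 + (9 * ((lam + 1) * q) +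
    (2 * lam + 1) * (7 * lam + 17) + (4 * lam + 2) * (4 * M + 12) + 3 * (τ * (2 * b ^ 3)) + 13))) +
    (placeValue (heapRadix lam (2 * b ^ 3) τ) (4 * lam + 2) *
      (guessTime B J TB lam ((lam + 1) * q) M + 4) + 5)

theorem runs_allocProg {B : RAMProg} {J : SbCFFA} {TB b q τ₀ : ℕ}
    (T : PerfectTable (2 * b ^ 3) b q τ₀) (hb : 32 ≤ b) (hτ₀ : 0 < τ₀)
    (hB : SolvesSubproblems B J TB) :
    ∃ lg, 2 ^ lg ≤ 2 * J.m + 1 ∧ ∀ lam, (J.n * J.s + lg) / b = lam → ∀ M,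
      (∀ i < 4 * lam + 2, heapRadix lam (2 * b ^ 3) τ₀ i ≤ M) →
      Runs (allocProg B b q τ₀ T.tab) J.input (allocTime B J TB b q τ₀ lam M)
        (fun τ => τ.reg 0 ≠ 0 ↔ J.IsYes) := by
  have hN : 0 < 2 * b ^ 3 := by positivity
  obtain ⟨t₁, σ₁, hex₁, ht₁, hlg1, hlg2⟩ := runs_logProg J.input
  have hag₁ := hex₁.agree
  have hin1 : J.input.reg 1 = J.m := by simp [SbCFFA.input, registerList]
  rw [hin1] at ht₁ hlg1 hlg2
  refine ⟨σ₁.reg 38, hlg2, fun lam hlam M hM => ?_⟩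
  have hr₁ : ∀ x < 4, σ₁.reg x = J.input.reg x := fun x hx =>
    hag₁.reg x (by simp [logProg, RAMProg.SetsReg]; omega)
  have ha₁ : ∀ x, σ₁.arr x = J.input.arr x := fun x =>
    hag₁.arr x (by simp [logProg, RAMProg.SetsArr])
  have e0 : σ₁.reg 0 = J.n := by rw [hr₁ 0 (by norm_num)]; simp [SbCFFA.input, registerList]
  have e1 : σ₁.reg 1 = J.m := by rw [hr₁ 1 (by norm_num), hin1]
  have e2 : σ₁.reg 2 = J.s := by rw [hr₁ 2 (by norm_num)]; simp [SbCFFA.input, registerList]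
  -- the preparations
  have hsetup : Runs (paramProg b q ;; tableProg (2 * b ^ 3) τ₀ T.tab) σ₁
      (4 * J.n + 4 * J.m + 9 * lam + 40 + (9 * ((lam + 1) * q) +
        (2 * lam + 1) * (7 * lam + 17) + (4 * lam + 2) * (4 * M + 12) +
            3 * (τ₀ * (2 * b ^ 3)) + 13))
      (fun τ => (τ.reg 6 = lam ∧ τ.reg 7 = 4 * lam + 2 ∧ τ.reg 8 = (lam + 1) * q ∧
        τ.reg 9 = J.m * J.m) ∧ τ.reg 10 = 3 ^ ((lam + 1) * q) ∧ τ.reg 11 = 2 ^ ((lam + 1) * q) ∧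
        τ.reg 12 = placeValue (heapRadix lam (2 * b ^ 3) τ₀) (4 * lam + 2) ∧
        (∀ i < 4 * lam + 2, τ.arr 3 i = placeValue (heapRadix lam (2 * b ^ 3) τ₀) i) ∧
        (∀ i < (lam + 1) * q, τ.arr 6 i = 3 ^ i) ∧ (∀ i < (lam + 1) * q, τ.arr 8 i = 2 ^ i) ∧
        τ.arr 9 = T.tab) := by
    refine Runs.seq (T₁ := 4 * J.n + 4 * J.m + 9 * lam + 40) ((runs_paramProg (by omega) σ₁
      (by rw [e0, e2, hlam])).of_le (by rw [e0, e1])) fun τ hag h => ?_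
    obtain ⟨h6, h7, h8, h9, h35⟩ := h
    rw [e1] at h9
    refine (runs_tableProg T.eq_zero hM τ h6 h7 h8 h35 fun i => ?_).imp fun τ' hag' h' => ⟨?_, h'⟩
    · rw [hag.arr 9 (by simp [paramProg, divProg, mulProg, RAMProg.SetsArr]), ha₁]
      rfl
    · have : ∀ x, 6 ≤ x → x ≤ 9 → τ'.reg x = τ.reg x := fun x hx hx' => by
        refine hag'.reg x ?_
        simp [tableProg, powerProg, radixProg, weightProg, mulProg, RAMProg.SetsReg,
          writeTable_setsReg (x := x) (b := 9) (f := T.tab) (n := τ₀ * (2 * b ^ 3)) (by omega)]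
        omega
      rw [this 6 (by norm_num) (by norm_num), this 7 (by norm_num) (by norm_num),
        this 8 (by norm_num) (by norm_num), this 9 (by norm_num) (by norm_num)]
      exact ⟨h6, h7, h8, h9⟩
  obtain ⟨t₂, σ₂, hex₂, ht₂, ⟨h6, h7, h8, h9⟩, h10, h11, h12, k3, k6, k8, k9⟩ := hsetup
  have hex := hex₁.seq hex₂
  have hag := hex.agree
  have hr₂ : ∀ x, x < 4 ∨ 18 ≤ x ∧ x ≤ 19 ∨ x = 62 → σ₂.reg x = J.input.reg x := fun x hx =>
    hag.reg x (by
      simp [logProg, paramProg, divProg, tableProg, powerProg, radixProg, weightProg, mulProg,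
        RAMProg.SetsReg,
        writeTable_setsReg (x := x) (b := 9) (f := T.tab) (n := τ₀ * (2 * b ^ 3)) (by omega)]
      omega)
  have ha₂ : ∀ x, x < 2 ∨ 9 < x → σ₂.arr x = J.input.arr x := fun x hx =>
    hag.arr x (by
      simp [logProg, paramProg, divProg, tableProg, powerProg, radixProg, weightProg, mulProg,
        RAMProg.SetsArr,
        writeTable_setsArr (c := x) (b := 9) (f := T.tab) (n := τ₀ * (2 * b ^ 3)) (by omega)]
      omega)
  have hzero : ∀ x, 9 < x → ∀ i, σ₂.arr x i = 0 := fun x hx i => by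
    rw [ha₂ x (Or.inr hx)]
    obtain ⟨y, rfl⟩ : ∃ y, x = y + 2 := ⟨x - 2, by omega⟩
    rfl
  have hready : Ready J q (2 * b ^ 3) τ₀ T.tab lam σ₂ := by
    refine ⟨?_, ?_, ?_, ?_, h6, h7, h8, h9, h10, h11, h12, ?_, ?_, k3, k6, k8, k9⟩
    · rw [hr₂ 0 (by norm_num)]; rfl
    · rw [hr₂ 1 (by norm_num)]; rfl
    · rw [hr₂ 2 (by norm_num)]; rfl
    · rw [hr₂ 3 (by norm_num)]; rfl
    · rw [ha₂ 0 (by norm_num)]; rfl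
    · rw [ha₂ 1 (by norm_num)]; rfl
  have h18 : σ₂.reg 18 = 0 := by rw [hr₂ 18 (by norm_num)]; simp [SbCFFA.input, registerList]
  have hsearched : Searched J q (2 * b ^ 3) τ₀ T.tab lam 0 σ₂ :=
    ⟨by simp [h18], fun i _ => hzero 11 (by norm_num) i, fun c i => by
      rw [hzero _ (by omega)]; exact Nat.zero_le _⟩
  have hset : ∀ {j : ℕ} {τ : RAMState} {x v : ℕ}, (x ≠ 18 ∧ x ≠ 19 ∧ x ≠ 62) →
      Searched J q (2 * b ^ 3) τ₀ T.tab lam j τ →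
      Searched J q (2 * b ^ 3) τ₀ T.tab lam j (τ.setReg x v) := fun hx h =>
    ⟨by simpa [hx.1.symm] using h.result,
      fun i hi => h.fresh i (by simpa [hx.2.1.symm] using hi), h.stamps.setReg hx.2.2⟩
  have hsearch := Runs.seq (T₂ := 2) (q := .const 0 0 ;; .add 0 0 18)
    (Q := fun τ => τ.reg 0 ≠ 0 ↔ J.IsYes) (Runs.forLoop (i := 13) (N := 12) (t := 5)
    (body := guessProg B q (2 * b ^ 3)) (σ := σ₂)
    (T := guessTime B J TB lam ((lam + 1) * q) M) (Searched J q (2 * b ^ 3) τ₀ T.tab lam) h12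
    (by simp [guessProg_setsReg B q (2 * b ^ 3) (x := 13) (by norm_num),
      guessProg_setsReg B q (2 * b ^ 3) (x := 12) (by norm_num)])
    (fun _ _ _ h => hset (by norm_num) h) (fun _ _ _ h => hset (by norm_num) h) hsearched
    (fun c hc τ hag hτ h => ?_)) (fun τ hag h => .const_seq (.add ?_))
  · obtain ⟨t₃, σ₃, hex₃, ht₃, h₃⟩ := hsearch
    exact ⟨_, σ₃, hex.seq hex₃, by unfold allocTime; omega, h₃⟩
  · refine runs_guessProg hB hN hτ₀ T.lt hM τ (hready.agree hag ?_ ?_) hτ hc h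
    · intro x hx
      simp at hx
      simp [guessProg_setsReg B q (2 * b ^ 3) (x := x) (by omega)]
      omega
    · intro c hc
      simp at hc
      simp [guessProg_setsArr B q (2 * b ^ 3) (b := c) (by omega) (by omega)]
  · simp only [RAMState.setReg_reg, if_true, if_false, zero_add, show ¬ (18 = 0) by norm_num]
    rw [h.result]
    constructor
    · rintro ⟨c, -, X, -, h⟩
      exact h.isYes
    · intro hyes
      obtain ⟨S, hS, hSm, hcol⟩ := hyes.exists_set
      have hlt : J.n * J.s + σ₁.reg 38 < b * (lam + 1) := by
        rw [← hlam]
        exact Nat.lt_mul_div_succ _ (by omega)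
      obtain ⟨G, hG, hinj⟩ := exists_heapColor_injOn T hb hτ₀ lam S (by omega) fun x hx =>
        (hSm x hx).trans_le (hlg1.trans (Nat.pow_le_pow_right (by norm_num) (by omega)))
      obtain ⟨c, hc, hdig⟩ := exists_mixedDigit_eq (heapRadix_pos (lam := lam) hN hτ₀)
          G hG (4 * lam + 2)
      refine ⟨c, hc, hcol _ _ (fun x hx y hy hxy => hinj hx hy ?_) fun x => heapColor_lt T.lt _ x⟩
      rwa [guessColor, heapColor_congr hdig, heapColor_congr hdig] at hxy

/-! ### The running time -/

theorem RAMExec.one_le {p : RAMProg} {σ σ' : RAMState} {t : ℕ} (h : RAMExec p σ t σ') : 1 ≤ t := by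
  induction h <;> omega

theorem pow_four_le_two_pow (L : ℕ) : L ^ 4 ≤ 21 * 2 ^ L := by
  rcases le_total L 6 with h | h
  · interval_cases L <;> norm_num
  · induction L, h using Nat.le_induction with
    | base => norm_num
    | succ L hL ih =>
      obtain ⟨d, rfl⟩ := Nat.exists_eq_add_of_le hL
      have : 2 * (6 + d) ^ 4 =
          (6 + d + 1) ^ 4 + (d ^ 4 + 20 * d ^ 3 + 138 * d ^ 2 + 356 * d + 191) := by ring
      rw [pow_succ 2]
      omega

theorem heapRadix_le {lam N τ i : ℕ} (hi : i < 4 * lam + 2) :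
    heapRadix lam N τ i ≤ (8 * N + τ) * (lam + 1) ^ 3 := by
  have h1 : 1 ≤ (lam + 1) ^ 3 := Nat.one_le_pow _ _ (by omega)
  unfold heapRadix
  split_ifs
  · nlinarith
  · have h2 := succ_mul_heapCap_le lam (i / 2) (by omega)
    have h3 : heapCap lam (i / 2) ≤ 2 * (lam + 1) :=
      (Nat.le_mul_of_pos_left _ (Nat.succ_pos _)).trans h2
    have h4 := Nat.mul_le_mul_left N (Nat.pow_le_pow_left h3 3)
    calc N * heapCap lam (i / 2) ^ 3 ≤ N * (2 * (lam + 1)) ^ 3 := h4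
      _ = 8 * N * (lam + 1) ^ 3 := by ring
      _ ≤ _ := Nat.mul_le_mul_right _ (by omega)

/-- Up to a factor polynomial in the number of leaves and in the input, each colouring costs one
call of `B` for each ternary string. -/
theorem allocTime_le {B : RAMProg} {J : SbCFFA} {TB b q τ lam : ℕ} (hb : 0 < b) (hτ : 0 < τ)
    (hTB : 1 ≤ TB) :
    allocTime B J TB b q τ lam ((8 * (2 * b ^ 3) + τ) * (lam + 1) ^ 3) ≤
      (50 * q + B.regBound + 45 * (8 * (2 * b ^ 3) + τ) + 3 * (τ * (2 * b ^ 3)) + 500) *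
        (placeValue (heapRadix lam (2 * b ^ 3) τ) (4 * lam + 2) * 3 ^ ((lam + 1) * q) *
          ((lam + 1) ^ 4 * (J.n + J.m + 1) ^ 3 * TB)) := by
  have hW : 1 ≤ placeValue (heapRadix lam (2 * b ^ 3) τ) (4 * lam + 2) :=
    placeValue_pos (heapRadix_pos (by positivity) hτ) _
  have hE : 1 ≤ 3 ^ ((lam + 1) * q) := Nat.one_le_pow _ _ (by norm_num)
  unfold allocTime guessTime agentTime callTime
  generalize placeValue (heapRadix lam (2 * b ^ 3) τ) (4 * lam + 2) = W at *
  generalize 3 ^ ((lam + 1) * q) = E at *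
  generalize 8 * (2 * b ^ 3) + τ = A
  generalize τ * (2 * b ^ 3) = D
  generalize B.regBound = R
  have hn : J.n ≤ J.n + J.m + 1 := by omega
  have hm : J.m ≤ J.n + J.m + 1 := by omega
  have hV : 1 ≤ J.n + J.m + 1 := by omega
  generalize J.n + J.m + 1 = V at *
  generalize J.n = n at *
  generalize J.m = m at *
  obtain ⟨L, hL⟩ : ∃ L, L = lam + 1 := ⟨_, rfl⟩
  have hL1 : 1 ≤ L := by omega
  have hlam : lam ≤ L := by omega
  rw [← hL]
  have key : ∀ i j l, i ≤ 4 → j ≤ 3 → l ≤ 1 → L ^ i * V ^ j * TB ^ l ≤ L ^ 4 * V ^ 3 * TB := by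
    intro i j l hi hj hl
    calc L ^ i * V ^ j * TB ^ l ≤ L ^ 4 * V ^ 3 * TB ^ 1 := by gcongr
      _ = _ := by rw [pow_one]
  have h1 : 41 * (L * q) + (4 * TB + 7 * (m * m) + 12 * m + R + 20) + 24 ≤
      (41 * q + R + 67) * (L * V ^ 2 * TB) := by
    have key' : ∀ i j l, i ≤ 1 → j ≤ 2 → l ≤ 1 → L ^ i * V ^ j * TB ^ l ≤ L * V ^ 2 * TB := by
      intro i j l hi hj hl
      calc L ^ i * V ^ j * TB ^ l ≤ L ^ 1 * V ^ 2 * TB ^ 1 := by gcongr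
        _ = _ := by rw [pow_one, pow_one]
    generalize L * V ^ 2 * TB = Q at *
    calc 41 * (L * q) + (4 * TB + 7 * (m * m) + 12 * m + R + 20) + 24
        ≤ 41 * (L * q) + (4 * TB + 7 * (V * V) + 12 * V + R + 20) + 24 := by gcongr
      _ = 41 * q * (L ^ 1 * V ^ 0 * TB ^ 0) + 4 * (L ^ 0 * V ^ 0 * TB ^ 1) +
          7 * (L ^ 0 * V ^ 2 * TB ^ 0) + 12 * (L ^ 0 * V ^ 1 * TB ^ 0) +
          (R + 44) * (L ^ 0 * V ^ 0 * TB ^ 0) := by ring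
      _ ≤ 41 * q * Q + 4 * Q + 7 * Q + 12 * Q + (R + 44) * Q := by
          gcongr <;> exact key' _ _ _ (by norm_num) (by norm_num) (by norm_num)
      _ = _ := by ring
  have h2 : n * (E * (41 * (L * q) + (4 * TB + 7 * (m * m) + 12 * m + R + 20) + 24) + 8 + 4) ≤
      (41 * q + R + 79) * (E * (L ^ 4 * V ^ 3 * TB)) := by
    calc n * (E * (41 * (L * q) + (4 * TB + 7 * (m * m) + 12 * m + R + 20) + 24) + 8 + 4)
        ≤ V * (E * ((41 * q + R + 67) * (L * V ^ 2 * TB)) + 8 + 4) := by gcongr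
      _ = (41 * q + R + 67) * (E * (L ^ 1 * V ^ 3 * TB ^ 1)) +
        12 * (1 * (L ^ 0 * V ^ 1 * TB ^ 0)) := by
          ring
      _ ≤ (41 * q + R + 67) * (E * (L ^ 4 * V ^ 3 * TB)) + 12 * (E * (L ^ 4 * V ^ 3 * TB)) := by
          refine Nat.add_le_add (Nat.mul_le_mul_left _ (Nat.mul_le_mul_left _ ?_))
            (Nat.mul_le_mul_left _ (Nat.mul_le_mul hE ?_)) <;>
          exact key _ _ _ (by norm_num) (by norm_num) (by norm_num)
      _ = _ := by ring
  generalize L ^ 4 * V ^ 3 * TB = P at *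
  have h3 : m * (5 * m + L * (5 * (A * L ^ 3) + 30) + 4 * (A * L ^ 3) + 60) ≤ (9 * A + 95) * P := by
    calc m * (5 * m + L * (5 * (A * L ^ 3) + 30) + 4 * (A * L ^ 3) + 60)
        ≤ V * (5 * V + L * (5 * (A * L ^ 3) + 30) + 4 * (A * L ^ 3) + 60) := by gcongr
      _ = 5 * (L ^ 0 * V ^ 2 * TB ^ 0) + 5 * A * (L ^ 4 * V ^ 1 * TB ^ 0) +
          30 * (L ^ 1 * V ^ 1 * TB ^ 0) + 4 * A * (L ^ 3 * V ^ 1 * TB ^ 0) +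
          60 * (L ^ 0 * V ^ 1 * TB ^ 0) := by ring
      _ ≤ 5 * P + 5 * A * P + 30 * P + 4 * A * P + 60 * P := by
          gcongr <;> exact key _ _ _ (by norm_num) (by norm_num) (by norm_num)
      _ = _ := by ring
  have h4 : (4 * lam + 2) * (5 * (A * L ^ 3) + 14) + 24 ≤ (20 * A + 80) * P := by
    calc (4 * lam + 2) * (5 * (A * L ^ 3) + 14) + 24
        ≤ (4 * L) * (5 * (A * L ^ 3) + 14) + 24 := by
          gcongr
          omega
      _ = 20 * A * (L ^ 4 * V ^ 0 * TB ^ 0) + 56 * (L ^ 1 * V ^ 0 * TB ^ 0) +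
          24 * (L ^ 0 * V ^ 0 * TB ^ 0) := by ring
      _ ≤ 20 * A * P + 56 * P + 24 * P := by
          gcongr <;> exact key _ _ _ (by norm_num) (by norm_num) (by norm_num)
      _ = _ := by ring
  have h5 : 4 * m + 5 + (4 * n + 4 * m + 9 * lam + 40 +
      (9 * (L * q) + (2 * lam + 1) * (7 * lam + 17) +
      (4 * lam + 2) * (4 * (A * L ^ 3) + 12) + 3 * D + 13)) + 5 ≤
          (9 * q + 16 * A + 3 * D + 202) * P := by
    calc 4 * m + 5 + (4 * n + 4 * m + 9 * lam + 40 + (9 * (L * q) + (2 * lam + 1) * (7 * lam + 17) +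
          (4 * lam + 2) * (4 * (A * L ^ 3) + 12) + 3 * D + 13)) + 5
        ≤ 4 * V + 5 + (4 * V + 4 * V + 9 * L + 40 + (9 * (L * q) + (2 * L) * (17 * L) +
          (4 * L) * (4 * (A * L ^ 3) + 12) + 3 * D + 13)) + 5 := by
          gcongr <;> omega
      _ = 12 * (L ^ 0 * V ^ 1 * TB ^ 0) + (9 * q + 57) * (L ^ 1 * V ^ 0 * TB ^ 0) +
          34 * (L ^ 2 * V ^ 0 * TB ^ 0) + 16 * A * (L ^ 4 * V ^ 0 * TB ^ 0) +
          (3 * D + 63) * (L ^ 0 * V ^ 0 * TB ^ 0) := by ring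
      _ ≤ 12 * P + (9 * q + 57) * P + 34 * P + 16 * A * P + (3 * D + 63) * P := by
          gcongr <;> exact key _ _ _ (by norm_num) (by norm_num) (by norm_num)
      _ ≤ _ := by
          ring_nf
          omega
  have hPE : P ≤ E * P := Nat.le_mul_of_pos_left _ hE
  have hPW : P ≤ W * (E * P) := hPE.trans (Nat.le_mul_of_pos_left _ hW)
  calc _ = (4 * m + 5 + (4 * n + 4 * m + 9 * lam + 40 +
    (9 * (L * q) + (2 * lam + 1) * (7 * lam + 17) +
        (4 * lam + 2) * (4 * (A * L ^ 3) + 12) + 3 * D + 13)) + 5) +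
        W * (n * (E * (41 * (L * q) + (4 * TB + 7 * (m * m) + 12 * m + R + 20) + 24) + 8 + 4) +
          m * (5 * m + L * (5 * (A * L ^ 3) + 30) + 4 * (A * L ^ 3) + 60) +
          ((4 * lam + 2) * (5 * (A * L ^ 3) + 14) + 24)) := by ring
    _ ≤ (9 * q + 16 * A + 3 * D + 202) * (W * (E * P)) +
        W * ((41 * q + R + 79) * (E * P) + (9 * A + 95) * (E * P) + (20 * A + 80) * (E * P)) := by
        exact Nat.add_le_add (h5.trans (Nat.mul_le_mul_left _ hPW)) (Nat.mul_le_mul_left _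
          (Nat.add_le_add (Nat.add_le_add h2 (h3.trans (Nat.mul_le_mul_left _ hPE)))
            (h4.trans (Nat.mul_le_mul_left _ hPE))))
    _ = (50 * q + R + 45 * A + 3 * D + 456) * (W * E * P) := by ring
    _ ≤ _ := by
        gcongr
        norm_num

theorem one_le_rpow_logb (k : ℕ) : 1 ≤ (k : ℝ) ^ Real.logb 2 (k : ℝ) := by
  rcases Nat.eq_zero_or_pos k with rfl | hk
  · simp
  · have : (1 : ℝ) ≤ k := by exact_mod_cast hk
    exact Real.one_le_rpow this (Real.logb_nonneg (by norm_num) this)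

/-- The number of colourings times the number of ternary strings, together with the polynomial
overhead in the number of leaves. Each leaf contributes at most `(3 * e) ^ b / 2`, and the spare
factor `2 ^ (lam + 1)` outweighs the overhead. The exponent `b * (lam + 1)` exceeds `k` by at most
`b + lg`, and `(3 * e) ^ lg` is polynomial in `m` because of `3 * e ≤ 2 ^ 4`. -/
theorem guesses_mul_strings_le {b q τ m k lg lam : ℕ} (hb : 0 < b) (hτ : 0 < τ)
    (hcost : ((2 * b ^ 3 : ℕ) : ℝ) ^ 4 * Real.exp 12 * τ * 3 ^ q ≤ (3 * Real.exp 1) ^ b / 2)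
    (hlg : 2 ^ lg ≤ 2 * m + 1) (hlam : (k + lg) / b = lam) :
    ((placeValue (heapRadix lam (2 * b ^ 3) τ) (4 * lam + 2) * 3 ^ ((lam + 1) * q) *
      (lam + 1) ^ 4 : ℕ) : ℝ) ≤
      336 * (3 * Real.exp 1) ^ b * (3 * Real.exp 1) ^ k * ((m : ℝ) + 1) ^ 4 := by
  have he1 : 1 ≤ 3 * Real.exp 1 := by
    have := Real.add_one_le_exp (1 : ℝ)
    linarith
  have he16 : 3 * Real.exp 1 ≤ 2 ^ 4 := by
    have := Real.exp_one_lt_d9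
    norm_num
    linarith
  have hL : ((lam + 1 : ℕ) : ℝ) ^ 4 ≤ 21 * 2 ^ (lam + 1) := by
    exact_mod_cast pow_four_le_two_pow (lam + 1)
  have hbL : b * (lam + 1) ≤ b + k + lg := by
    have := Nat.div_mul_le_self (k + lg) b
    rw [hlam] at this
    nlinarith
  have h1 : (placeValue (heapRadix lam (2 * b ^ 3) τ) (4 * lam + 2) : ℝ) * 3 ^ ((lam + 1) * q) ≤
      (3 * Real.exp 1) ^ (b * (lam + 1)) / 2 ^ (lam + 1) := by
    calc (placeValue (heapRadix lam (2 * b ^ 3) τ) (4 * lam + 2) : ℝ) * 3 ^ ((lam + 1) * q)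
        ≤ (((2 * b ^ 3 : ℕ) : ℝ) ^ 4 * Real.exp 12 * τ) ^ (lam + 1) * 3 ^ ((lam + 1) * q) := by
          gcongr
          exact placeValue_heapRadix_le (by positivity) hτ
      _ = (((2 * b ^ 3 : ℕ) : ℝ) ^ 4 * Real.exp 12 * τ * 3 ^ q) ^ (lam + 1) := by
          rw [mul_pow _ ((3 : ℝ) ^ q), ← pow_mul, mul_comm q]
      _ ≤ ((3 * Real.exp 1) ^ b / 2) ^ (lam + 1) := by gcongr
      _ = _ := by rw [div_pow, ← pow_mul]
  have h2 : (3 * Real.exp 1) ^ lg ≤ 16 * ((m : ℝ) + 1) ^ 4 := by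
    have h3 : ((2 : ℝ) ^ lg) ≤ 2 * m + 1 := by exact_mod_cast hlg
    calc (3 * Real.exp 1) ^ lg ≤ (2 ^ 4) ^ lg := by gcongr
      _ = (2 ^ lg) ^ 4 := by rw [← pow_mul, ← pow_mul, mul_comm]
      _ ≤ (2 * ((m : ℝ) + 1)) ^ 4 := by
          gcongr
          linarith
      _ = _ := by ring
  push_cast
  push_cast at hL
  calc (placeValue (heapRadix lam (2 * b ^ 3) τ) (4 * lam + 2) : ℝ) * 3 ^ ((lam + 1) * q) *
      ((lam : ℝ) + 1) ^ 4
      ≤ (3 * Real.exp 1) ^ (b * (lam + 1)) / 2 ^ (lam + 1) * (21 * 2 ^ (lam + 1)) := by gcongr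
    _ = 21 * (3 * Real.exp 1) ^ (b * (lam + 1)) := by
        field_simp
    _ ≤ 21 * (3 * Real.exp 1) ^ (b + k + lg) := by gcongr
    _ = 21 * (3 * Real.exp 1) ^ b * (3 * Real.exp 1) ^ k * (3 * Real.exp 1) ^ lg := by
        rw [pow_add, pow_add]; ring
    _ ≤ 21 * (3 * Real.exp 1) ^ b * (3 * Real.exp 1) ^ k * (16 * ((m : ℝ) + 1) ^ 4) := by gcongr
    _ = _ := by ring

theorem mainTheorem2 (𝒢 : GraphFamily) (h𝒢 : 𝒢.Hereditary) (h : ℕ → ℝ)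
    (hB : ∃ (B : RAMProg) (c : ℕ), ∀ I : SbMWIS, 𝒢 I.m I.G →
      B.DecidesWithin I.input I.IsYes (h I.k * ((I.m : ℝ) + 1) ^ c)) :
    ∃ (P : RAMProg) (C : ℝ) (c : ℕ), ∀ J : SbCFFA, 𝒢 J.m J.H →
      P.DecidesWithin J.input J.IsYes
        (C * (3 * Real.exp 1) ^ (J.n * J.s) *
          ((J.n * J.s : ℕ) : ℝ) ^ Real.logb 2 ((J.n * J.s : ℕ) : ℝ) *
          h J.s * ((J.n : ℝ) + (J.m : ℝ) + 1) ^ c) := by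
  obtain ⟨B, c, hB⟩ := hB
  obtain ⟨b, q, τ, hb, hτ, ⟨T⟩, hcost⟩ := exists_block_constants
  set D : ℕ := 50 * q + B.regBound + 45 * (8 * (2 * b ^ 3) + τ) + 3 * (τ * (2 * b ^ 3)) + 500
    with hD
  refine ⟨allocProg B b q τ T.tab, D * (336 * (3 * Real.exp 1) ^ b), c + 7, fun J hJ => ?_⟩
  set X : ℝ := h J.s * ((J.m : ℝ) + 1) ^ c with hX
  have hsub : ∀ u col Z,
      B.DecidesWithin (J.subproblem u col Z).input (J.subproblem u col Z).IsYes X :=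
    fun u col Z => hB (J.subproblem u col Z) hJ
  -- every run takes at least one step, so the hypothesis forces the bound to be at least one
  have hX1 : 1 ≤ X := by
    obtain ⟨t, σ, hex, ht, -⟩ := hsub (fun _ => 0) (fun _ => 0) ∅
    have : (1 : ℝ) ≤ t := by exact_mod_cast hex.one_le
    linarith
  have hs : 0 ≤ h J.s := by
    by_contra! hneg
    have : X ≤ 0 := mul_nonpos_of_nonpos_of_nonneg hneg.le (by positivity)
    linarith
  have hsolves : SolvesSubproblems B J ⌊X⌋₊ := fun u col Z => by
    obtain ⟨t, τ, hex, ht, h⟩ := hsub u col Z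
    exact ⟨t, τ, hex, Nat.le_floor ht, h⟩
  obtain ⟨lg, hlg, hrun⟩ := runs_allocProg T hb hτ hsolves
  obtain ⟨t, σ, hex, ht, hyes⟩ := hrun _ rfl _ fun i hi => heapRadix_le hi
  refine ⟨t, σ, hex, ?_, hyes⟩
  have h1 := guesses_mul_strings_le (by omega) hτ hcost hlg (lam := (J.n * J.s + lg) / b) rfl
  have h2 := ht.trans (allocTime_le (by omega) hτ (Nat.le_floor (by exact_mod_cast hX1)))
  set lam := (J.n * J.s + lg) / b
  have h3 := one_le_rpow_logb (J.n * J.s)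
  set K : ℝ := ((J.n * J.s : ℕ) : ℝ) ^ Real.logb 2 ((J.n * J.s : ℕ) : ℝ)
  set W := placeValue (heapRadix lam (2 * b ^ 3) τ) (4 * lam + 2) * 3 ^ ((lam + 1) * q) with hW
  have hV : ((J.m : ℝ) + 1) ≤ (J.n : ℝ) + J.m + 1 := by
    have : (0 : ℝ) ≤ J.n := Nat.cast_nonneg _
    linarith
  have hXV : X ≤ h J.s * ((J.n : ℝ) + J.m + 1) ^ c := by
    rw [hX]
    gcongr
  calc (t : ℝ) ≤ (D * (W * ((lam + 1) ^ 4 * (J.n + J.m + 1) ^ 3 * ⌊X⌋₊)) : ℕ) := by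
        exact_mod_cast h2
    _ = D * ((W * (lam + 1) ^ 4 : ℕ) : ℝ) * ((J.n : ℝ) + J.m + 1) ^ 3 * (⌊X⌋₊ : ℝ) := by
        push_cast; ring
    _ ≤ D * (336 * (3 * Real.exp 1) ^ b * (3 * Real.exp 1) ^ (J.n * J.s) * ((J.m : ℝ) + 1) ^ 4) *
        ((J.n : ℝ) + J.m + 1) ^ 3 * X := by
        gcongr
        exact Nat.floor_le (by linarith)
    _ ≤ D * (336 * (3 * Real.exp 1) ^ b * (3 * Real.exp 1) ^ (J.n * J.s) *
        ((J.n : ℝ) + J.m + 1) ^ 4) * ((J.n : ℝ) + J.m + 1) ^ 3 *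
        (h J.s * ((J.n : ℝ) + J.m + 1) ^ c) := by gcongr
    _ = D * (336 * (3 * Real.exp 1) ^ b) * (3 * Real.exp 1) ^ (J.n * J.s) * 1 * h J.s *
        ((J.n : ℝ) + J.m + 1) ^ (c + 7) := by ring
    _ ≤ _ := by gcongr
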